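/- Let $K$ be a field extension of $\mathbb{R}$ (for instance $\mathbb{R}$, $\mathbb{C}$ or $\mathbb{C}((h))$) and let $h\in K$, $h\neq 0$. Let $\mathcal U_h(\mathrm{sl}(2))$ be the associative unital $K$-algebra generated by $H,Y,T,T^{-1}$ with relations $TT^{-1}=T^{-1}T=1$, $[H,T]=T^2-1$, $[T,Y]=\frac h2(HT+TH)$, $[H,Y]=-\frac12\big(Y(T+T^{-1})+(T+T^{-1})Y\big)$; with $T=e^{hX}$ these are $[H,X]=2\frac{\sinh hX}{h}$, $[X,Y]=H$, $[H,Y]=-Y\cosh hX-\cosh hX\,Y$. Its comultiplication is $\Delta(H)=H\otimes T+T^{-1}\otimes H$, $\Delta(Y)=Y\otimes T+T^{-1}\otimes Y$, $\Delta(T)=T\otimes T$ (that is, $\Delta(X)=X\otimes 1+1\otimes X$), and it defines tensor products of representations. For $2j\in\mathbb{Z}_{\ge 0}$ let $V^{(j)}$ be the $K$-space with basis $e^j_m$, $m=-j,-j+1,\dots,j$, and let $He^j_m=2m\,e^j_m$, $Z_\pm e^j_m=\sqrt{(j\mp m)(j\pm m+1)}\,e^j_{m\pm1}$. Then $\mathcal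 U_h(\mathrm{sl}(2))$ acts on $V^{(j)}$ by this $H$, by $T=e^{hX}=(1+\frac h2Z_+)(1-\frac h2Z_+)^{-1}$ and by $Y=(\cosh\frac{hX}{2})^{-1}Z_-(\cosh\frac{hX}{2})^{-1}$, where $(\cosh\frac{hX}{2})^{-1}=(1-\frac{h^2}{4}Z_+^2)^{1/2}$ is the binomial series in the nilpotent operator $Z_+$; equivalently $Z_+=\frac2h\tanh\frac{hX}2$ and $Z_-=(\cosh\frac{hX}2)Y(\cosh\frac{hX}2)$. Put $\alpha_{j,m}=\sqrt{(j+m)!/(j-m)!}$. With $(x)_n=x(x+1)\cdots(x+n-1)$, $(x)_0=1$, put $$b^{m_1,m_2}_{k,l}=\frac{(-2m_1-k)_l\,(-2m_2-l)_k}{k!\,l!}\ \text{ if } k,l\ge 0,\qquad b^{m_1,m_2}_{k,l}=0\ \text{ otherwise,}$$ $$a^{m_1,m_2}_{k,l}=(-1)^k\left(\tfrac h2\right)^{k+l}\left(b^{m_1,m_2}_{k,l}-b^{m_1,m_2}_{k-1,l-1}\right),\qquad A^{m_1,m_2}_{k,l}=a^{m_1,m_2}_{k,l}\,\frac{\alpha_{j_1,m_1+k}\,\alpha_{j_2,m_2+l}}{\alpha_{j_1,m_1}\,\alpha_{j_2,m_2}}.$$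 Proposition. The representations $V^{(j)}$ are irreducible, and for all $2j_1,2j_2\in\mathbb{Z}_{\ge 0}$ there is an isomorphism of representations of $\mathcal U_h(\mathrm{sl}(2))$ $$V^{(j_1)}\otimes V^{(j_2)}\cong\bigoplus_{j=|j_1-j_2|}^{j_1+j_2}V^{(j)}$$ ($j$ increases in steps of $1$) under which $e^j_m\in V^{(j)}$ corresponds to $$e^{(j_1j_2)j}_m=\sum_{n_1,n_2}\mathcal C^{j_1,j_2,j}_{n_1,n_2,m}(h)\;e^{j_1}_{n_1}\otimes e^{j_2}_{n_2},\qquad \mathcal C^{j_1,j_2,j}_{n_1,n_2,m}(h)=\sum_{m_1+m_2=m}C^{j_1,j_2,j}_{m_1,m_2,m}\,A^{m_1,m_2}_{n_1-m_1,\,n_2-m_2},$$ where $C^{j_1,j_2,j}_{m_1,m_2,m}$ are the usual $\mathrm{su}(2)$ Clebsch-Gordan coefficients (Condon-Shortley convention). These Clebsch-Gordan coefficients are unique up to normalization: if an isomorphism of representations as above sends each $e^j_m$ to $\sum_{n_1,n_2}\mathcal D^{j_1,j_2,j}_{n_1,n_2,m}\,e^{j_1}_{n_1}\otimes e^{j_2}_{n_2}$,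 then there are non-zero $c_j\in K$ with $\mathcal D^{j_1,j_2,j}_{n_1,n_2,m}=c_j\,\mathcal C^{j_1,j_2,j}_{n_1,n_2,m}(h)$ for all $j,m,n_1,n_2$. -/

import Mathlib

open scoped TensorProduct DirectSum Nat

noncomputable section

namespace Jordanian

/-! ### The Jordanian quantum algebra and its comultiplication -/

/-- Generators of `U_h(sl(2))`; `Tinv` stands for `T⁻¹`. -/
inductive Gen : Type
  | H | Y | T | Tinv

section Algebra

variable {K : Type*} [Field K]

/-- The generators inside the free algebra. -/
abbrev fg (K : Type*) [Field K] (g : Gen) : FreeAlgebra K Gen := FreeAlgebra.ι K g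

/-- The quadratic defining relations of `U_h(sl(2))`. With `T = exp (h X)` they are
`[H, X] = 2 sinh (h X) / h`, `[X, Y] = H`, `[H, Y] = - Y cosh (h X) - cosh (h X) Y`,
where `cosh (h X) = (T + T⁻¹) / 2`. -/
inductive Rel (h : K) : FreeAlgebra K Gen → FreeAlgebra K Gen → Prop
  | T_Tinv : Rel h (fg K .T * fg K .Tinv) 1
  | Tinv_T : Rel h (fg K .Tinv * fg K .T) 1
  | H_T : Rel h (fg K .H * fg K .T - fg K .T * fg K .H) (fg K .T * fg K .T - 1)
  | T_Y : Rel h (fg K .T * fg K .Y - fg K .Y * fg K .T)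
      ((h / 2) • (fg K .H * fg K .T + fg K .T * fg K .H))
  | H_Y : Rel h (fg K .H * fg K .Y - fg K .Y * fg K .H)
      (-((1 / 2 : K) • (fg K .Y * (fg K .T + fg K .Tinv) + (fg K .T + fg K .Tinv) * fg K .Y)))

/-- The algebra `U_h(sl(2))` over `K`. -/
abbrev Uh (h : K) : Type _ := RingQuot (Rel h)

/-- The generators of `U_h(sl(2))`. -/
def gen (h : K) (g : Gen) : Uh h := RingQuot.mkAlgHom K (Rel h) (fg K g)

/-- The universal property: elements `H, Y, T, T⁻¹` of an algebra which satisfy the relations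
define a homomorphism from `U_h(sl(2))`. -/
def liftUh (h : K) {A : Type*} [Ring A] [Algebra K A] (H Y T T' : A)
    (h1 : T * T' = 1) (h2 : T' * T = 1) (h3 : H * T - T * H = T * T - 1)
    (h4 : T * Y - Y * T = (h / 2) • (H * T + T * H))
    (h5 : H * Y - Y * H = -((1 / 2 : K) • (Y * (T + T') + (T + T') * Y))) :
    Uh h →ₐ[K] A :=
  RingQuot.liftAlgHom K ⟨FreeAlgebra.lift K (fun g => match g with
      | .H => H | .Y => Y | .T => T | .Tinv => T'), by
    intro x y r
    cases r <;> simp [fg, h1, h2, h3, h4, h5, -neg_smul]⟩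

theorem gen_T_Tinv (h : K) : gen h .T * gen h .Tinv = 1 := by
  simpa [gen] using RingQuot.mkAlgHom_rel K (Rel.T_Tinv (h := h))

theorem gen_Tinv_T (h : K) : gen h .Tinv * gen h .T = 1 := by
  simpa [gen] using RingQuot.mkAlgHom_rel K (Rel.Tinv_T (h := h))

theorem gen_H_T (h : K) :
    gen h .H * gen h .T - gen h .T * gen h .H = gen h .T * gen h .T - 1 := by
  simpa [gen] using RingQuot.mkAlgHom_rel K (Rel.H_T (h := h))

theorem gen_T_Y (h : K) : gen h .T * gen h .Y - gen h .Y * gen h .T =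
    (h / 2) • (gen h .H * gen h .T + gen h .T * gen h .H) := by
  simpa [gen] using RingQuot.mkAlgHom_rel K (Rel.T_Y (h := h))

theorem gen_H_Y (h : K) : gen h .H * gen h .Y - gen h .Y * gen h .H =
    -((1 / 2 : K) • (gen h .Y * (gen h .T + gen h .Tinv)
      + (gen h .T + gen h .Tinv) * gen h .Y)) := by
  simpa [gen] using RingQuot.mkAlgHom_rel K (Rel.H_Y (h := h))

theorem two_ne_zero' (K : Type*) [Field K] [Algebra ℝ K] : (2 : K) ≠ 0 := by
  have := (algebraMap ℝ K).injective.ne (two_ne_zero (α := ℝ))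
  rwa [map_ofNat, map_zero] at this

/-- The coproducts of the generators again satisfy the defining relations. -/
theorem comul_rel [Algebra ℝ K] (h : K) {A : Type*} [Ring A] [Algebra K A] (H Y T T' : A)
    (h1 : T * T' = 1) (h2 : T' * T = 1) (h3 : H * T - T * H = T * T - 1)
    (h4 : T * Y - Y * T = (h / 2) • (H * T + T * H))
    (h5 : H * Y - Y * H = -((1 / 2 : K) • (Y * (T + T') + (T + T') * Y))) :
    (H ⊗ₜ[K] T + T' ⊗ₜ[K] H) * (T ⊗ₜ[K] T) - (T ⊗ₜ[K] T) * (H ⊗ₜ[K] T + T' ⊗ₜ[K] H)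
        = (T ⊗ₜ[K] T) * (T ⊗ₜ[K] T) - 1 ∧
    (T ⊗ₜ[K] T) * (Y ⊗ₜ[K] T + T' ⊗ₜ[K] Y) - (Y ⊗ₜ[K] T + T' ⊗ₜ[K] Y) * (T ⊗ₜ[K] T)
        = (h / 2) • ((H ⊗ₜ[K] T + T' ⊗ₜ[K] H) * (T ⊗ₜ[K] T)
            + (T ⊗ₜ[K] T) * (H ⊗ₜ[K] T + T' ⊗ₜ[K] H)) ∧
    (H ⊗ₜ[K] T + T' ⊗ₜ[K] H) * (Y ⊗ₜ[K] T + T' ⊗ₜ[K] Y)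
        - (Y ⊗ₜ[K] T + T' ⊗ₜ[K] Y) * (H ⊗ₜ[K] T + T' ⊗ₜ[K] H)
        = -((1 / 2 : K) • ((Y ⊗ₜ[K] T + T' ⊗ₜ[K] Y) * (T ⊗ₜ[K] T + T' ⊗ₜ[K] T')
            + (T ⊗ₜ[K] T + T' ⊗ₜ[K] T') * (Y ⊗ₜ[K] T + T' ⊗ₜ[K] Y))) := by
  have two : (2 : K) ≠ 0 := two_ne_zero' K
  have r3 : H * T = T * H + T * T - 1 := by rw [← sub_eq_zero] at h3 ⊢; rw [← h3]; abel
  have r3' : H * T' = T' * H + T' * T' - 1 := by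
    have e : T' * (H * T - T * H) * T' = T' * (T * T - 1) * T' := by rw [h3]
    have e1 : T' * (H * T - T * H) * T' = T' * H - H * T' := by
      calc _ = T' * H * (T * T') - (T' * T) * (H * T') := by noncomm_ring
        _ = _ := by rw [h1, h2]; simp
    have e2 : T' * (T * T - 1) * T' = 1 - T' * T' := by
      calc _ = (T' * T) * (T * T') - T' * T' := by noncomm_ring
        _ = _ := by rw [h1, h2]; simp
    rw [e1, e2] at e
    rw [← sub_eq_zero] at e ⊢; rw [← neg_eq_zero, ← e]; abel
  have r4 : Y * T = T * Y - (h / 2) • (T * H + T * T - 1 + T * H) := by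
    rw [r3] at h4; rw [← h4]; abel
  have r4' : Y * T' = T' * Y + (h / 2) • (T' * H + T' * T' - 1 + T' * H) := by
    have e : T' * (T * Y - Y * T) * T' = T' * ((h / 2) • (H * T + T * H)) * T' := by rw [h4]
    have e1 : T' * (T * Y - Y * T) * T' = Y * T' - T' * Y := by
      calc _ = (T' * T) * (Y * T') - (T' * Y) * (T * T') := by noncomm_ring
        _ = _ := by rw [h1, h2]; simp
    have e2 : T' * ((h / 2) • (H * T + T * H)) * T' = (h / 2) • (T' * H + H * T') := by
      rw [mul_smul_comm, smul_mul_assoc]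
      congr 1
      calc _ = (T' * H) * (T * T') + (T' * T) * (H * T') := by noncomm_ring
        _ = _ := by rw [h1, h2]; simp
    rw [e1, e2, r3'] at e
    rw [sub_eq_iff_eq_add] at e
    rw [e]; abel_nf
  have r5 : H * Y = Y * H - (1 / 2 : K) • (Y * T + Y * T' + T * Y + T' * Y) := by
    rw [sub_eq_iff_eq_add] at h5; rw [h5, mul_add, add_mul]; module
  refine ⟨?_, ?_, ?_⟩
  · simp only [mul_add, add_mul, Algebra.TensorProduct.tmul_mul_tmul, r3, h1, h2,
      TensorProduct.add_tmul, TensorProduct.tmul_add, TensorProduct.sub_tmul,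
      TensorProduct.tmul_sub, Algebra.TensorProduct.one_def]
    abel
  · simp only [mul_add, add_mul, Algebra.TensorProduct.tmul_mul_tmul, r4, r3, h1, h2,
      TensorProduct.add_tmul, TensorProduct.tmul_add, TensorProduct.sub_tmul,
      TensorProduct.tmul_sub, ← TensorProduct.smul_tmul', TensorProduct.tmul_smul]
    module
  · simp only [mul_add, add_mul, Algebra.TensorProduct.tmul_mul_tmul, r5, r4, r4', r3, r3', h1, h2,
      TensorProduct.add_tmul, TensorProduct.tmul_add, TensorProduct.sub_tmul,
      TensorProduct.tmul_sub, ← TensorProduct.smul_tmul', TensorProduct.tmul_smul]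
    match_scalars <;> field

/-- The comultiplication `Δ(H) = H ⊗ T + T⁻¹ ⊗ H`, `Δ(Y) = Y ⊗ T + T⁻¹ ⊗ Y`, `Δ(T) = T ⊗ T`
(equivalently `Δ(X) = X ⊗ 1 + 1 ⊗ X`). -/
def comul [Algebra ℝ K] (h : K) : Uh h →ₐ[K] Uh h ⊗[K] Uh h :=
  liftUh h
    (gen h .H ⊗ₜ[K] gen h .T + gen h .Tinv ⊗ₜ[K] gen h .H)
    (gen h .Y ⊗ₜ[K] gen h .T + gen h .Tinv ⊗ₜ[K] gen h .Y)
    (gen h .T ⊗ₜ[K] gen h .T)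
    (gen h .Tinv ⊗ₜ[K] gen h .Tinv)
    (by simp [Algebra.TensorProduct.tmul_mul_tmul, gen_T_Tinv, Algebra.TensorProduct.one_def])
    (by simp [Algebra.TensorProduct.tmul_mul_tmul, gen_Tinv_T, Algebra.TensorProduct.one_def])
    (comul_rel h _ _ _ _ (gen_T_Tinv h) (gen_Tinv_T h) (gen_H_T h) (gen_T_Y h) (gen_H_Y h)).1
    (comul_rel h _ _ _ _ (gen_T_Tinv h) (gen_Tinv_T h) (gen_H_T h) (gen_T_Y h) (gen_H_Y h)).2.1
    (comul_rel h _ _ _ _ (gen_T_Tinv h) (gen_Tinv_T h) (gen_H_T h) (gen_T_Y h) (gen_H_Y h)).2.2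

/-- The tensor product of two representations of `U_h(sl(2))`, formed with the comultiplication. -/
def tensorRep [Algebra ℝ K] (h : K) {V W : Type*} [AddCommGroup V] [Module K V]
    [AddCommGroup W] [Module K W]
    (ρ : Uh h →ₐ[K] Module.End K V) (σ : Uh h →ₐ[K] Module.End K W) :
    Uh h →ₐ[K] Module.End K (V ⊗[K] W) :=
  Module.endTensorEndAlgHom.comp ((Algebra.TensorProduct.map ρ σ).comp (comul h))

end Algebra

/-! ### The finite-dimensional irreducible representations

A spin `j` is given by the natural number `d = 2 j`, and a weight `m ∈ {-j, …, j}` by the natural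
number `j + m ∈ {0, …, d}`. -/

section Irreps

/-- The space of `V^(j)`, where `d = 2 j`. -/
abbrev V (K : Type*) (d : ℕ) : Type _ := Fin (d + 1) → K

variable (K : Type*) [Field K]

/-- The vector `e^j_m` of `V^(j)`, where `d = 2 j` and `r = j + m`; it is `0` if `m > j`. -/
def e (d r : ℕ) : V K d := fun i => if (i : ℕ) = r then 1 else 0

theorem e_eq_basis (d : ℕ) (r : Fin (d + 1)) : Pi.basisFun K (Fin (d + 1)) r = e K d r := by
  ext i
  simp [e, Pi.single_apply, Fin.ext_iff]

theorem e_eq_zero {d r : ℕ} (hr : d < r) : e K d r = 0 := by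
  ext i
  have := i.isLt
  simp only [e, Pi.zero_apply, ite_eq_right_iff, one_ne_zero, imp_false]
  omega

theorem V_hom_ext {K : Type*} [Field K] {d : ℕ} {W : Type*} [AddCommGroup W] [Module K W]
    {f g : V K d →ₗ[K] W} (hfg : ∀ r ≤ d, f (e K d r) = g (e K d r)) : f = g :=
  (Pi.basisFun K (Fin (d + 1))).ext fun i => by
    rw [e_eq_basis]; exact hfg i (by have := i.isLt; omega)

/-- `H e^j_m = 2 m e^j_m`. -/
def opH (d : ℕ) : Module.End K (V K d) :=
  (Pi.basisFun K (Fin (d + 1))).constr K fun r => (2 * ((r : ℕ) : K) - (d : K)) • e K d r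

theorem opH_e (d r : ℕ) : opH K d (e K d r) = (2 * (r : K) - (d : K)) • e K d r := by
  rcases lt_or_ge d r with hr | hr
  · simp [e_eq_zero K hr]
  · have := (Pi.basisFun K (Fin (d + 1))).constr_basis K
      (fun r => (2 * ((r : ℕ) : K) - (d : K)) • e K d r) ⟨r, by omega⟩
    rwa [e_eq_basis] at this

variable [Algebra ℝ K]

/-- `Z_+ e^j_m = √((j - m) (j + m + 1)) e^j_{m+1}`. -/
def opZp (d : ℕ) : Module.End K (V K d) :=
  (Pi.basisFun K (Fin (d + 1))).constr K fun r =>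
    algebraMap ℝ K (√(((d : ℝ) - (r : ℕ)) * ((r : ℕ) + 1))) • e K d (r + 1)

/-- `Z_- e^j_m = √((j + m) (j - m + 1)) e^j_{m-1}`. -/
def opZm (d : ℕ) : Module.End K (V K d) :=
  (Pi.basisFun K (Fin (d + 1))).constr K fun r =>
    algebraMap ℝ K (√(((r : ℕ) : ℝ) * ((d : ℝ) - (r : ℕ) + 1))) • e K d (r - 1)

theorem opZp_e (d r : ℕ) : opZp K d (e K d r) =
    algebraMap ℝ K (√(((d : ℝ) - r) * (r + 1))) • e K d (r + 1) := by
  rcases lt_or_ge d r with hr | hr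
  · simp [e_eq_zero K hr, e_eq_zero K (show d < r + 1 by omega)]
  · have := (Pi.basisFun K (Fin (d + 1))).constr_basis K
      (fun r => algebraMap ℝ K (√(((d : ℝ) - (r : ℕ)) * ((r : ℕ) + 1))) • e K d (r + 1))
      ⟨r, by omega⟩
    rwa [e_eq_basis] at this

theorem opZm_e (d r : ℕ) : opZm K d (e K d r) =
    algebraMap ℝ K (√((r : ℝ) * ((d : ℝ) - r + 1))) • e K d (r - 1) := by
  rcases lt_or_ge d r with hr | hr
  · rcases Nat.lt_or_ge (d + 1) r with h2 | h2
    · simp [e_eq_zero K hr, e_eq_zero K (show d < r - 1 by omega)]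
    · obtain rfl : r = d + 1 := by omega
      simp [e_eq_zero K hr]
  · have := (Pi.basisFun K (Fin (d + 1))).constr_basis K
      (fun r => algebraMap ℝ K (√(((r : ℕ) : ℝ) * ((d : ℝ) - (r : ℕ) + 1))) • e K d (r - 1))
      ⟨r, by omega⟩
    rwa [e_eq_basis] at this

theorem H_Zp (d : ℕ) : opH K d * opZp K d - opZp K d * opH K d = (2 : K) • opZp K d := by
  refine V_hom_ext fun r _ => ?_
  simp only [LinearMap.sub_apply, Module.End.mul_apply, LinearMap.smul_apply, opZp_e, opH_e,
    map_smul]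
  push_cast
  module

theorem H_Zm (d : ℕ) : opH K d * opZm K d - opZm K d * opH K d = -((2 : K) • opZm K d) := by
  refine V_hom_ext fun r _ => ?_
  simp only [LinearMap.sub_apply, Module.End.mul_apply, LinearMap.smul_apply, opZm_e, opH_e,
    map_smul, LinearMap.neg_apply]
  cases r with
  | zero => simp
  | succ r =>
    rw [Nat.add_sub_cancel]
    push_cast
    module

theorem Zp_Zm (d : ℕ) : opZp K d * opZm K d - opZm K d * opZp K d = opH K d := by
  refine V_hom_ext fun r hr => ?_
  simp only [LinearMap.sub_apply, Module.End.mul_apply, opZm_e, opZp_e, opH_e, map_smul,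
    smul_smul, Nat.add_sub_cancel, ← map_mul]
  have hd : (0 : ℝ) ≤ (d : ℝ) - r := by
    have : (r : ℝ) ≤ d := by exact_mod_cast hr
    linarith
  have e2 : √(((d : ℝ) - r) * (r + 1)) * √(((r + 1 : ℕ) : ℝ) * ((d : ℝ) - (r + 1 : ℕ) + 1))
      = ((d : ℝ) - r) * (r + 1) := by
    have : ((r + 1 : ℕ) : ℝ) * ((d : ℝ) - (r + 1 : ℕ) + 1) = ((d : ℝ) - r) * (r + 1) := by
      push_cast; ring
    rw [this, Real.mul_self_sqrt (by positivity)]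
  rw [e2]
  have key : ∀ x : ℝ, x - ((d : ℝ) - r) * (r + 1) = 2 * r - d →
      algebraMap ℝ K x • e K d r
        - algebraMap ℝ K (((d : ℝ) - r) * (r + 1)) • e K d r = (2 * (r : K) - d) • e K d r := by
    intro x hx
    rw [← sub_smul, ← map_sub, hx, map_sub, map_mul, map_natCast, map_natCast, map_ofNat]
  cases r with
  | zero =>
    rw [← key 0 (by simp)]
    simp
  | succ r =>
    rw [Nat.add_sub_cancel]
    refine key _ ?_
    have : ((r + 1 : ℕ) : ℝ) * ((d : ℝ) - (r + 1 : ℕ) + 1) = ((d : ℝ) - r) * (r + 1) := by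
      push_cast; ring
    rw [this, Real.mul_self_sqrt]
    · push_cast; ring
    · push_cast at hd
      exact mul_nonneg (by linarith) (by positivity)

theorem opZp_pow (d k r : ℕ) : ∃ c : K, (opZp K d ^ k) (e K d r) = c • e K d (r + k) := by
  induction k with
  | zero => exact ⟨1, by simp⟩
  | succ k ih =>
    obtain ⟨c, hc⟩ := ih
    refine ⟨c * algebraMap ℝ K (√(((d : ℝ) - (r + k : ℕ)) * ((r + k : ℕ) + 1))), ?_⟩
    rw [pow_succ', Module.End.mul_apply, hc, map_smul, opZp_e, smul_smul]
    rfl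

theorem opZp_nilp (d : ℕ) : opZp K d ^ (d + 1) = 0 := by
  refine V_hom_ext fun r _ => ?_
  obtain ⟨c, hc⟩ := opZp_pow K d (d + 1) r
  rw [hc, e_eq_zero K (by omega)]
  simp

variable {K}

/-- `z = h Z_+ / 2`, that is, `tanh (h X / 2)`. -/
def opz (h : K) (d : ℕ) : Module.End K (V K d) := (h / 2) • opZp K d

/-- `T = exp (h X) = (1 + h Z_+ / 2) (1 - h Z_+ / 2)⁻¹`. -/
def opT (h : K) (d : ℕ) : Module.End K (V K d) := (1 + opz h d) * Ring.inverse (1 - opz h d)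

/-- `T⁻¹ = (1 - h Z_+ / 2) (1 + h Z_+ / 2)⁻¹`. -/
def opTinv (h : K) (d : ℕ) : Module.End K (V K d) := (1 - opz h d) * Ring.inverse (1 + opz h d)

/-- `(cosh (h X / 2))⁻¹ = (1 - tanh (h X / 2) ^ 2) ^ (1 / 2)`, the binomial series in the nilpotent
operator `z = tanh (h X / 2)`. -/
def opSech (h : K) (d : ℕ) : Module.End K (V K d) :=
  ∑ k ∈ Finset.range (d + 1), algebraMap ℝ K (Ring.choose (1 / 2 : ℝ) k) • (-(opz h d ^ 2)) ^ k

/-- `Y = (cosh (h X / 2))⁻¹ Z_- (cosh (h X / 2))⁻¹`. -/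
def opY (h : K) (d : ℕ) : Module.End K (V K d) := opSech h d * opZm K d * opSech h d

theorem sqrt_series {A : Type*} [Ring A] [Algebra K A] (N : A) (n : ℕ) (hN : N ^ (n + 1) = 0) :
    (∑ k ∈ Finset.range (n + 1), algebraMap ℝ K (Ring.choose (1 / 2 : ℝ) k) • N ^ k) *
    (∑ k ∈ Finset.range (n + 1), algebraMap ℝ K (Ring.choose (1 / 2 : ℝ) k) • N ^ k) = 1 + N := by
  set f : PowerSeries K := PowerSeries.binomialSeries K (1 / 2 : ℝ) with hf
  set P : Polynomial K := PowerSeries.trunc (n + 1) f with hP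
  have h1 : f * f = ((1 + Polynomial.X : Polynomial K) : PowerSeries K) := by
    rw [hf, ← PowerSeries.binomialSeries_add]
    have := PowerSeries.binomialSeries_nat (R := ℝ) (A := K) 1
    simp only [Nat.cast_one, pow_one] at this
    rw [show (1 / 2 + 1 / 2 : ℝ) = 1 by norm_num, this]
    simp
  have h2 : Polynomial.aeval N P =
      ∑ k ∈ Finset.range (n + 1), algebraMap ℝ K (Ring.choose (1 / 2 : ℝ) k) • N ^ k := by
    rw [hP, PowerSeries.trunc_apply, map_sum, Nat.Ico_zero_eq_range]
    refine Finset.sum_congr rfl fun k _ => ?_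
    rw [Polynomial.aeval_monomial, hf, PowerSeries.binomialSeries_coeff, Algebra.smul_def,
      mul_one, ← Algebra.smul_def]
  have h3 : Polynomial.X ^ (n + 1) ∣ P * P - (1 + Polynomial.X) := by
    rw [Polynomial.X_pow_dvd_iff]
    intro m hm
    have h4 := PowerSeries.trunc_trunc_mul_trunc (n := n + 1) f f
    have h5 := congrArg (fun Q => Polynomial.coeff Q m) h4
    simp only [PowerSeries.coeff_trunc, hm, if_true, h1] at h5
    rw [← hP, ← Polynomial.coe_mul, Polynomial.coeff_coe, Polynomial.coeff_coe] at h5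
    rw [Polynomial.coeff_sub, h5, sub_self]
  obtain ⟨Q, hQ⟩ := h3
  rw [← h2, ← map_mul, eq_add_of_sub_eq hQ]
  simp [hN]

theorem opz_nilp (h : K) (d : ℕ) : opz h d ^ (d + 1) = 0 := by
  rw [opz, smul_pow, opZp_nilp, smul_zero]

theorem opSech_sq (h : K) (d : ℕ) : opSech h d * opSech h d = 1 - opz h d * opz h d := by
  rw [opSech, sqrt_series _ d, pow_two, sub_eq_add_neg]
  have h1 : (-(opz h d ^ 2)) ^ (d + 1) = (-1) ^ (d + 1) * (opz h d ^ 2) ^ (d + 1) :=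
    neg_pow (opz h d ^ 2) (d + 1)
  rw [h1, ← pow_mul, mul_comm 2, pow_mul, opz_nilp, zero_pow two_ne_zero, mul_zero]

theorem opSech_comm (h : K) (d : ℕ) (B : Module.End K (V K d)) (hB : Commute (opz h d) B) :
    Commute (opSech h d) B := by
  refine Commute.sum_left _ _ _ fun k _ => Commute.smul_left ?_ _
  exact ((hB.pow_left 2).neg_left).pow_left k

/-- The image of the `sl(2)` relations under the nonlinear map. -/
theorem nonlinear_rel {A : Type*} [Ring A] [Algebra K A] (h : K) (H z Zm S u v : A)
    (hz : H * z - z * H = (2 : K) • z) (hm : H * Zm - Zm * H = -((2 : K) • Zm))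
    (hpm : z * Zm - Zm * z = (h / 2) • H)
    (hu : (1 - z) * u = 1) (hu' : u * (1 - z) = 1) (hv : (1 + z) * v = 1) (hv' : v * (1 + z) = 1)
    (hS : S * S = 1 - z * z) (hSc : ∀ B, Commute z B → Commute S B) :
    ((1 + z) * u) * ((1 - z) * v) = 1 ∧ ((1 - z) * v) * ((1 + z) * u) = 1 ∧
    H * ((1 + z) * u) - ((1 + z) * u) * H = ((1 + z) * u) * ((1 + z) * u) - 1 ∧
    ((1 + z) * u) * (S * Zm * S) - (S * Zm * S) * ((1 + z) * u)
      = (h / 2) • (H * ((1 + z) * u) + ((1 + z) * u) * H) ∧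
    H * (S * Zm * S) - (S * Zm * S) * H = -((1 / 2 : K) •
      ((S * Zm * S) * ((1 + z) * u + (1 - z) * v) + ((1 + z) * u + (1 - z) * v) * (S * Zm * S))) := by
  have half_add_half : h / 2 + h / 2 = h := by
    have := two_ne_zero' K
    field_simp
    ring
  have uz : u * z = u - 1 := by rw [← hu']; noncomm_ring
  have zu : z * u = u - 1 := by rw [← hu]; noncomm_ring
  have vz : v * z = 1 - v := by rw [← hv']; noncomm_ring
  have zv : z * v = 1 - v := by rw [← hv]; noncomm_ring
  have Su : Commute S u := hSc u (by rw [Commute, SemiconjBy, uz, zu])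
  have Sv : Commute S v := hSc v (by rw [Commute, SemiconjBy, vz, zv])
  have Sz : Commute S z := hSc z (Commute.refl z)
  have T1 : (1 + z) * u = 2 * u - 1 := by rw [add_mul, zu]; noncomm_ring
  have T2 : (1 - z) * v = 2 * v - 1 := by rw [sub_mul, zv]; noncomm_ring
  have uvc : u * v = v * u := by
    have e1 : u * (1 + z) = (1 + z) * u := by rw [mul_add, add_mul, uz, zu]; simp
    calc u * v = (v * (1 + z)) * (u * v) := by rw [hv', one_mul]
      _ = v * ((1 + z) * u) * v := by noncomm_ring
      _ = v * u * ((1 + z) * v) := by rw [← e1]; noncomm_ring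
      _ = v * u := by rw [hv, mul_one]
  have uv : u + v = 2 * (u * v) := by
    have e1 : u * (z * v) = u - u * v := by rw [zv]; noncomm_ring
    have e2 : u * (z * v) = u * v - v := by rw [← mul_assoc, uz]; noncomm_ring
    have e3 := e1.symm.trans e2
    rw [two_mul]
    rw [sub_eq_sub_iff_add_eq_add] at e3
    exact e3
  have TT : (2 * u - 1) * (2 * v - 1) = 1 := by
    calc _ = 2 * (2 * (u * v)) - 2 * (u + v) + 1 := by noncomm_ring
      _ = 1 := by rw [uv]; noncomm_ring
  have TT' : (2 * v - 1) * (2 * u - 1) = 1 := by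
    calc _ = 2 * (2 * (v * u)) - 2 * (u + v) + 1 := by noncomm_ring
      _ = 1 := by rw [uv, uvc]; noncomm_ring
  have hz2 : H * z = z * H + 2 * z := by
    rw [sub_eq_iff_eq_add] at hz; rw [hz, ofNat_smul_eq_nsmul K 2]; noncomm_ring
  have hm2 : H * Zm = Zm * H - 2 * Zm := by
    rw [sub_eq_iff_eq_add] at hm; rw [hm, ofNat_smul_eq_nsmul K 2]; noncomm_ring
  have Hu : H * u = u * H + 2 * (u * u) - 2 * u := by
    have e1 : H * u - u * H = u * (H * z - z * H) * u := by
      calc H * u - u * H = (u * (1 - z)) * (H * u) - (u * H) * ((1 - z) * u) := by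
            rw [hu, hu', one_mul, mul_one]
        _ = _ := by noncomm_ring
    rw [hz2, add_sub_cancel_left, two_mul, mul_add, uz, sub_eq_iff_eq_add] at e1
    rw [e1]; noncomm_ring
  obtain ⟨D, hD⟩ : ∃ D, D = H * S - S * H := ⟨_, rfl⟩
  have zz : H * (z * z) = z * z * H + 4 * (z * z) := by
    calc H * (z * z) = (H * z) * z := by noncomm_ring
      _ = z * (H * z) + 2 * (z * z) := by
        nth_rw 1 [hz2]; rw [add_mul, mul_assoc, mul_assoc]
      _ = _ := by rw [hz2]; noncomm_ring
  have zD : Commute z D := by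
    have e1 : z * D - D * z = H * (z * S - S * z) - (z * S - S * z) * H
        + (S * (H * z - z * H) - (H * z - z * H) * S) := by rw [hD]; noncomm_ring
    rw [Sz.eq, sub_self, mul_zero, zero_mul, sub_zero, zero_add, hz2, add_sub_cancel_left,
      two_mul, mul_add, add_mul, Sz.eq, sub_self] at e1
    exact sub_eq_zero.mp e1
  have SD : S * D = -(2 * (z * z)) := by
    have e1 : D * S + S * D = H * (S * S) - (S * S) * H := by rw [hD]; noncomm_ring
    rw [hS, mul_sub, zz, ← (hSc D zD).eq] at e1
    have e2 : (2 : K) • (S * D) = (2 : K) • (-(2 * (z * z))) := by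
      rw [ofNat_smul_eq_nsmul K 2, ofNat_smul_eq_nsmul K 2, two_nsmul, e1]
      noncomm_ring
    have := congrArg (fun x => (2 : K)⁻¹ • x) e2
    simpa only [smul_smul, inv_mul_cancel₀ (two_ne_zero' K), one_smul] using this
  have zzuv : (z * z) * (u * v) = u * v - 1 := by
    calc _ = z * (z * u) * v := by noncomm_ring
      _ = (z * u) * v - z * v := by rw [zu, mul_sub, mul_one, sub_mul, zu]
      _ = u * v - 1 := by rw [zu, zv, sub_mul, one_mul]; abel
  have SSuv : S * S * (u * v) = 1 := by
    rw [hS, sub_mul, zzuv, one_mul, sub_sub_cancel]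
  have Suv : Commute S (u * v) := Su.mul_right Sv
  have Dv : D = -(2 * ((u * v - 1) * S)) := by
    calc D = S * S * (u * v) * D := by rw [SSuv, one_mul]
      _ = (u * v) * S * (S * D) := by 
          rw [mul_assoc S, Suv.eq, ← mul_assoc, Suv.eq, mul_assoc, mul_assoc, mul_assoc]
      _ = -(2 * ((u * v) * (S * z) * z)) := by
        rw [SD]; noncomm_ring
      _ = -(2 * ((z * z) * (u * v) * S)) := by
        have e1 : u * v * z = z * (u * v) := by
          rw [mul_assoc, vz.trans zv.symm, ← mul_assoc, uz.trans zu.symm, mul_assoc]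
        have e2 : u * v * (S * z) * z = z * z * (u * v) * S := by
          calc u * v * (S * z) * z = u * v * z * (S * z) := by
                rw [Sz.eq]; simp only [mul_assoc]; rw [Sz.eq]
            _ = z * (u * v) * (z * S) := by rw [e1, Sz.eq]
            _ = z * (u * v * z) * S := by simp only [mul_assoc]
            _ = _ := by rw [e1]; simp only [mul_assoc]
        rw [e2]
      _ = _ := by rw [zzuv]
  rw [T1, T2]
  refine ⟨TT, TT', ?_, ?_, ?_⟩
  · calc _ = 2 * (H * u) - 2 * (u * H) := by noncomm_ring
      _ = _ := by rw [Hu]; noncomm_ring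
  · have e1 : u * Zm - Zm * u = (h / 2) • (u * H * u) := by
      calc u * Zm - Zm * u = (u * Zm) * ((1 - z) * u) - (u * (1 - z)) * (Zm * u) := by
            rw [hu, hu', one_mul, mul_one]; 
        _ = u * (z * Zm - Zm * z) * u := by noncomm_ring
        _ = _ := by rw [hpm, mul_smul_comm, smul_mul_assoc]
    have e2 : S * H * S = H - H * (z * z) + 2 * (z * z) := by
      have : S * H = H * S - D := by rw [hD]; abel
      rw [this, sub_mul, ← (hSc D zD).eq, SD, mul_assoc, hS]; noncomm_ring
    have e3 : u * (S * H * S) * u = 2 * (u * H) - H + 2 * (u * u) - 2 * u := by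
      rw [e2, zz]
      calc u * (H - (z * z * H + 4 * (z * z)) + 2 * (z * z)) * u
          = u * (H * u) - (u * z) * (z * (H * u)) - 2 * ((u * z) * (z * u)) := by noncomm_ring
        _ = _ := by
          rw [uz, zu, Hu]
          calc _ = u * u * H + 2 * (u * u * u) - 2 * (u * u)
              - (u * (z * u) * H + 2 * (u * (z * u) * u) - 2 * (u * (z * u)) - z * u * H
                  - 2 * (z * u * u) + 2 * (z * u)) - 2 * ((u - 1) * (u - 1)) := by noncomm_ring
            _ = _ := by rw [zu]; noncomm_ring
    calc (2 * u - 1) * (S * Zm * S) - S * Zm * S * (2 * u - 1)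
        = 2 * ((u * S) * Zm * S - S * Zm * (S * u)) := by noncomm_ring
      _ = 2 * (S * (u * Zm - Zm * u) * S) := by
        rw [show (u * S) * Zm * S - S * Zm * (S * u) = (S * u) * Zm * S - S * Zm * (u * S) by
          rw [Su.eq]]
        noncomm_ring
      _ = h • (S * (u * H * u) * S) := by
        rw [e1, mul_smul_comm, smul_mul_assoc, two_mul, ← add_smul, half_add_half]
      _ = h • (u * (S * H * S) * u) := by
        congr 1
        calc _ = (S * u) * H * (u * S) := by noncomm_ring
          _ = (u * S) * H * (S * u) := by rw [Su.eq]
          _ = _ := by noncomm_ring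
      _ = (h / 2) • (2 * (2 * (u * H) - H + 2 * (u * u) - 2 * u)) := by
        rw [e3, two_mul (2 * (u * H) - H + 2 * (u * u) - 2 * u), smul_add, ← add_smul,
          half_add_half]
      _ = _ := by
        congr 1
        calc _ = 2 * (u * H + 2 * (u * u) - 2 * u) + 2 * (u * H) - 2 * H := by noncomm_ring
          _ = _ := by rw [← Hu]; noncomm_ring
  · have e1 : H * (S * Zm * S) - S * Zm * S * H = D * Zm * S + S * (H * Zm - Zm * H) * S
        + S * Zm * D := by rw [hD]; noncomm_ring
    have e2 : 2 * u - 1 + (2 * v - 1) = (2 : K) • (2 * (u * v) - 1) := by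
      rw [← uv, ofNat_smul_eq_nsmul K 2]; noncomm_ring
    have e3 : D = -(2 * (S * (u * v - 1))) := by
      rw [Dv, sub_mul, one_mul, ← Suv.eq]; noncomm_ring
    rw [e2, mul_smul_comm, smul_mul_assoc, ← smul_add, smul_smul,
      one_div, inv_mul_cancel₀ (two_ne_zero' K), one_smul, e1, hm2]
    calc D * Zm * S + S * (Zm * H - 2 * Zm - Zm * H) * S + S * Zm * D
        = (-(2 * ((u * v - 1) * S))) * Zm * S - 2 * (S * Zm * S)
            + S * Zm * (-(2 * (S * (u * v - 1)))) := by rw [← e3, ← Dv]; noncomm_ring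
      _ = _ := by noncomm_ring

theorem op_rel (h : K) (d : ℕ) :
    opT h d * opTinv h d = 1 ∧ opTinv h d * opT h d = 1 ∧
    opH K d * opT h d - opT h d * opH K d = opT h d * opT h d - 1 ∧
    opT h d * opY h d - opY h d * opT h d = (h / 2) • (opH K d * opT h d + opT h d * opH K d) ∧
    opH K d * opY h d - opY h d * opH K d = -((1 / 2 : K) •
      (opY h d * (opT h d + opTinv h d) + (opT h d + opTinv h d) * opY h d)) := by
  have hn : IsNilpotent (opz h d) := ⟨d + 1, opz_nilp h d⟩
  have hm := hn.isUnit_one_sub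
  have hp := hn.isUnit_one_add
  refine nonlinear_rel h (opH K d) (opz h d) (opZm K d) (opSech h d) _ _ ?_ (H_Zm K d) ?_
    (Ring.mul_inverse_cancel _ hm) (Ring.inverse_mul_cancel _ hm)
    (Ring.mul_inverse_cancel _ hp) (Ring.inverse_mul_cancel _ hp)
    (opSech_sq h d) (opSech_comm h d)
  · rw [opz, mul_smul_comm, smul_mul_assoc, smul_comm, ← H_Zp]; module
  · rw [opz, mul_smul_comm, smul_mul_assoc, ← Zp_Zm]; module

/-- The representation of `U_h(sl(2))` on `V^(j)`, where `d = 2 j`. -/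
def rep (h : K) (d : ℕ) : Uh h →ₐ[K] Module.End K (V K d) :=
  liftUh h (opH K d) (opY h d) (opT h d) (opTinv h d) (op_rel h d).1 (op_rel h d).2.1
    (op_rel h d).2.2.1 (op_rel h d).2.2.2.1 (op_rel h d).2.2.2.2

end Irreps

/-! ### Clebsch-Gordan coefficients

Throughout, `d₁ = 2 j₁`, `d₂ = 2 j₂`, `d = 2 j` are twice the spins, and a weight `m` of the
representation of spin `j` is given by the natural number `j + m`. -/

section ClebschGordan

/-- The spins `j = |j₁ - j₂|, |j₁ - j₂| + 1, …, j₁ + j₂`, given by `d = 2 j`. -/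
abbrev CoupledSpin (d₁ d₂ : ℕ) : Type :=
  {d : ℕ // |(d₁ : ℤ) - (d₂ : ℤ)| ≤ (d : ℤ) ∧ d ≤ d₁ + d₂ ∧ Even (d₁ + d₂ + d)}

/-- `1 / n!`, which is `0` for negative `n`. -/
def invFact (n : ℤ) : ℝ := if 0 ≤ n then 1 / (n.toNat ! : ℝ) else 0

/-- For `p = j₁ + m₁`, `q = j₂ + m₂` and `r = j + m`: the condition `m₁ + m₂ = m`. -/
def WeightSum (d₁ d₂ d p q r : ℕ) : Prop :=
  (2 * (p : ℤ) - d₁) + (2 * (q : ℤ) - d₂) = 2 * (r : ℤ) - d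

instance (d₁ d₂ d p q r : ℕ) : Decidable (WeightSum d₁ d₂ d p q r) := by
  unfold WeightSum; infer_instance

/-- The `su(2)` Clebsch-Gordan coefficient `C^{j₁,j₂,j}_{m₁,m₂,m}` with the Condon-Shortley phase
convention, for `|j₁ - j₂| ≤ j ≤ j₁ + j₂`, `p = j₁ + m₁`, `q = j₂ + m₂`, `r = j + m`:
`δ_{m,m₁+m₂} √((2j+1) (j+j₁-j₂)! (j-j₁+j₂)! (j₁+j₂-j)! / (j₁+j₂+j+1)!)
 √((j+m)! (j-m)! (j₁-m₁)! (j₁+m₁)! (j₂-m₂)! (j₂+m₂)!)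
 ∑_k (-1)^k / (k! (j₁+j₂-j-k)! (j₁-m₁-k)! (j₂+m₂-k)! (j-j₂+m₁+k)! (j-j₁-m₂+k)!)`,
where terms with a factorial of a negative number are omitted. Below `s = j₁ + j₂ - j`. -/
def su2CG (d₁ d₂ d p q r : ℕ) : ℝ :=
  let s : ℕ := (d₁ + d₂ - d) / 2
  if WeightSum d₁ d₂ d p q r then
    √(((d : ℝ) + 1) * (((d + d₁ - d₂) / 2)! : ℝ) * (((d + d₂ - d₁) / 2)! : ℝ) * (s ! : ℝ)
        / (((d₁ + d₂ + d) / 2 + 1)! : ℝ))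
      * √((r ! : ℝ) * ((d - r)! : ℝ) * ((d₁ - p)! : ℝ) * (p ! : ℝ) * ((d₂ - q)! : ℝ) * (q ! : ℝ))
      * ∑ k ∈ Finset.range (s + 1), (-1 : ℝ) ^ k * invFact k * invFact ((s : ℤ) - k)
          * invFact ((d₁ : ℤ) - p - k) * invFact ((q : ℤ) - k)
          * invFact ((p : ℤ) - s + k) * invFact ((d₂ : ℤ) - s - q + k)
  else 0

/-- `α_{j,m} = √((j + m)! / (j - m)!)`, where `d = 2 j` and `i = j + m`. -/
def alpha (d : ℕ) (i : ℤ) : ℝ := √((i.toNat ! : ℝ) / (((d : ℤ) - i).toNat ! : ℝ))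

variable {K : Type*} [Field K]

/-- `b^{m₁,m₂}_{k,l} = (-2m₁-k)_l (-2m₂-l)_k / (k! l!)` for `k, l ≥ 0`, and `0` otherwise, with the
Pochhammer symbol `(x)_n = x (x+1) ⋯ (x+n-1)`. Here `M₁ = 2 m₁` and `M₂ = 2 m₂`. -/
def bCoeff (K : Type*) [Field K] (M₁ M₂ k l : ℤ) : K :=
  if 0 ≤ k ∧ 0 ≤ l then
    (ascPochhammer K l.toNat).eval (-(M₁ : K) - (k : K))
      * (ascPochhammer K k.toNat).eval (-(M₂ : K) - (l : K)) / ((k.toNat ! : K) * (l.toNat ! : K))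
  else 0

/-- `a^{m₁,m₂}_{k,l} = (-1)^k (h/2)^{k+l} (b^{m₁,m₂}_{k,l} - b^{m₁,m₂}_{k-1,l-1})`,
where `M₁ = 2 m₁` and `M₂ = 2 m₂`. -/
def aCoeff (h : K) (M₁ M₂ k l : ℤ) : K :=
  (-1) ^ k * (h / 2) ^ (k + l) * (bCoeff K M₁ M₂ k l - bCoeff K M₁ M₂ (k - 1) (l - 1))

variable [Algebra ℝ K]

/-- `A^{m₁,m₂}_{k,l} = a^{m₁,m₂}_{k,l} α_{j₁,m₁+k} α_{j₂,m₂+l} / (α_{j₁,m₁} α_{j₂,m₂})`,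
where `p = j₁ + m₁` and `q = j₂ + m₂`. -/
def ACoeff (h : K) (d₁ d₂ p q : ℕ) (k l : ℤ) : K :=
  aCoeff h (2 * (p : ℤ) - d₁) (2 * (q : ℤ) - d₂) k l
    * algebraMap ℝ K (alpha d₁ (p + k) * alpha d₂ (q + l) / (alpha d₁ p * alpha d₂ q))

/-- The numbers `𝒞^{j₁,j₂,j}_{n₁,n₂,m}` are Clebsch-Gordan coefficients of `U_h(sl(2))` in the
`e`-basis: there is a decomposition of the tensor product `V^(j₁) ⊗ V^(j₂)` into the direct sum
of the representations `V^(j)`, `j = |j₁ - j₂|, …, j₁ + j₂`, in which the basis vector `e^j_m` of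
`V^(j)` corresponds to `e^{(j₁j₂)j}_m = ∑_{n₁,n₂} 𝒞^{j₁,j₂,j}_{n₁,n₂,m} e^{j₁}_{n₁} ⊗ e^{j₂}_{n₂}`.
The value `𝒞 d p q r` is the coefficient with `d = 2 j`, `p = j₁ + n₁`, `q = j₂ + n₂`,
`r = j + m`. -/
def IsClebschGordan (h : K) (d₁ d₂ : ℕ)
    (𝒞 : (d : CoupledSpin d₁ d₂) → Fin (d₁ + 1) → Fin (d₂ + 1) → Fin (d.1 + 1) → K) : Prop :=
  ∃ Φ : (⨁ d : CoupledSpin d₁ d₂, V K d.1) ≃ₗ[K] V K d₁ ⊗[K] V K d₂,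
    (∀ u : Uh h, Φ.toLinearMap ∘ₗ DirectSum.lmap (fun d : CoupledSpin d₁ d₂ => rep h d.1 u)
        = tensorRep h (rep h d₁) (rep h d₂) u ∘ₗ Φ.toLinearMap) ∧
    ∀ (d : CoupledSpin d₁ d₂) (r : Fin (d.1 + 1)),
      Φ (DirectSum.lof K (CoupledSpin d₁ d₂) (fun d => V K d.1) d (e K d.1 r))
        = ∑ p : Fin (d₁ + 1), ∑ q : Fin (d₂ + 1), 𝒞 d p q r • (e K d₁ p ⊗ₜ[K] e K d₂ q)

/-- The sum `∑_{m₁+m₂=m} C^{j₁,j₂,j}_{m₁,m₂,m} A^{m₁,m₂}_{n₁-m₁,n₂-m₂}`, where `p = j₁ + n₁`,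
`q = j₂ + n₂`, `r = j + m`, and the summation indices are `x.1 = j₁ + m₁`, `x.2 = j₂ + m₂`. -/
def cgSum (h : K) (d₁ d₂ d p q r : ℕ) : K :=
  ∑ x ∈ (Finset.range (d₁ + 1) ×ˢ Finset.range (d₂ + 1)).filter
      (fun x => WeightSum d₁ d₂ d x.1 x.2 r),
    algebraMap ℝ K (su2CG d₁ d₂ d x.1 x.2 r)
      * ACoeff h d₁ d₂ x.1 x.2 ((p : ℤ) - x.1) ((q : ℤ) - x.2)

end ClebschGordan

end Jordanian

end

noncomputable section

namespace Jordanian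

/-! ### The `sl(2)`-triple hidden in `U_h(sl(2))`, and its commutant -/

section Commutant

variable {K : Type*} [Field K] [Algebra ℝ K]

/-! Write z = tanh(hX/2), so that T = (1+z)(1-z)⁻¹ and z = (h/2)Z_+ on every V^(j). On V^(j₁) ⊗
V^(j₂) the operators x = z ⊗ 1 and y = 1 ⊗ z commute, and the coproduct of z is (x+y)/(1+xy), the
addition formula for tanh. Put R = (1-y)/(1+xy) and S = (1+x)/(1+xy), and let F send e_{m₁} ⊗ e_{m₂}
to R^{2m₁} S^{2m₂} (e_{m₁} ⊗ e_{m₂}).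

Raising m₁ or m₂ by one brings in a factor R² or S², so the identity R²x + S²y = (x+y)/(1+xy) says
that F intertwines x + y with the coproduct of z. The commutator with Δ(H) is a derivation on
functions of x and y, under which R and S have logarithmic derivatives 1 - t and 1 - t', where t = 1
⊗ T and t' = T⁻¹ ⊗ 1. On e_{m₁} ⊗ e_{m₂} the operator Δ(H) is 2m₁t + 2m₂t'. The terms in t and t'
cancel, and F intertwines H ⊗ 1 + 1 ⊗ H with Δ(H). This is `exists_twist`. By `twist_eq_truncSeries`
the expansion of R^{2m₁} S^{2m₂} in x and y has the coefficients a of the statement, up to powers of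
h/2. Hence F applied to the classically coupled vectors of `exists_coupling` gives the vectors of
the statement.

The action of Y on these vectors is never computed. In a finite-dimensional representation an
operator that commutes with H and z commutes with Y (`commute_Y`): the elements (2/h)z, H and CYC
with C = cosh(hX/2) form an `sl(2)`-triple, and the commutator of the operator with CYC would
otherwise be a primitive vector of weight -2 in a finite-dimensional `sl(2)`-module. Applied to a
block operator, this shows that a linear map compatible with H and z is a homomorphism
(`intertwines_of_H_z`).

The resulting map from the direct sum is injective because the images of the highest weight vectors
are nonzero eigenvectors of Δ(H) with distinct eigenvalues (`toModule_injective`), and bijective by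
a dimension count (`sum_coupledSpin`). Invertibility of F is not needed. Uniqueness is Schur's lemma
over an arbitrary field K: two decompositions agree up to a factor on a highest weight vector, hence
by `rep_irreducible` on the whole V^(j). -/

theorem two_mul_cancel (K : Type*) [Field K] [Algebra ℝ K] {A : Type*} [Ring A] [Algebra K A]
    {a b : A} (hab : 2 * a = 2 * b) : a = b := by
  have e2 : (2 : K) • a = (2 : K) • b := by
    rw [ofNat_smul_eq_nsmul K 2, ofNat_smul_eq_nsmul K 2, nsmul_eq_mul, nsmul_eq_mul]
    exact_mod_cast hab
  have := congrArg (fun x => (2 : K)⁻¹ • x) e2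
  simpa only [smul_smul, inv_mul_cancel₀ (two_ne_zero' K), one_smul] using this

/-- The binomial series of `(1 - z ^ 2) ^ (1 / 2)`, together with its inverse. -/
theorem exists_sqrt_one_sub_sq (K : Type*) [Field K] [Algebra ℝ K] {A : Type*} [Ring A]
    [Algebra K A] (z : A) (hz : IsNilpotent z) :
    ∃ S C : A, S * S = 1 - z * z ∧ S * C = 1 ∧ C * S = 1 ∧
      (∀ B, Commute z B → Commute S B) ∧ ∀ B, Commute z B → Commute C B := by
  obtain ⟨n, hn⟩ := hz
  have hN : (-(z ^ 2)) ^ (n + 1) = 0 := by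
    have h1 : (-(z ^ 2)) ^ (n + 1) = (-1) ^ (n + 1) * (z ^ 2) ^ (n + 1) := neg_pow (z ^ 2) (n + 1)
    rw [h1, ← pow_mul, show 2 * (n + 1) = n + (n + 2) by ring, pow_add z, hn, zero_mul, mul_zero]
  set S : A := ∑ k ∈ Finset.range (n + 1),
    algebraMap ℝ K (Ring.choose (1 / 2 : ℝ) k) • (-(z ^ 2)) ^ k with hSdef
  have hS : S * S = 1 - z * z := by
    rw [hSdef, sqrt_series _ n hN, pow_two, sub_eq_add_neg]
  have hSc : ∀ B, Commute z B → Commute S B := fun B hB =>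
    Commute.sum_left _ _ _ fun k _ => Commute.smul_left (((hB.pow_left 2).neg_left).pow_left k) _
  have hu : IsUnit (1 - z * z) := by
    refine IsNilpotent.isUnit_one_sub ⟨n, ?_⟩
    rw [← pow_two, ← pow_mul, two_mul, pow_add, hn, zero_mul]
  -- The square of `S` is the unit 1 - z², which gives `S` an inverse on each side; the two agree.
  have hSu : IsUnit S := by
    obtain ⟨u, hu⟩ := hu
    have h1 : S * (S * ↑u⁻¹) = 1 := by rw [← mul_assoc, hS, ← hu, Units.mul_inv]
    have h2 : (↑u⁻¹ * S) * S = 1 := by rw [mul_assoc, hS, ← hu, Units.inv_mul]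
    have h3 : S * ↑u⁻¹ = ↑u⁻¹ * S := by
      calc S * ↑u⁻¹ = (↑u⁻¹ * S) * S * (S * ↑u⁻¹) := by rw [h2, one_mul]
        _ = ↑u⁻¹ * S * (S * (S * ↑u⁻¹)) := by noncomm_ring
        _ = _ := by rw [h1, mul_one]
    exact ⟨⟨S, S * ↑u⁻¹, h1, h3 ▸ h2⟩, rfl⟩
  obtain ⟨s, hs⟩ := hSu
  refine ⟨S, ↑s⁻¹, hS, by rw [← hs, s.mul_inv], by rw [← hs, s.inv_mul], hSc, fun B hB => ?_⟩
  have := hSc B hB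
  rw [← hs] at this
  exact this.units_inv_left

/-- The `sl(2)`-triple `2 h⁻¹ z, H, C Y C` inside an algebra with elements `H, Y, T, T'` satisfying
the relations of `U_h(sl(2))`, where `T = (1 + z) (1 - z)⁻¹` and `C = (1 - z ^ 2) ^ (- 1 / 2)`. -/
theorem sl2_relations {A : Type*} [Ring A] [Algebra K A] (h : K) (H Y T T' z S C : A)
    (h2 : T' * T = 1) (h3 : H * T - T * H = T * T - 1)
    (h4 : T * Y - Y * T = (h / 2) • (H * T + T * H))
    (h5 : H * Y - Y * H = -((1 / 2 : K) • (Y * (T + T') + (T + T') * Y)))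
    (hT : T * (1 - z) = 1 + z) (hT' : (1 - z) * T = 1 + z)
    (hS : S * S = 1 - z * z) (hSC : S * C = 1) (hCS : C * S = 1)
    (hSc : ∀ B, Commute z B → Commute S B) (hCc : ∀ B, Commute z B → Commute C B) :
    H * z - z * H = 2 * z ∧ z * (C * Y * C) - (C * Y * C) * z = (h / 2) • H ∧
      H * (C * Y * C) - (C * Y * C) * H = -(2 * (C * Y * C)) := by
  have hz : H * z - z * H = 2 * z := by
    apply two_mul_cancel K
    -- Multiplying by 1 - z on both sides clears the denominator of T and makes the relation
    -- polynomial in z.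
    have e1 : (1 - z) * (H * T - T * H) * (1 - z) = 2 * (H * z - z * H) := by
      calc _ = (1 - z) * H * (T * (1 - z)) - ((1 - z) * T) * (H * (1 - z)) := by noncomm_ring
        _ = _ := by rw [hT, hT']; noncomm_ring
    rw [← e1, h3]
    calc (1 - z) * (T * T - 1) * (1 - z) = ((1 - z) * T) * (T * (1 - z)) - (1 - z) * (1 - z) := by
          noncomm_ring
      _ = _ := by rw [hT, hT']; noncomm_ring
  have hY : z * Y - Y * z = (h / 2) • (H - z * H * z) := by
    apply two_mul_cancel K
    have e1 : (1 - z) * (T * Y - Y * T) * (1 - z) = 2 * (z * Y - Y * z) := by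
      calc _ = ((1 - z) * T) * (Y * (1 - z)) - ((1 - z) * Y) * (T * (1 - z)) := by noncomm_ring
        _ = _ := by rw [hT, hT']; noncomm_ring
    rw [← e1, h4, mul_smul_comm, smul_mul_assoc, mul_smul_comm]
    congr 1
    calc (1 - z) * (H * T + T * H) * (1 - z)
        = (1 - z) * H * (T * (1 - z)) + ((1 - z) * T) * (H * (1 - z)) := by noncomm_ring
      _ = _ := by rw [hT, hT']; noncomm_ring
  have zC : C * z = z * C := (hCc z (Commute.refl z)).eq
  have zC' : z * C = C * z := zC.symm
  have zCa : ∀ w, z * (C * w) = C * (z * w) := fun w => by rw [← mul_assoc, zC', mul_assoc]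
  have zS : S * z = z * S := (hSc z (Commute.refl z)).eq
  have hz2 : H * z = z * H + 2 * z := by rw [← hz]; abel
  have zz : H * (z * z) = z * z * H + 4 * (z * z) := by
    calc H * (z * z) = (H * z) * z := by noncomm_ring
      _ = z * (H * z) + 2 * (z * z) := by
        nth_rw 1 [hz2]; rw [add_mul, mul_assoc, mul_assoc]
      _ = _ := by rw [hz2]; noncomm_ring
  -- The commutator of H with the square root is found without its series: it commutes with z, hence
  -- with `S`, so that 2SD = [H, S²] = [H, 1 - z²].
  obtain ⟨D, hD⟩ : ∃ D, D = H * S - S * H := ⟨_, rfl⟩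
  have zD : Commute z D := by
    have e1 : z * D - D * z = H * (z * S - S * z) - (z * S - S * z) * H
        + (S * (H * z - z * H) - (H * z - z * H) * S) := by rw [hD]; noncomm_ring
    rw [zS, sub_self, mul_zero, zero_mul, sub_zero, zero_add, hz, two_mul, mul_add, add_mul, zS,
      sub_self] at e1
    exact sub_eq_zero.mp e1
  have SD : S * D = -(2 * (z * z)) := by
    have e1 : D * S + S * D = H * (S * S) - (S * S) * H := by rw [hD]; noncomm_ring
    rw [hS, mul_sub, zz, ← (hSc D zD).eq] at e1
    apply two_mul_cancel K
    rw [two_mul, e1]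
    noncomm_ring
  have hC : H * C = C * H + 2 * (C * C * C * (z * z)) := by
    have e1 : D = -(2 * (C * (z * z))) := by
      calc D = C * (S * D) := by rw [← mul_assoc, hCS, one_mul]
        _ = _ := by rw [SD]; noncomm_ring
    have e2 : C * H - H * C = C * D * C := by
      calc C * H - H * C = C * H * (S * C) - (C * S) * (H * C) := by rw [hSC, hCS]; noncomm_ring
        _ = _ := by rw [hD]; noncomm_ring
    have e3 : C * D * C = -(2 * (C * C * C * (z * z))) := by
      rw [e1]
      simp only [mul_neg, neg_mul, two_mul, mul_add, add_mul, mul_assoc, zC', zCa]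
    rw [e3, sub_eq_iff_eq_add, neg_add_eq_sub, eq_sub_iff_add_eq] at e2
    rw [e2]
  have CCzz : C * (C * (z * z)) = C * C - 1 := by
    have e1 : C * (S * S) * C = 1 := by
      calc _ = (C * S) * (S * C) := by noncomm_ring
        _ = 1 := by rw [hCS, hSC, one_mul]
    rw [hS] at e1
    simp only [mul_sub, sub_mul, mul_one, mul_assoc, zC', zCa] at e1
    rw [← e1]; abel
  have hC' : H * C = C * H + 2 * (C * C * C) - 2 * C := by
    rw [hC, mul_assoc C C C, mul_assoc C, mul_assoc C C, CCzz]
    noncomm_ring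
  -- This is cosh(hX) = 2 cosh²(hX/2) - 1.
  have TT : T + T' = 2 * (2 * (C * C) - 1) := by
    have e1 : T' * (1 + z) = 1 - z := by rw [← hT, ← mul_assoc, h2, one_mul]
    have e2 : S * S * (C * C) = 1 := by
      calc _ = S * (S * C) * C := by noncomm_ring
        _ = 1 := by rw [hSC, mul_one, hSC]
    calc T + T' = (T + T') * (S * S * (C * C)) := by rw [e2, mul_one]
      _ = ((T * (1 - z)) * (1 + z) + (T' * (1 + z)) * (1 - z)) * (C * C) := by
        rw [hS]; noncomm_ring
      _ = 2 * (C * C) + 2 * (z * (z * (C * C))) := by rw [hT, e1]; noncomm_ring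
      _ = _ := by simp only [zC', zCa, CCzz]; noncomm_ring
  have CT : C * (T + T') = (T + T') * C := by rw [TT]; noncomm_ring
  have CH : C * H = H * C - 2 * (C * C * C) + 2 * C := by rw [hC']; abel
  refine ⟨hz, ?_, ?_⟩
  · have e1 : z * (C * Y * C) - (C * Y * C) * z = C * (z * Y - Y * z) * C := by
      calc _ = (z * C) * Y * C - C * Y * (C * z) := by noncomm_ring
        _ = _ := by rw [← zC, zC]; nth_rw 1 [← zC]; noncomm_ring
    have zH : z * H = H * z - 2 * z := by rw [← hz]; abel
    rw [e1, hY, mul_smul_comm, smul_mul_assoc]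
    congr 1
    calc C * (H - z * H * z) * C = (C * H) * C - (C * z) * H * (z * C) := by noncomm_ring
      _ = (C * H) * C - (z * C) * H * (C * z) := by rw [zC]
      _ = (C * H) * C - z * (C * H) * C * z := by noncomm_ring
      _ = H * (C * C) - 2 * (C * (C * (C * C))) + 2 * (C * C)
          - (z * H) * (C * (C * z)) + 2 * (z * (C * (C * (C * (C * z)))))
          - 2 * (z * (C * (C * z))) := by rw [CH]; noncomm_ring
      _ = H * (C * C) - 2 * (C * (C * (C * C))) + 2 * (C * C)
          - H * (C * (C * (z * z))) + 2 * (C * (C * (z * z))) + 2 * (C * (C * (C * (C * (z * z)))))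
          - 2 * (C * (C * (z * z))) := by
        rw [zH, sub_mul, mul_assoc H, mul_assoc 2 z]; simp only [zCa]; abel
      _ = H := by simp only [CCzz]; noncomm_ring
  · have e1 : C * (H * Y - Y * H) * C
        = -((C * Y * C) * (2 * (C * C) - 1) + (2 * (C * C) - 1) * (C * Y * C)) := by
      apply two_mul_cancel K
      have : 2 * (C * (H * Y - Y * H) * C)
          = -(C * Y * ((T + T') * C) + C * (T + T') * Y * C) := by
        rw [h5, mul_neg, neg_mul, mul_neg, mul_smul_comm, smul_mul_assoc, two_mul, ← add_smul,
          ← two_mul, mul_one_div_cancel (two_ne_zero' K), one_smul]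
        noncomm_ring
      rw [this, ← CT, CT, TT]
      noncomm_ring
    calc H * (C * Y * C) - C * Y * C * H = (H * C) * Y * C - C * Y * (C * H) := by noncomm_ring
      _ = (C * H + 2 * (C * C * C) - 2 * C) * Y * C
          - C * Y * (H * C - 2 * (C * C * C) + 2 * C) := by rw [← hC', ← CH]
      _ = C * (H * Y - Y * H) * C + 2 * (C * C * C * Y * C) - 2 * (C * Y * C)
          + 2 * (C * Y * C * C * C) - 2 * (C * Y * C) := by
        noncomm_ring
      _ = _ := by rw [e1]; noncomm_ring

/-- In a finite-dimensional representation of `U_h(sl(2))`, whatever commutes with `H` and `T`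
commutes with `Y`. -/
theorem commute_Y {M : Type*} [AddCommGroup M] [Module K M] [FiniteDimensional K M] (h : K)
    (hh : h ≠ 0) (H Y T T' z N : Module.End K M)
    (h2 : T' * T = 1) (h3 : H * T - T * H = T * T - 1)
    (h4 : T * Y - Y * T = (h / 2) • (H * T + T * H))
    (h5 : H * Y - Y * H = -((1 / 2 : K) • (Y * (T + T') + (T + T') * Y)))
    (hT : T * (1 - z) = 1 + z) (hT' : (1 - z) * T = 1 + z) (hz : IsNilpotent z)
    (hNH : N * H = H * N) (hNz : N * z = z * N) : N * Y = Y * N := by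
  let _ : LieRing (Module.End K M) := LieRing.ofAssociativeRing
  obtain ⟨S, C, hS, hSC, hCS, hSc, hCc⟩ := exists_sqrt_one_sub_sq K z hz
  obtain ⟨k1, k2, k3⟩ := sl2_relations h H Y T T' z S C h2 h3 h4 h5 hT hT' hS hSC hCS hSc hCc
  set F := C * Y * C with hF
  have hN : C * N = N * C := (hCc N hNz.symm).eq
  -- Since N commutes with z and H, the commutator D = [N, F] satisfies [z, D] = 0 and [H, D] = -2D.
  -- It is a highest weight vector of weight -2 for the adjoint action of the triple on the
  -- finite-dimensional space `Module.End K M`.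
  have hD : N * F - F * N = 0 := by
    by_contra hne
    have hzD : z * (N * F - F * N) - (N * F - F * N) * z = 0 := by
      have : z * (N * F - F * N) - (N * F - F * N) * z
        = N * (z * F - F * z) - (z * F - F * z) * N := by
        calc _ = (z * N) * F - z * F * N - N * F * z + F * (N * z) := by noncomm_ring
          _ = N * z * F - z * F * N - N * F * z + F * (z * N) := by rw [hNz]
          _ = _ := by noncomm_ring
      rw [this, k2, mul_smul_comm, smul_mul_assoc, hNH, sub_self]
    have hHD : H * (N * F - F * N) - (N * F - F * N) * H = -(2 * (N * F - F * N)) := by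
      have : H * (N * F - F * N) - (N * F - F * N) * H
        = N * (H * F - F * H) - (H * F - F * H) * N := by
        calc _ = (H * N) * F - H * F * N - N * F * H + F * (N * H) := by noncomm_ring
          _ = N * H * F - H * F * N - N * F * H + F * (H * N) := by rw [hNH]
          _ = _ := by noncomm_ring
      rw [this, k3]; noncomm_ring
    -- `IsSl2Triple` demands a nonzero H; if H = 0, then [H, D] = -2D already gives D = 0.
    have hH0 : H ≠ 0 := by
      rintro rfl
      apply hne
      apply two_mul_cancel K
      simpa using hHD.symm
    have hK : CharZero K := charZero_of_injective_algebraMap (algebraMap ℝ K).injective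
    have t : IsSl2Triple H ((2 / h) • z) F := by
      refine ⟨hH0, ?_, ?_, ?_⟩
      · rw [Ring.lie_def, smul_mul_assoc, mul_smul_comm, ← smul_sub, k2, smul_smul]
        have := two_ne_zero' K
        rw [show 2 / h * (h / 2) = 1 by field_simp, one_smul]
      · rw [Ring.lie_def, smul_mul_assoc, mul_smul_comm, ← smul_sub, k1, smul_comm, nsmul_eq_mul]
        simp
      · rw [Ring.lie_def, k3, nsmul_eq_mul]; simp
    have P : t.HasPrimitiveVectorWith (N * F - F * N) (-2 : K) := by
      refine ⟨hne, ?_, ?_⟩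
      · rw [Ring.lie_def, hHD, neg_smul, ofNat_smul_eq_nsmul K 2, nsmul_eq_mul]; simp
      · rw [Ring.lie_def, smul_mul_assoc, mul_smul_comm, ← smul_sub, hzD, smul_zero]
    -- Primitive vectors in finite dimension have weights in ℕ, and -2 is not one of them in
    -- characteristic zero.
    obtain ⟨n, hn⟩ := P.exists_nat
    have : ((n + 2 : ℕ) : K) = 0 := by push_cast; rw [← hn]; ring
    exact absurd (Nat.cast_eq_zero.mp this) (by omega)
  -- `S` inverts `C` and commutes with N, so conjugation back turns [N, CYC] into [N, Y].
  have e : S * (N * F - F * N) * S = N * Y - Y * N := by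
    have hNS : S * N = N * S := (hSc N hNz.symm).eq
    calc _ = (S * N) * C * Y * (C * S) - (S * C) * Y * C * (N * S) := by rw [hF]; noncomm_ring
      _ = (N * S) * C * Y * (C * S) - (S * C) * Y * C * (S * N) := by rw [hNS]
      _ = N * (S * C) * Y * (C * S) - (S * C) * Y * (C * S) * N := by noncomm_ring
      _ = _ := by rw [hCS, hSC]; simp
  rw [hD] at e
  simpa [sub_eq_zero, eq_comm] using e

end Commutant

/-! ### The commutator with H as a derivation on a commutative ring -/

section CommutatorDerivation

variable {A B : Type*} [Ring A] [CommRing B]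

/-- The commutator with `H` sends the image of `f` under `j` to the image of `f'`. -/
def HasBracket (j : B →+* A) (H : A) (f f' : B) : Prop := H * j f - j f * H = j f'

namespace HasBracket

variable {j : B →+* A} {H : A} {f f' g g' : B}

theorem eq (hf : HasBracket j H f f') : H * j f = j f * H + j f' := by
  rw [HasBracket] at hf; rw [← hf]; abel

theorem congr (hf : HasBracket j H f f') (h : f' = g') : HasBracket j H f g' := h ▸ hf

theorem one : HasBracket j H 1 0 := by simp [HasBracket]

theorem add (hf : HasBracket j H f f') (hg : HasBracket j H g g') :
    HasBracket j H (f + g) (f' + g') := by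
  rw [HasBracket, map_add, mul_add, hf.eq, hg.eq, map_add]; noncomm_ring

theorem neg (hf : HasBracket j H f f') : HasBracket j H (-f) (-f') := by
  rw [HasBracket, map_neg, mul_neg, hf.eq, map_neg]; noncomm_ring

theorem mul (hf : HasBracket j H f f') (hg : HasBracket j H g g') :
    HasBracket j H (f * g) (f' * g + f * g') := by
  rw [HasBracket, map_mul, ← mul_assoc, hf.eq, add_mul, mul_assoc (j f), hg.eq, map_add, map_mul,
    map_mul]
  noncomm_ring

theorem inv {g : B} (hfg : f * g = 1) (hf : HasBracket j H f f') :
    HasBracket j H g (-(g * g * f')) := by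
  have h1 : j f * j g = 1 := by rw [← map_mul, hfg, map_one]
  have h2 : j g * j f = 1 := by rw [← map_mul, mul_comm, hfg, map_one]
  have h3 : j f * j (g * f') = j f' := by rw [← map_mul, ← mul_assoc, hfg, one_mul]
  have h4 : j f' * j g = j (g * f') := by rw [← map_mul, mul_comm]
  rw [HasBracket]
  calc H * j g - j g * H = (j g * j f) * H * j g - j g * H * (j f * j g) := by
        rw [h1, h2]; simp
    _ = -(j g * (H * j f - j f * H) * j g) := by noncomm_ring
    _ = -(j g * (j f' * j g)) := by rw [hf.eq]; noncomm_ring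
    _ = _ := by rw [h4, ← map_mul, ← map_neg, mul_assoc]

/-- The factor w is the logarithmic derivative of u, and logarithmic derivatives are additive.
Negative exponents are needed because they will be the weights 2m₁ and 2m₂. -/
theorem zpow {u : Bˣ} {w : B} (hu : HasBracket j H u (w * u)) (n : ℤ) :
    HasBracket j H ((u ^ n : Bˣ) : B) (n * w * ((u ^ n : Bˣ) : B)) := by
  have hinv : HasBracket j H ((u⁻¹ : Bˣ) : B) (-w * ((u⁻¹ : Bˣ) : B)) := by
    refine (hu.inv u.mul_inv).congr ?_
    linear_combination -(w * ((u⁻¹ : Bˣ) : B)) * u.mul_inv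
  induction n with
  | zero => simpa using one
  | succ n ih =>
    rw [zpow_add_one, Units.val_mul]
    exact (ih.mul hu).congr (by push_cast; ring)
  | pred n ih =>
    rw [zpow_sub_one, Units.val_mul]
    exact (ih.mul hinv).congr (by push_cast; ring)

end HasBracket

/-- Logarithmic derivatives of `(1 - y) / (1 + x y)` and `(1 + x) / (1 + x y)` with respect to a
derivation with `x ↦ 2 x t`, `y ↦ 2 y t'`, where `t = (1 + y) / (1 - y)`, `t' = (1 - x) / (1 + x)`. -/
theorem hasBracket_twist {j : B →+* A} {H : A} {x y k t t' : B} (hk : (1 + x * y) * k = 1)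
    (ht : t * (1 - y) = 1 + y) (ht' : t' * (1 + x) = 1 - x)
    (hx : HasBracket j H x (2 * x * t)) (hy : HasBracket j H y (2 * y * t')) :
    HasBracket j H ((1 - y) * k) ((1 - t) * ((1 - y) * k)) ∧
    HasBracket j H ((1 + x) * k) ((1 - t') * ((1 + x) * k)) := by
  have hK := (HasBracket.one.add (hx.mul hy)).inv hk
  constructor
  · rw [sub_eq_add_neg 1 y]
    refine ((HasBracket.one.add hy.neg).mul hK).congr ?_
    linear_combination (2 * x * y * k ^ 2 * (- 1)) * ht - 2 * y * k ^ 2 * ht' + k * ht + (2 * y * k * t' - 2 * y * k) * hk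
  · refine ((HasBracket.one.add hx).mul hK).congr ?_
    linear_combination 2 * x * k ^ 2 * ht - 2 * x * y * k ^ 2 * ht' + k * ht' + (2 * x * k - 2 * x * k * t) * hk

end CommutatorDerivation

/-! ### Generating function of the coefficients a -/

section TwistCoefficients

/-- `(-1) ^ k b^{m₁,m₂}_{k,l}` in terms of binomial coefficients. -/
def binomCoeff (M N k l : ℤ) : ℤ :=
  if 0 ≤ k ∧ 0 ≤ l then
    (-1) ^ l.toNat * Ring.choose (M + k) l.toNat * Ring.choose (N + l) k.toNat
  else 0

theorem binomCoeff_nat (M N : ℤ) (k l : ℕ) :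
    binomCoeff M N k l = (-1) ^ l * Ring.choose (M + k) l * Ring.choose (N + l) k := by
  simp [binomCoeff]

theorem binomCoeff_neg_left (M N l : ℤ) : binomCoeff M N (-1) l = 0 := by simp [binomCoeff]

theorem binomCoeff_neg_right (M N k : ℤ) : binomCoeff M N k (-1) = 0 := by simp [binomCoeff]

/-- Pascal's rule. For the generating functions b of the coefficients it says (1+xy) b_{M+1,N} =
(1-y) b_{M,N}, which is multiplication by R. The next lemma is the analogue (1+xy) b_{M,N+1} = (1+x)
b_{M,N} for S. -/
theorem binomCoeff_succ_left (M N : ℤ) (k l : ℕ) :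
    binomCoeff (M + 1) N k l + binomCoeff (M + 1) N (k - 1) (l - 1)
      = binomCoeff M N k l - binomCoeff M N k (l - 1) := by
  cases l with
  | zero =>
    simp only [Nat.cast_zero, zero_sub, binomCoeff_neg_right]
    rw [← Nat.cast_zero, binomCoeff_nat, binomCoeff_nat]; simp
  | succ l =>
    have e1 := Ring.choose_succ_succ (M + k) l
    rw [show ((l + 1 : ℕ) : ℤ) - 1 = l by push_cast; ring]
    cases k with
    | zero =>
      simp only [Nat.cast_zero, zero_sub, binomCoeff_neg_left] at e1 ⊢
      rw [← Nat.cast_zero, binomCoeff_nat, binomCoeff_nat, binomCoeff_nat]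
      simp only [Nat.cast_zero, add_zero, Ring.choose_zero_right] at e1 ⊢
      rw [e1]; ring
    | succ k =>
      have e2 := Ring.choose_succ_succ (N + l) k
      rw [show ((k + 1 : ℕ) : ℤ) - 1 = k by push_cast; ring]
      simp only [binomCoeff_nat]
      push_cast at e1 e2 ⊢
      rw [show M + 1 + (k + 1 : ℤ) = M + (k + 1) + 1 by ring, show M + 1 + (k : ℤ) = M + (k + 1) by ring,
        show N + (l + 1 : ℤ) = N + l + 1 by ring, e1, e2]
      ring

theorem binomCoeff_succ_right (M N : ℤ) (k l : ℕ) :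
    binomCoeff M (N + 1) k l + binomCoeff M (N + 1) (k - 1) (l - 1)
      = binomCoeff M N k l + binomCoeff M N (k - 1) l := by
  cases k with
  | zero =>
    simp only [Nat.cast_zero, zero_sub, binomCoeff_neg_left]
    rw [← Nat.cast_zero, binomCoeff_nat, binomCoeff_nat]; simp
  | succ k =>
    have e1 := Ring.choose_succ_succ (N + l) k
    rw [show ((k + 1 : ℕ) : ℤ) - 1 = k by push_cast; ring]
    cases l with
    | zero =>
      simp only [Nat.cast_zero, zero_sub, binomCoeff_neg_right] at e1 ⊢
      rw [← Nat.cast_zero, binomCoeff_nat, binomCoeff_nat, binomCoeff_nat]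
      simp only [Nat.cast_zero, add_zero, Ring.choose_zero_right] at e1 ⊢
      rw [e1]; ring
    | succ l =>
      have e2 := Ring.choose_succ_succ (M + k) l
      rw [show ((l + 1 : ℕ) : ℤ) - 1 = l by push_cast; ring]
      simp only [binomCoeff_nat]
      push_cast at e1 e2 ⊢
      rw [show N + 1 + (l + 1 : ℤ) = N + (l + 1) + 1 by ring, show N + 1 + (l : ℤ) = N + (l + 1) by ring,
        show M + (k + 1 : ℤ) = M + k + 1 by ring, e1, e2]
      ring

/-- The product of C(k,l) and C(l,k) vanishes off the diagonal, so b_{0,0} is the geometric series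
of 1/(1+xy). -/
theorem binomCoeff_zero (k l : ℕ) :
    binomCoeff 0 0 k l + binomCoeff 0 0 (k - 1) (l - 1) = if k = 0 ∧ l = 0 then 1 else 0 := by
  have key : ∀ k l : ℕ, binomCoeff 0 0 k l = if k = l then (-1) ^ l else 0 := by
    intro k l
    rw [binomCoeff_nat, zero_add, zero_add, Ring.choose_natCast, Ring.choose_natCast]
    rcases lt_trichotomy k l with hkl | hkl | hkl
    · rw [Nat.choose_eq_zero_of_lt hkl]; simp [hkl.ne]
    · simp [hkl]
    · rw [Nat.choose_eq_zero_of_lt hkl]; simp [hkl.ne']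
  cases k with
  | zero =>
    cases l with
    | zero => simpa [binomCoeff_neg_left] using key 0 0
    | succ l => simpa [binomCoeff_neg_left] using key 0 (l + 1)
  | succ k =>
    cases l with
    | zero => simpa [binomCoeff_neg_right] using key (k + 1) 0
    | succ l =>
      rw [show ((l + 1 : ℕ) : ℤ) - 1 = l by push_cast; ring,
        show ((k + 1 : ℕ) : ℤ) - 1 = k by push_cast; ring, key, key]
      split_ifs with h1 h2 h2 <;> simp_all [pow_succ]

variable {B : Type*} [CommRing B]

/-- A polynomial in `x` and `y` with given integral coefficients. -/
def truncSeries (n : ℕ) (x y : B) (c : ℤ → ℤ → ℤ) : B :=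
  ∑ k ∈ Finset.range n, ∑ l ∈ Finset.range n, (c k l : B) * (x ^ k * y ^ l)

theorem truncSeries_congr {n : ℕ} {x y : B} {c c' : ℤ → ℤ → ℤ}
    (h : ∀ k l : ℕ, c k l = c' k l) : truncSeries n x y c = truncSeries n x y c' := by
  simp only [truncSeries, h]

theorem truncSeries_add (n : ℕ) (x y : B) (c c' : ℤ → ℤ → ℤ) :
    truncSeries n x y c + truncSeries n x y c'
      = truncSeries n x y (fun k l => c k l + c' k l) := by
  simp only [truncSeries, ← Finset.sum_add_distrib]
  push_cast
  simp only [add_mul]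

theorem truncSeries_sub (n : ℕ) (x y : B) (c c' : ℤ → ℤ → ℤ) :
    truncSeries n x y c - truncSeries n x y c'
      = truncSeries n x y (fun k l => c k l - c' k l) := by
  simp only [truncSeries, ← Finset.sum_sub_distrib]
  push_cast
  simp only [sub_mul]

/-- The truncation is harmless: the only term pushed out of the range carries x^n = 0, and the term
that enters carries `c (-1)`. -/
theorem mul_sum_range_eq_shift {n : ℕ} {x : B} (hx : x ^ n = 0) (c : ℤ → B) (hc : c (-1) = 0) :
    x * ∑ k ∈ Finset.range n, c k * x ^ k = ∑ k ∈ Finset.range n, c (k - 1) * x ^ k := by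
  have h1 := Finset.sum_range_succ (fun k : ℕ => c (k - 1) * x ^ k) n
  have h2 := Finset.sum_range_succ' (fun k : ℕ => c (k - 1) * x ^ k) n
  simp only [hx, mul_zero, add_zero, Nat.cast_zero, zero_sub, hc, zero_mul, Nat.cast_add,
    Nat.cast_one, add_sub_cancel_right] at h1 h2
  rw [← h1, h2, Finset.mul_sum]
  exact Finset.sum_congr rfl fun k _ => by ring

theorem mul_truncSeries_left {n : ℕ} {x : B} (hx : x ^ n = 0) (y : B) (c : ℤ → ℤ → ℤ)
    (hc : ∀ l, c (-1) l = 0) :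
    x * truncSeries n x y c = truncSeries n x y (fun k l => c (k - 1) l) := by
  have := mul_sum_range_eq_shift hx
    (fun k => ∑ l ∈ Finset.range n, (c k l : B) * y ^ l) (by simp [hc])
  have e : ∀ c : ℤ → ℤ → ℤ, truncSeries n x y c
      = ∑ k ∈ Finset.range n, (∑ l ∈ Finset.range n, (c k l : B) * y ^ l) * x ^ k := fun c => by
    refine Finset.sum_congr rfl fun k _ => ?_
    rw [Finset.sum_mul]
    exact Finset.sum_congr rfl fun l _ => by ring
  rw [e, e]
  exact this

theorem mul_truncSeries_right {n : ℕ} (x : B) {y : B} (hy : y ^ n = 0) (c : ℤ → ℤ → ℤ)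
    (hc : ∀ k, c k (-1) = 0) :
    y * truncSeries n x y c = truncSeries n x y (fun k l => c k (l - 1)) := by
  simp only [truncSeries, Finset.mul_sum]
  refine Finset.sum_congr rfl fun k _ => ?_
  have := mul_sum_range_eq_shift hy (fun l => (c k l : B) * x ^ k) (by simp [hc])
  rw [Finset.mul_sum] at this
  convert this using 2 with l _ l _ <;> ring

/-- The generating function of the coefficients `a^{m₁,m₂}_{k,l}`. -/
theorem twist_eq_truncSeries {n : ℕ} (hn : n ≠ 0) {x y : B} (hx : x ^ n = 0) (hy : y ^ n = 0)
    (R S : Bˣ) (hR : (R : B) * (1 + x * y) = 1 - y) (hS : (S : B) * (1 + x * y) = 1 + x)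
    (M N : ℤ) :
    ((R ^ M * S ^ N : Bˣ) : B) = truncSeries n x y
      (fun k l => binomCoeff M N k l + binomCoeff M N (k - 1) (l - 1)) := by
  -- The recurrences in M and N and the value at (0,0) identify b_{M,N} with R^M S^N / (1+xy); the
  -- coefficients of the statement are those of (1+xy) b_{M,N}.
  set b : ℤ → ℤ → B := fun M N => truncSeries n x y (binomCoeff M N) with hb
  have hu : IsUnit (1 + x * y) := by
    refine IsNilpotent.isUnit_one_add ⟨n, ?_⟩
    rw [mul_pow, hx, zero_mul]
  have hxb : ∀ M N, x * b M N = truncSeries n x y (fun k l => binomCoeff M N (k - 1) l) :=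
    fun M N => mul_truncSeries_left hx y _ (binomCoeff_neg_left M N)
  have hyb : ∀ M N, y * b M N = truncSeries n x y (fun k l => binomCoeff M N k (l - 1)) :=
    fun M N => mul_truncSeries_right x hy _ (binomCoeff_neg_right M N)
  have hg : ∀ M N, (1 + x * y) * b M N = truncSeries n x y
      (fun k l => binomCoeff M N k l + binomCoeff M N (k - 1) (l - 1)) := by
    intro M N
    rw [add_mul, one_mul, mul_assoc, hyb, mul_truncSeries_left hx y _ , hb, truncSeries_add]
    intro l; simp [binomCoeff]
  have hM : ∀ M N, b (M + 1) N = R * b M N := by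
    intro M N
    apply hu.mul_left_cancel
    rw [hg, truncSeries_congr (c' := fun k l => binomCoeff M N k l - binomCoeff M N k (l - 1))
      (binomCoeff_succ_left M N), ← truncSeries_sub, ← hyb]
    simp only [hb]
    linear_combination -(truncSeries n x y (binomCoeff M N)) * hR
  have hN : ∀ M N, b M (N + 1) = S * b M N := by
    intro M N
    apply hu.mul_left_cancel
    rw [hg, truncSeries_congr (c' := fun k l => binomCoeff M N k l + binomCoeff M N (k - 1) l)
      (binomCoeff_succ_right M N), ← truncSeries_add, ← hxb]
    simp only [hb]
    linear_combination -(truncSeries n x y (binomCoeff M N)) * hS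
  have h0 : (1 + x * y) * b 0 0 = 1 := by
    rw [hg, truncSeries_congr (c' := fun k l => if k = 0 ∧ l = 0 then 1 else 0)]
    · obtain ⟨m, rfl⟩ := Nat.exists_eq_succ_of_ne_zero hn
      rw [truncSeries, Finset.sum_eq_single 0, Finset.sum_eq_single 0]
      · simp
      · intro l _ hl; simp [hl]
      · simp
      · intro k _ hk
        exact Finset.sum_eq_zero fun l _ => by simp [hk]
      · simp
    · intro k l
      rw [binomCoeff_zero]; norm_cast
  have hbM : ∀ M : ℤ, b M 0 = ((R ^ M : Bˣ) : B) * b 0 0 := by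
    intro M
    induction M with
    | zero => simp
    | succ n ih => rw [hM, ih, zpow_add_one, Units.val_mul]; ring
    | pred n ih =>
      apply R.isUnit.mul_left_cancel
      rw [← hM, sub_add_cancel, ih, zpow_sub_one, Units.val_mul]
      linear_combination -(((R ^ (-n : ℤ) : Bˣ) : B) * b 0 0) * R.mul_inv
  have hbMN : ∀ N : ℤ, b M N = ((S ^ N : Bˣ) : B) * b M 0 := by
    intro N
    induction N with
    | zero => simp
    | succ n ih => rw [hN, ih, zpow_add_one, Units.val_mul]; ring
    | pred n ih =>
      apply S.isUnit.mul_left_cancel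
      rw [← hN, sub_add_cancel, ih, zpow_sub_one, Units.val_mul]
      linear_combination -(((S ^ (-n : ℤ) : Bˣ) : B) * b M 0) * S.mul_inv
  rw [← hg, hbMN, hbM, Units.val_mul]
  linear_combination -(((R ^ M : Bˣ) : B) * ((S ^ N : Bˣ) : B)) * h0

variable {K : Type*} [Field K] [Algebra ℝ K]

theorem ascPochhammer_eval_neg_div_factorial (m : ℤ) (n : ℕ) :
    (ascPochhammer K n).eval (-(m : K)) / (n ! : K) = (-1) ^ n * (Ring.choose m n : ℤ) := by
  have : CharZero K := charZero_of_injective_algebraMap (algebraMap ℝ K).injective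
  rw [div_eq_iff (by exact_mod_cast n.factorial_ne_zero), ascPochhammer_eval_neg_eq_descPochhammer,
    ← descPochhammer_eval_cast, Polynomial.eval_eq_smeval,
    Ring.descPochhammer_eq_factorial_smul_choose]
  push_cast [nsmul_eq_mul]
  ring

theorem neg_one_pow_mul_bCoeff (M N : ℤ) (k l : ℤ) :
    (-1) ^ k * bCoeff K M N k l = (binomCoeff M N k l : K) := by
  rw [bCoeff, binomCoeff]
  split_ifs with hkl
  · obtain ⟨k, rfl⟩ := Int.eq_ofNat_of_zero_le hkl.1
    obtain ⟨l, rfl⟩ := Int.eq_ofNat_of_zero_le hkl.2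
    simp only [Int.toNat_natCast]
    have e1 := ascPochhammer_eval_neg_div_factorial (K := K) (M + k) l
    have e2 := ascPochhammer_eval_neg_div_factorial (K := K) (N + l) k
    have e3 : (-1 : K) ^ k * (-1) ^ k = 1 := by rw [← mul_pow]; simp
    rw [mul_comm (k ! : K), mul_div_mul_comm, ← neg_add', ← neg_add']
    push_cast at e1 e2 ⊢
    rw [e1, e2, zpow_natCast]
    linear_combination ((-1) ^ l * ((Ring.choose (M + k) l : ℤ) : K) * ((Ring.choose (N + l) k : ℤ) : K)) * e3
  · simp

/-- The sign (-1)^k is absorbed into `binomCoeff`. It differs between k and k - 1, which turns the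
difference in the definition of a into a sum. -/
theorem aCoeff_eq (h : K) (M N : ℤ) (k l : ℤ) :
    aCoeff h M N k l = (h / 2) ^ (k + l) *
      ((binomCoeff M N k l + binomCoeff M N (k - 1) (l - 1) : ℤ) : K) := by
  rw [aCoeff, Int.cast_add, ← neg_one_pow_mul_bCoeff, ← neg_one_pow_mul_bCoeff,
    zpow_sub_one₀ (by simp)]
  simp only [inv_neg, inv_one]
  ring

end TwistCoefficients

/-! ### The twist operator on the tensor product -/

section Twist

open scoped IsMulCommutative in
/-- Two commuting elements of a ring lie in the image of a commutative ring. -/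
theorem exists_commRing_of_commute.{u} {A : Type u} [Ring A] (x y : A) (hxy : x * y = y * x) :
    ∃ (B : Type u) (_ : CommRing B) (j : B →+* A) (X Y : B),
      Function.Injective j ∧ j X = x ∧ j Y = y := by
  have hc : ∀ a ∈ ({x, y} : Set A), ∀ b ∈ ({x, y} : Set A), a * b = b * a := by
    rintro a (rfl | rfl) b (rfl | rfl) <;> first | rfl | exact hxy | exact hxy.symm
  have := Subring.isMulCommutative_closure hc
  exact ⟨Subring.closure {x, y}, inferInstance, (Subring.closure {x, y}).subtype,
    ⟨x, Subring.subset_closure (by simp)⟩, ⟨y, Subring.subset_closure (by simp)⟩,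
    Subtype.val_injective, rfl, rfl⟩

section TensorBasis

variable {K : Type*} [Field K]

theorem tensor_hom_ext {d₁ d₂ : ℕ} {W : Type*} [AddCommGroup W] [Module K W]
    {f g : V K d₁ ⊗[K] V K d₂ →ₗ[K] W}
    (hfg : ∀ p ≤ d₁, ∀ q ≤ d₂, f (e K d₁ p ⊗ₜ e K d₂ q) = g (e K d₁ p ⊗ₜ e K d₂ q)) : f = g :=
  TensorProduct.ext (V_hom_ext fun p hp => V_hom_ext fun q hq => hfg p hp q hq)

/-- A basis of the tensor product, consisting of the vectors `e_p ⊗ e_q`. -/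
def tensorBasis (K : Type*) [Field K] (d₁ d₂ : ℕ) :
    Module.Basis (Fin (d₁ + 1) × Fin (d₂ + 1)) K (V K d₁ ⊗[K] V K d₂) :=
  (Pi.basisFun K (Fin (d₁ + 1))).tensorProduct (Pi.basisFun K (Fin (d₂ + 1)))

theorem tensorBasis_apply (d₁ d₂ : ℕ) (i : Fin (d₁ + 1) × Fin (d₂ + 1)) :
    tensorBasis K d₁ d₂ i = e K d₁ i.1 ⊗ₜ e K d₂ i.2 := by
  rw [tensorBasis, Module.Basis.tensorProduct_apply, e_eq_basis, e_eq_basis]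

theorem exists_tensor_hom {d₁ d₂ : ℕ} {W : Type*} [AddCommGroup W] [Module K W]
    (w : ℕ → ℕ → W) : ∃ f : V K d₁ ⊗[K] V K d₂ →ₗ[K] W,
      ∀ p ≤ d₁, ∀ q ≤ d₂, f (e K d₁ p ⊗ₜ e K d₂ q) = w p q := by
  refine ⟨(tensorBasis K d₁ d₂).constr K fun i => w i.1 i.2, fun p hp q hq => ?_⟩
  have := (tensorBasis K d₁ d₂).constr_basis K (fun i => w i.1 i.2)
    (⟨p, by omega⟩, ⟨q, by omega⟩)
  rwa [tensorBasis_apply] at this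

/-- The action of an operator on the left factor of a tensor product. -/
def leftAct {V W : Type*} [AddCommGroup V] [Module K V] [AddCommGroup W] [Module K W] :
    Module.End K V →ₐ[K] Module.End K (V ⊗[K] W) :=
  Module.endTensorEndAlgHom.comp Algebra.TensorProduct.includeLeft

/-- The action of an operator on the right factor of a tensor product. -/
def rightAct {V W : Type*} [AddCommGroup V] [Module K V] [AddCommGroup W] [Module K W] :
    Module.End K W →ₐ[K] Module.End K (V ⊗[K] W) :=
  Module.endTensorEndAlgHom.comp Algebra.TensorProduct.includeRight

section Act

variable {V W : Type*} [AddCommGroup V] [Module K V] [AddCommGroup W] [Module K W]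

theorem leftAct_tmul (f : Module.End K V) (v : V) (w : W) :
    leftAct f (v ⊗ₜ[K] w) = f v ⊗ₜ w := rfl

theorem rightAct_tmul (f : Module.End K W) (v : V) (w : W) :
    rightAct f (v ⊗ₜ[K] w) = v ⊗ₜ f w := rfl

theorem leftAct_mul_rightAct (f : Module.End K V) (g : Module.End K W) :
    leftAct f * rightAct g = rightAct g * (leftAct f : Module.End K (V ⊗[K] W)) :=
  TensorProduct.ext' fun _ _ => rfl

end Act

end TensorBasis

variable {K : Type*} [Field K] [Algebra ℝ K]

theorem isNilpotent_opz (h : K) (d : ℕ) : IsNilpotent (opz h d) := ⟨d + 1, opz_nilp h d⟩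

theorem opT_mul (h : K) (d : ℕ) : opT h d * (1 - opz h d) = 1 + opz h d := by
  rw [opT, mul_assoc, Ring.inverse_mul_cancel _ (isNilpotent_opz h d).isUnit_one_sub, mul_one]

theorem mul_opT (h : K) (d : ℕ) : (1 - opz h d) * opT h d = 1 + opz h d := by
  rw [opT, ← mul_assoc, show (1 - opz h d) * (1 + opz h d) = (1 + opz h d) * (1 - opz h d) by
    simp only [mul_add, add_mul, mul_sub, sub_mul, mul_one, one_mul]; abel, mul_assoc, Ring.mul_inverse_cancel _ (isNilpotent_opz h d).isUnit_one_sub,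
    mul_one]

theorem opTinv_mul (h : K) (d : ℕ) : opTinv h d * (1 + opz h d) = 1 - opz h d := by
  rw [opTinv, mul_assoc, Ring.inverse_mul_cancel _ (isNilpotent_opz h d).isUnit_one_add, mul_one]

theorem mul_opTinv (h : K) (d : ℕ) : (1 + opz h d) * opTinv h d = 1 - opz h d := by
  rw [opTinv, ← mul_assoc, show (1 + opz h d) * (1 - opz h d) = (1 - opz h d) * (1 + opz h d) by
    simp only [mul_add, add_mul, mul_sub, sub_mul, mul_one, one_mul]; abel, mul_assoc, Ring.mul_inverse_cancel _ (isNilpotent_opz h d).isUnit_one_add,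
    mul_one]

theorem opT_mul_opz (h : K) (d : ℕ) : opT h d * opz h d = opz h d * opT h d := by
  have := (opT_mul h d).trans (mul_opT h d).symm
  rw [mul_sub, sub_mul, mul_one, one_mul] at this
  exact sub_right_injective this

theorem opTinv_mul_opz (h : K) (d : ℕ) : opTinv h d * opz h d = opz h d * opTinv h d := by
  have := (opTinv_mul h d).trans (mul_opTinv h d).symm
  rw [mul_add, add_mul, mul_one, one_mul] at this
  exact add_left_cancel this

theorem opH_opz (h : K) (d : ℕ) : opH K d * opz h d - opz h d * opH K d = 2 * opz h d := by
  rw [opz, mul_smul_comm, smul_mul_assoc, ← smul_sub (h / 2) (opH K d * opZp K d), H_Zp,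
    smul_comm, ofNat_smul_eq_nsmul K 2, nsmul_eq_mul]
  simp

theorem alpha_pos (d : ℕ) (i : ℤ) : 0 < alpha d i := by
  rw [alpha]; positivity

/-- In the rescaled basis α_m e_m the operator Z_+ is a plain shift; this is the origin of the
quotients of α in the coefficients A. -/
theorem alpha_succ {d r : ℕ} (hr : r < d) :
    √(((d : ℝ) - r) * (r + 1)) = alpha d ((r + 1 : ℕ) : ℤ) / alpha d r := by
  obtain ⟨s, rfl⟩ := Nat.exists_eq_add_of_lt hr
  rw [alpha, alpha, ← Real.sqrt_div (by positivity)]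
  congr 1
  rw [show ((r + s + 1 : ℕ) : ℤ) - ((r + 1 : ℕ) : ℤ) = (s : ℕ) by push_cast; ring,
    show ((r + s + 1 : ℕ) : ℤ) - (r : ℤ) = (s + 1 : ℕ) by push_cast; ring]
  simp only [Int.toNat_natCast, Nat.factorial_succ]
  have h1 := Nat.factorial_ne_zero r
  have h2 := Nat.factorial_ne_zero s
  push_cast
  field_simp
  ring

theorem opz_pow_e (h : K) (d k r : ℕ) : (opz h d ^ k) (e K d r) =
    ((h / 2) ^ k * algebraMap ℝ K (alpha d ((r + k : ℕ) : ℤ) / alpha d r)) • e K d (r + k) := by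
  induction k with
  | zero => simp [div_self (alpha_pos d r).ne']
  | succ k ih =>
    rw [pow_succ', Module.End.mul_apply, ih, map_smul, opz, LinearMap.smul_apply, opZp_e]
    rcases le_or_gt d (r + k) with hd | hd
    · rw [e_eq_zero K (show d < r + k + 1 by omega), e_eq_zero K (show d < r + (k + 1) by omega)]
      simp
    · rw [alpha_succ hd, smul_smul, smul_smul, ← add_assoc, pow_succ]
      congr 1
      have : alpha d ((r + k + 1 : ℕ) : ℤ) / alpha d r = alpha d ((r + k : ℕ) : ℤ) / alpha d r
          * (alpha d ((r + k + 1 : ℕ) : ℤ) / alpha d ((r + k : ℕ) : ℤ)) := by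
        have := (alpha_pos d (r + k : ℕ)).ne'
        field_simp
      rw [this, map_mul]
      ring

/-- Passes from summation over the increments k to summation over the target index p + k; what lies
outside either range is zero. -/
theorem sum_range_shift {W : Type*} [AddCommMonoid W] (u : ℤ → W) (n p d : ℕ) (hn : d < n + p)
    (hneg : ∀ k < 0, u k = 0) (hbig : ∀ k : ℤ, (d : ℤ) < p + k → u k = 0) :
    ∑ k ∈ Finset.range n, u k = ∑ i ∈ Finset.range (d + 1), u ((i : ℤ) - p) := by
  have h1 : ∑ i ∈ Finset.range (d + 1), u ((i : ℤ) - p)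
      = ∑ i ∈ Finset.range (p + n), u ((i : ℤ) - p) := by
    refine Finset.sum_subset (Finset.range_subset_range.2 (by omega)) fun i _ hi => hbig _ ?_
    rw [Finset.mem_range] at hi
    omega
  have h2 : ∑ i ∈ Finset.range p, u ((i : ℤ) - p) = 0 := Finset.sum_eq_zero fun i hi => by
    rw [Finset.mem_range] at hi
    exact hneg _ (by omega)
  rw [h1, Finset.sum_range_add, h2, zero_add]
  simp

theorem ACoeff_eq_zero (h : K) (d₁ d₂ p q : ℕ) {k l : ℤ} (hkl : k < 0 ∨ l < 0) :
    ACoeff h d₁ d₂ p q k l = 0 := by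
  rw [ACoeff, aCoeff, bCoeff, bCoeff, if_neg (by omega), if_neg (by omega)]
  simp

/-- The coproduct of `H`, acting on the tensor product of two representations. -/
def tensorH (h : K) (d₁ d₂ : ℕ) : Module.End K (V K d₁ ⊗[K] V K d₂) :=
  leftAct (opH K d₁) * rightAct (opT h d₂) + leftAct (opTinv h d₁) * rightAct (opH K d₂)

theorem commutator_of_commute_left {A : Type*} [Ring A] {H T T' H' z : A} (hT : T * z = z * T)
    (hH' : H' * z = z * H') (hT' : T' * z = z * T') (hz : H * z - z * H = 2 * z) :
    (H * T + T' * H') * z - z * (H * T + T' * H') = 2 * z * T := by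
  calc _ = H * (T * z) + T' * (H' * z) - (z * H) * T - (z * T') * H' := by noncomm_ring
    _ = (H * z - z * H) * T := by rw [hT, hH', ← hT']; noncomm_ring
    _ = _ := by rw [hz]

theorem commutator_of_commute_right {A : Type*} [Ring A] {H T T' H' z : A} (hT : T * z = z * T)
    (hH : H * z = z * H) (hT' : T' * z = z * T') (hz : H' * z - z * H' = 2 * z) :
    (H * T + T' * H') * z - z * (H * T + T' * H') = 2 * z * T' := by
  calc _ = H * (T * z) + T' * (H' * z) - (z * H) * T - (z * T') * H' := by noncomm_ring
    _ = T' * (H' * z - z * H') := by rw [hT, ← hH, ← hT']; noncomm_ring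
    _ = _ := by rw [hz, two_mul, mul_add, hT']; noncomm_ring

theorem tensorH_leftAct (h : K) (d₁ d₂ : ℕ) :
    tensorH h d₁ d₂ * leftAct (opz h d₁) - leftAct (opz h d₁) * tensorH h d₁ d₂
      = 2 * leftAct (opz h d₁) * rightAct (opT h d₂) := by
  refine commutator_of_commute_left (leftAct_mul_rightAct _ _).symm (leftAct_mul_rightAct _ _).symm
    ?_ ?_
  · rw [← map_mul, opTinv_mul_opz, map_mul]
  · have := congrArg (leftAct (W := V K d₂)) (opH_opz h d₁)
    rw [map_sub, map_mul, map_mul, map_mul, map_ofNat] at this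
    exact this

theorem tensorH_rightAct (h : K) (d₁ d₂ : ℕ) :
    tensorH h d₁ d₂ * rightAct (opz h d₂) - rightAct (opz h d₂) * tensorH h d₁ d₂
      = 2 * rightAct (opz h d₂) * leftAct (opTinv h d₁) := by
  refine commutator_of_commute_right ?_ (leftAct_mul_rightAct _ _) (leftAct_mul_rightAct _ _) ?_
  · rw [← map_mul, opT_mul_opz, map_mul]
  · have := congrArg (rightAct (V := V K d₁)) (opH_opz h d₂)
    rw [map_sub, map_mul, map_mul, map_mul, map_ofNat] at this
    exact this

/-- The commutative algebra behind the twist. -/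
theorem exists_twist_units {B : Type*} [CommRing B] {n : ℕ} {X Y : B} (hX : X ^ n = 0)
    (hY : Y ^ n = 0) : ∃ (R S : Bˣ) (k t₁ t t' z : B), (1 + X * Y) * k = 1 ∧ (R : B) = (1 - Y) * k ∧
      (S : B) = (1 + X) * k ∧ t₁ * (1 - X) = 1 + X ∧ t * (1 - Y) = 1 + Y ∧ t' * (1 + X) = 1 - X ∧
      IsNilpotent z ∧ t₁ * t * (1 - z) = 1 + z ∧ (R : B) * R * X + S * S * Y = z := by
  have nX : IsNilpotent X := ⟨n, hX⟩
  have nY : IsNilpotent Y := ⟨n, hY⟩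
  obtain ⟨k, hk⟩ := ((Commute.all X Y).isNilpotent_mul_right nX).isUnit_one_add
  obtain ⟨a, ha⟩ := nY.isUnit_one_sub
  obtain ⟨c, hc⟩ := nX.isUnit_one_add
  obtain ⟨b, hb⟩ := nX.isUnit_one_sub
  have kk : (1 + X * Y) * ((k⁻¹ : Bˣ) : B) = 1 := by rw [← hk, k.mul_inv]
  have h1 : (1 + X) * ((b⁻¹ : Bˣ) : B) * (1 - X) = 1 + X := by rw [← hb, mul_assoc, b.inv_mul, mul_one]
  have h2 : (1 + Y) * ((a⁻¹ : Bˣ) : B) * (1 - Y) = 1 + Y := by rw [← ha, mul_assoc, a.inv_mul, mul_one]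
  -- The last two witnesses are (1-X)/(1+X), the Cayley transform for T⁻¹ on the left factor, and
  -- (X+Y)/(1+XY), the tanh of a sum.
  refine ⟨a * k⁻¹, c * k⁻¹, (k⁻¹ : Bˣ), (1 + X) * (b⁻¹ : Bˣ), (1 + Y) * (a⁻¹ : Bˣ),
    (1 - X) * (c⁻¹ : Bˣ), (X + Y) * (k⁻¹ : Bˣ), kk, by rw [Units.val_mul, ha],
    by rw [Units.val_mul, hc], h1, h2, by rw [← hc, mul_assoc, c.inv_mul, mul_one],
    (Commute.all _ _).isNilpotent_mul_right ((Commute.all X Y).isNilpotent_add nX nY), ?_, ?_⟩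
  · generalize (1 + X) * ((b⁻¹ : Bˣ) : B) = t₁ at *
    generalize (1 + Y) * ((a⁻¹ : Bˣ) : B) = t at *
    linear_combination (1 - t₁ * t) * kk + t * (1 - Y) * ((k⁻¹ : Bˣ) : B) * h1
      + (1 + X) * ((k⁻¹ : Bˣ) : B) * h2
  · rw [Units.val_mul, Units.val_mul, ha, hc]
    linear_combination (X + Y) * ((k⁻¹ : Bˣ) : B) * kk

/-- The series of the twist, applied to a basis vector. -/
theorem truncSeries_tmul (h : K) {d₁ d₂ p q n : ℕ} (hp : d₁ < n + p) (hq : d₂ < n + q) {B : Type*} [CommRing B]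
    (j : B →+* Module.End K (V K d₁ ⊗[K] V K d₂)) {X Y : B} (hX : j X = leftAct (opz h d₁))
    (hY : j Y = rightAct (opz h d₂)) :
    j (truncSeries n X Y (fun k l => binomCoeff (2 * p - d₁) (2 * q - d₂) k l
        + binomCoeff (2 * p - d₁) (2 * q - d₂) (k - 1) (l - 1))) (e K d₁ p ⊗ₜ e K d₂ q) =
      ∑ p' ∈ Finset.range (d₁ + 1), ∑ q' ∈ Finset.range (d₂ + 1),
        ACoeff h d₁ d₂ p q ((p' : ℤ) - p) ((q' : ℤ) - q) • (e K d₁ p' ⊗ₜ e K d₂ q') := by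
  have e1 : ∀ k l : ℕ, j (X ^ k * Y ^ l) (e K d₁ p ⊗ₜ e K d₂ q) =
      ((h / 2) ^ k * algebraMap ℝ K (alpha d₁ ((p + k : ℕ) : ℤ) / alpha d₁ p)
        * ((h / 2) ^ l * algebraMap ℝ K (alpha d₂ ((q + l : ℕ) : ℤ) / alpha d₂ q))) •
        (e K d₁ (p + k) ⊗ₜ e K d₂ (q + l)) := by
    intro k l
    rw [map_mul, map_pow, map_pow, hX, hY, ← map_pow, ← map_pow, Module.End.mul_apply,
      rightAct_tmul, leftAct_tmul, opz_pow_e, opz_pow_e, TensorProduct.smul_tmul_smul]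
  let u : ℤ → ℤ → V K d₁ ⊗[K] V K d₂ := fun k l =>
    ACoeff h d₁ d₂ p q k l • (e K d₁ (p + k).toNat ⊗ₜ e K d₂ (q + l).toNat)
  have e2 : j (truncSeries n X Y (fun k l => binomCoeff (2 * p - d₁) (2 * q - d₂) k l
        + binomCoeff (2 * p - d₁) (2 * q - d₂) (k - 1) (l - 1))) (e K d₁ p ⊗ₜ e K d₂ q)
      = ∑ k ∈ Finset.range n, ∑ l ∈ Finset.range n, u k l := by
    rw [truncSeries, map_sum, LinearMap.sum_apply]
    refine Finset.sum_congr rfl fun k _ => ?_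
    rw [map_sum, LinearMap.sum_apply]
    refine Finset.sum_congr rfl fun l _ => ?_
    rw [map_mul, map_intCast, Module.End.mul_apply, e1]
    simp only [u]
    rw [ACoeff, aCoeff_eq, show ((p : ℤ) + k).toNat = p + k by omega,
      show ((q : ℤ) + l).toNat = q + l by omega, map_smul, Module.End.intCast_apply,
      ← Int.cast_smul_eq_zsmul K, smul_smul, ← Nat.cast_add, ← Nat.cast_add, ← Nat.cast_add,
      zpow_natCast, pow_add, mul_div_mul_comm, map_mul]
    congr 1
    ring
  rw [e2, Finset.sum_congr rfl fun (k : ℕ) _ => sum_range_shift (u k) n q d₂ hq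
    (fun l hl => by simp only [u]; rw [ACoeff_eq_zero h _ _ _ _ (Or.inr hl), zero_smul])
    (fun l hl => by simp only [u]; rw [e_eq_zero K (show d₂ < ((q : ℤ) + l).toNat by omega)]; simp),
    sum_range_shift (fun k => ∑ q' ∈ Finset.range (d₂ + 1), u k ((q' : ℤ) - q)) n p d₁ hp
    (fun k hk => Finset.sum_eq_zero fun q' _ => by
      simp only [u]; rw [ACoeff_eq_zero h _ _ _ _ (Or.inl hk), zero_smul])
    (fun k hk => Finset.sum_eq_zero fun q' _ => by
      simp only [u]; rw [e_eq_zero K (show d₁ < ((p : ℤ) + k).toNat by omega)]; simp)]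
  refine Finset.sum_congr rfl fun p' _ => Finset.sum_congr rfl fun q' _ => ?_
  simp only [u]
  rw [show ((p : ℤ) + (p' - p)).toNat = p' by omega, show ((q : ℤ) + (q' - q)).toNat = q' by omega]

/-- An element t with t(1-X) = 1+X is determined by X once 1-X is a unit, so Cayley transforms
formed in the commutative ring and among the operators have the same image. -/
theorem map_eq_of_cayley {A B C F : Type*} [Ring A] [CommRing B] [Ring C] [FunLike F C A]
    [RingHomClass F C A] (j : B →+* A) (f : F) {X t : B} {z T : C} (hX : j X = f z)
    (hu : IsUnit (1 - X)) (ht : t * (1 - X) = 1 + X) (hT : T * (1 - z) = 1 + z) : j t = f T := by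
  apply (hu.map j).mul_right_cancel
  rw [← map_mul, ht, map_add, map_sub, map_one, hX, ← map_one f, ← map_sub, ← map_add, ← map_mul, hT]

theorem map_eq_of_cayley_inv {A B C F : Type*} [Ring A] [CommRing B] [Ring C] [FunLike F C A]
    [RingHomClass F C A] (j : B →+* A) (f : F) {X t : B} {z T : C} (hX : j X = f z)
    (hu : IsUnit (1 + X)) (ht : t * (1 + X) = 1 - X) (hT : T * (1 + z) = 1 - z) : j t = f T :=
  map_eq_of_cayley j f (X := -X) (z := -z) (by rw [map_neg, map_neg, hX]) (by simpa using hu)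
    (by simpa [sub_eq_add_neg] using ht) (by simpa [sub_eq_add_neg] using hT)

theorem cayley_map {A B : Type*} [Ring A] [CommRing B] (j : B →+* A) {t₁ t₂ z : B} {T₁ T₂ : A}
    (h : t₁ * t₂ * (1 - z) = 1 + z) (h₁ : j t₁ = T₁) (h₂ : j t₂ = T₂) :
    T₁ * T₂ * (1 - j z) = 1 + j z ∧ (1 - j z) * (T₁ * T₂) = 1 + j z := by
  subst h₁ h₂
  constructor
  · simpa using congrArg j h
  · rw [mul_comm] at h
    simpa using congrArg j h

section TwistAction

variable {h : K} {d₁ d₂ : ℕ} {B : Type*} [CommRing B]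
  {j : B →+* Module.End K (V K d₁ ⊗[K] V K d₂)} {R S : Bˣ}
  {F : Module.End K (V K d₁ ⊗[K] V K d₂)}

/-- Applying z to the left factor raises m₁ by one, so the exponent of R grows by two and F acquires
the factor R². -/
theorem twist_leftAct {X : B} (hX : j X = leftAct (opz h d₁))
    (hF : ∀ p q, F (e K d₁ p ⊗ₜ e K d₂ q) =
      j ((R ^ (2 * (p : ℤ) - d₁) * S ^ (2 * (q : ℤ) - d₂) : Bˣ) : B) (e K d₁ p ⊗ₜ[K] e K d₂ q))
    (p q : ℕ) : F (leftAct (opz h d₁) (e K d₁ p ⊗ₜ e K d₂ q)) =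
        j (((R ^ (2 * (p : ℤ) - d₁) * S ^ (2 * (q : ℤ) - d₂) : Bˣ) : B) * (R * R * X))
          (e K d₁ p ⊗ₜ e K d₂ q) := by
  have hR : R ^ (2 * ((p + 1 : ℕ) : ℤ) - d₁) = R ^ (2 * (p : ℤ) - d₁) * (R * R) := by
    rw [← pow_two, ← zpow_natCast, ← zpow_add]; congr 1; push_cast; ring
  rw [leftAct_tmul, opz, LinearMap.smul_apply, opZp_e, smul_smul, ← TensorProduct.smul_tmul',
    map_smul, hF, hR, ← map_smul, TensorProduct.smul_tmul', ← smul_smul, ← opZp_e,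
    ← LinearMap.smul_apply, ← opz, ← leftAct_tmul, ← hX, ← Module.End.mul_apply, ← map_mul]
  congr 2
  push_cast
  ring

theorem twist_rightAct {Y : B} (hY : j Y = rightAct (opz h d₂))
    (hF : ∀ p q, F (e K d₁ p ⊗ₜ e K d₂ q) =
      j ((R ^ (2 * (p : ℤ) - d₁) * S ^ (2 * (q : ℤ) - d₂) : Bˣ) : B) (e K d₁ p ⊗ₜ[K] e K d₂ q))
    (p q : ℕ) : F (rightAct (opz h d₂) (e K d₁ p ⊗ₜ e K d₂ q)) =
        j (((R ^ (2 * (p : ℤ) - d₁) * S ^ (2 * (q : ℤ) - d₂) : Bˣ) : B) * (S * S * Y))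
          (e K d₁ p ⊗ₜ e K d₂ q) := by
  have hS : S ^ (2 * ((q + 1 : ℕ) : ℤ) - d₂) = S ^ (2 * (q : ℤ) - d₂) * (S * S) := by
    rw [← pow_two, ← zpow_natCast, ← zpow_add]; congr 1; push_cast; ring
  rw [rightAct_tmul, opz, LinearMap.smul_apply, opZp_e, smul_smul, TensorProduct.tmul_smul,
    map_smul, hF, hS, ← map_smul, ← TensorProduct.tmul_smul, ← smul_smul, ← opZp_e,
    ← LinearMap.smul_apply, ← opz, ← rightAct_tmul, ← hY, ← Module.End.mul_apply, ← map_mul]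
  congr 2
  push_cast
  ring

theorem twist_opz {X Y z : B} (hX : j X = leftAct (opz h d₁)) (hY : j Y = rightAct (opz h d₂))
    (hz : (R : B) * R * X + S * S * Y = z)
    (hF : ∀ p q, F (e K d₁ p ⊗ₜ e K d₂ q) =
      j ((R ^ (2 * (p : ℤ) - d₁) * S ^ (2 * (q : ℤ) - d₂) : Bˣ) : B) (e K d₁ p ⊗ₜ[K] e K d₂ q)) :
    F * (leftAct (opz h d₁) + rightAct (opz h d₂)) = j z * F := by
  refine tensor_hom_ext fun p hp q hq => ?_
  have e1 := twist_leftAct hX hF p q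
  have e2 := twist_rightAct hY hF p q
  rw [Module.End.mul_apply, LinearMap.add_apply, map_add, e1, e2, Module.End.mul_apply, hF,
    ← LinearMap.add_apply, ← map_add, ← mul_add, hz, mul_comm, map_mul, Module.End.mul_apply]

theorem twist_opH {t t' : B} (hT : j t = rightAct (opT h d₂)) (hT' : j t' = leftAct (opTinv h d₁))
    (bR : HasBracket j (tensorH h d₁ d₂) (R : B) ((1 - t) * R))
    (bS : HasBracket j (tensorH h d₁ d₂) (S : B) ((1 - t') * S))
    (hF : ∀ p q, F (e K d₁ p ⊗ₜ e K d₂ q) =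
      j ((R ^ (2 * (p : ℤ) - d₁) * S ^ (2 * (q : ℤ) - d₂) : Bˣ) : B) (e K d₁ p ⊗ₜ[K] e K d₂ q)) :
    F * (leftAct (opH K d₁) + rightAct (opH K d₂)) = tensorH h d₁ d₂ * F := by
  refine tensor_hom_ext fun p hp q hq => ?_
  set M : ℤ := 2 * (p : ℤ) - d₁ with hM
  set N : ℤ := 2 * (q : ℤ) - d₂ with hN
  set v : V K d₁ ⊗[K] V K d₂ := e K d₁ p ⊗ₜ e K d₂ q with hv
  have hb := ((bR.zpow M).mul (bS.zpow N)).eq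
  rw [← Units.val_mul] at hb
  have hint : ∀ (n : ℤ) (b : B), j (n * b) v = (n : K) • j b v := fun n b => by
    rw [map_mul, map_intCast, Module.End.mul_apply, Module.End.intCast_apply]
    exact (Int.cast_smul_eq_zsmul K n _).symm
  have e1 : leftAct (opH K d₁) v = (M : K) • v := by
    rw [hv, leftAct_tmul, opH_e, hM, ← TensorProduct.smul_tmul']; push_cast; rfl
  have e2 : rightAct (opH K d₂) v = (N : K) • v := by
    rw [hv, rightAct_tmul, opH_e, hN, TensorProduct.tmul_smul]; push_cast; rfl
  -- On a weight vector H ⊗ T + T⁻¹ ⊗ H becomes M t + N t'. The bracket with R^M S^N contributes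
  -- M(1-t) + N(1-t'), and the sum is the scalar M + N.
  have e3 : tensorH h d₁ d₂ v = j (M * t + N * t') v := by
    rw [tensorH, leftAct_mul_rightAct, LinearMap.add_apply, Module.End.mul_apply,
      Module.End.mul_apply, e1, e2, map_add, LinearMap.add_apply, hint, hint, hT, hT', map_smul,
      map_smul]
  have e4 : F v = j ((R ^ M * S ^ N : Bˣ) : B) v := hF p q
  rw [Module.End.mul_apply, LinearMap.add_apply, e1, e2, Module.End.mul_apply, ← add_smul,
    map_smul, e4, ← Module.End.mul_apply, hb, LinearMap.add_apply, Module.End.mul_apply, e3,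
    ← Module.End.mul_apply, ← map_mul, ← LinearMap.add_apply, ← map_add, ← Int.cast_add, ← hint]
  congr 2
  push_cast
  ring

end TwistAction

/-- The twist, an operator on `V^(j₁) ⊗ V^(j₂)` that carries the primitive coproducts of `H` and
`Z_+` to the coproducts in `U_h(sl(2))`. -/
theorem exists_twist (h : K) (d₁ d₂ : ℕ) :
    ∃ F zt : Module.End K (V K d₁ ⊗[K] V K d₂), IsNilpotent zt ∧
      leftAct (opT h d₁) * rightAct (opT h d₂) * (1 - zt) = 1 + zt ∧
      (1 - zt) * (leftAct (opT h d₁) * rightAct (opT h d₂)) = 1 + zt ∧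
      F * (leftAct (opz h d₁) + rightAct (opz h d₂)) = zt * F ∧
      F * (leftAct (opH K d₁) + rightAct (opH K d₂)) = tensorH h d₁ d₂ * F ∧
      ∀ p ≤ d₁, ∀ q ≤ d₂, F (e K d₁ p ⊗ₜ e K d₂ q) =
        ∑ p' ∈ Finset.range (d₁ + 1), ∑ q' ∈ Finset.range (d₂ + 1),
          ACoeff h d₁ d₂ p q ((p' : ℤ) - p) ((q' : ℤ) - q) • (e K d₁ p' ⊗ₜ e K d₂ q') := by
  -- Rational identities in z ⊗ 1 and 1 ⊗ z are proved in a commutative ring `B` that maps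
  -- injectively to the operators; H stays outside `B` and enters only through `HasBracket`.
  obtain ⟨B, _, j, X, Y, hj, hX, hY⟩ := exists_commRing_of_commute
    (leftAct (W := V K d₂) (opz h d₁)) (rightAct (V := V K d₁) (opz h d₂)) (leftAct_mul_rightAct _ _)
  obtain ⟨n, hn⟩ : ∃ n, n = d₁ + d₂ + 1 := ⟨_, rfl⟩
  have hXn : X ^ n = 0 := by
    apply hj
    rw [map_pow, hX, ← map_pow, hn, show d₁ + d₂ + 1 = d₁ + 1 + d₂ by ring, pow_add, opz_nilp]
    simp
  have hYn : Y ^ n = 0 := by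
    apply hj
    rw [map_pow, hY, ← map_pow, hn, show d₁ + d₂ + 1 = d₂ + 1 + d₁ by ring, pow_add, opz_nilp]
    simp
  obtain ⟨R, S, k, t₁, t, t', z, hk, hR, hS, ht₁, ht, ht', hz, hTz, hRS⟩ := exists_twist_units hXn hYn
  have u1 : IsUnit (1 - X) := IsNilpotent.isUnit_one_sub ⟨n, hXn⟩
  have u2 : IsUnit (1 - Y) := IsNilpotent.isUnit_one_sub ⟨n, hYn⟩
  have u3 : IsUnit (1 + X) := IsNilpotent.isUnit_one_add ⟨n, hXn⟩
  have hT₁ : j t₁ = leftAct (opT h d₁) := map_eq_of_cayley j leftAct hX u1 ht₁ (opT_mul h d₁)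
  have hT₂ : j t = rightAct (opT h d₂) := map_eq_of_cayley j rightAct hY u2 ht (opT_mul h d₂)
  have hT₁' : j t' = leftAct (opTinv h d₁) :=
    map_eq_of_cayley_inv j leftAct hX u3 ht' (opTinv_mul h d₁)
  have bX : HasBracket j (tensorH h d₁ d₂) X (2 * X * t) := by
    rw [HasBracket, map_mul, map_mul, map_ofNat, hT₂, hX, tensorH_leftAct]
  have bY : HasBracket j (tensorH h d₁ d₂) Y (2 * Y * t') := by
    rw [HasBracket, map_mul, map_mul, map_ofNat, hT₁', hY, tensorH_rightAct]
  obtain ⟨bR, bS⟩ := hasBracket_twist hk ht ht' bX bY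
  rw [← hR] at bR
  rw [← hS] at bS
  -- The exponents depend on the basis vector, so F is defined on the basis and is not given as the
  -- image of one element of `B`.
  obtain ⟨F, hF⟩ := exists_tensor_hom (K := K) (d₁ := d₁) (d₂ := d₂) (fun p q =>
    j ((R ^ (2 * (p : ℤ) - d₁) * S ^ (2 * (q : ℤ) - d₂) : Bˣ) : B) (e K d₁ p ⊗ₜ[K] e K d₂ q))
  -- The formula persists beyond the range, where both sides are zero; it is used there when raising
  -- leads from p = d₁ to p + 1.
  have hF' : ∀ p q, F (e K d₁ p ⊗ₜ e K d₂ q) =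
      j ((R ^ (2 * (p : ℤ) - d₁) * S ^ (2 * (q : ℤ) - d₂) : Bˣ) : B) (e K d₁ p ⊗ₜ[K] e K d₂ q) := by
    intro p q
    rcases lt_or_ge d₁ p with hp | hp
    · simp [e_eq_zero K hp]
    rcases lt_or_ge d₂ q with hq | hq
    · simp [e_eq_zero K hq]
    exact hF p hp q hq
  refine ⟨F, j z, hz.map j, ?_, ?_, ?_, ?_, ?_⟩
  · exact (cayley_map j hTz hT₁ hT₂).1
  · exact (cayley_map j hTz hT₁ hT₂).2
  · exact twist_opz hX hY hRS hF'
  · exact twist_opH hT₂ hT₁' bR bS hF'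
  · intro p hp q hq
    rw [hF', twist_eq_truncSeries (by omega) hXn hYn R S
      (by rw [hR]; linear_combination (1 - Y) * hk) (by rw [hS]; linear_combination (1 + X) * hk)]
    exact truncSeries_tmul h (by omega) (by omega) j hX hY

end Twist

/-! ### The classical su(2) coupling -/

section Classical

/-- With 1/n! = 0 for n < 0 this holds for every integer, which spares the identities below all
boundary cases. -/
theorem mul_invFact (n : ℤ) : n * invFact n = invFact (n - 1) := by
  rcases lt_trichotomy n 0 with hn | rfl | hn
  · rw [invFact, invFact, if_neg (by omega), if_neg (by omega), mul_zero]
  · simp [invFact]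
  · obtain ⟨m, rfl⟩ : ∃ m : ℕ, n = m + 1 := ⟨(n - 1).toNat, by omega⟩
    rw [invFact, invFact, if_pos (by omega), if_pos (by omega), add_sub_cancel_right,
      show ((m : ℤ) + 1).toNat = m + 1 by omega, Int.toNat_natCast, Nat.factorial_succ]
    have := m.factorial_ne_zero
    push_cast
    field_simp

theorem invFact_of_neg {n : ℤ} (hn : n < 0) : invFact n = 0 := by
  rw [invFact, if_neg (by omega)]

theorem invFact_zero : invFact 0 = 1 := by simp [invFact]

theorem invFact_natCast_pos (n : ℕ) : 0 < invFact n := by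
  rw [invFact, if_pos (by omega)]
  positivity

/-- The binomial coefficient `a choose i`, divided by `a!`. -/
def invFactPair (a i : ℤ) : ℝ := invFact i * invFact (a - i)

theorem invFactPair_of_neg {a i : ℤ} (hi : i < 0) : invFactPair a i = 0 := by
  rw [invFactPair, invFact_of_neg hi, zero_mul]

theorem invFactPair_of_lt {a i : ℤ} (hi : a < i) : invFactPair a i = 0 := by
  rw [invFactPair, invFact_of_neg (n := a - i) (by omega), mul_zero]

theorem succ_mul_invFactPair (a i : ℤ) :
    (i + 1) * invFactPair a (i + 1) = (a - i) * invFactPair a i := by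
  have h1 := mul_invFact (i + 1)
  have h2 := mul_invFact (a - i)
  rw [add_sub_cancel_right] at h1
  rw [show a - i - 1 = a - (i + 1) by ring] at h2
  push_cast at h1 h2
  rw [invFactPair, invFactPair, ← h2, ← h1]
  ring

/-- The sum in the van der Waerden formula for the Clebsch-Gordan coefficients, a multiple of
the coefficient of `x ^ p y ^ q` in `(x - y) ^ s (1 + x) ^ a (1 + y) ^ b`. -/
def waerdenSum (a b : ℤ) (s : ℕ) (p q : ℤ) : ℝ :=
  ∑ k ∈ Finset.range (s + 1), (-1 : ℝ) ^ k * invFactPair s k * invFactPair a (p - s + k)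
    * invFactPair b (q - k)

theorem succ_mul_invFactPair_succ (s k : ℤ) : (s + 1) * invFactPair (s + 1) k =
    invFactPair s (k - 1) + invFactPair s k := by
  have h1 := mul_invFact k
  have h2 := mul_invFact (s + 1 - k)
  rw [show s + 1 - k - 1 = s - k by ring] at h2
  simp only [invFactPair]
  rw [show s - (k - 1) = s + 1 - k by ring, ← h1, ← h2]
  push_cast
  ring

/-- Multiplication of the generating polynomial by x - y; the factor s + 1 comes from the division
by s!. -/
theorem waerdenSum_succ (a b : ℤ) (s : ℕ) (p q : ℤ) : (s + 1) * waerdenSum a b (s + 1) p q =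
    waerdenSum a b s (p - 1) q - waerdenSum a b s p (q - 1) := by
  have e1 : (s + 1) * waerdenSum a b (s + 1) p q =
      ∑ k ∈ Finset.range (s + 1 + 1), ((-1 : ℝ) ^ k * invFactPair s k
        * invFactPair a (p - 1 - s + k) * invFactPair b (q - k))
      + ∑ k ∈ Finset.range (s + 1 + 1), ((-1 : ℝ) ^ k * invFactPair s (k - 1)
        * invFactPair a (p - 1 - s + k) * invFactPair b (q - k)) := by
    rw [waerdenSum, Finset.mul_sum, ← Finset.sum_add_distrib]
    refine Finset.sum_congr rfl fun k _ => ?_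
    have := succ_mul_invFactPair_succ s k
    push_cast at this ⊢
    rw [show p - ((s : ℤ) + 1) + k = p - 1 - s + k by ring]
    linear_combination ((-1 : ℝ) ^ k * invFactPair a (p - 1 - s + k) * invFactPair b (q - k)) * this
  have e2 := Finset.sum_range_succ (fun k : ℕ => (-1 : ℝ) ^ k * invFactPair s k
        * invFactPair a (p - 1 - s + k) * invFactPair b (q - k)) (s + 1)
  have e3 := Finset.sum_range_succ' (fun k : ℕ => (-1 : ℝ) ^ k * invFactPair s (k - 1)
        * invFactPair a (p - 1 - s + k) * invFactPair b (q - k)) (s + 1)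
  rw [invFactPair_of_lt (a := s) (by push_cast; omega)] at e2
  rw [invFactPair_of_neg (a := s) (i := ((0 : ℕ) : ℤ) - 1) (by simp)] at e3
  simp only [mul_zero, zero_mul, add_zero] at e2 e3
  rw [e1, e2, e3]
  rw [waerdenSum, waerdenSum, ← Finset.sum_add_distrib, ← Finset.sum_sub_distrib]
  refine Finset.sum_congr rfl fun k _ => ?_
  push_cast
  rw [show (k : ℤ) + 1 - 1 = k by ring, show p - 1 - (s : ℤ) + (k + 1) = p - s + k by ring,
    show q - ((k : ℤ) + 1) = q - 1 - k by ring]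
  ring

/-- The raising operator on `(x - y) ^ s (1 + x) ^ a (1 + y) ^ b`. -/
theorem waerdenSum_raise (a b : ℤ) (s : ℕ) (p q : ℤ) :
    (a + s - p + 1) * waerdenSum a b s (p - 1) q + (b + s - q + 1) * waerdenSum a b s p (q - 1)
      = (p + q - s) * waerdenSum a b s p q := by
  induction s generalizing p q with
  | zero =>
    have h1 := succ_mul_invFactPair a (p - 1)
    have h2 := succ_mul_invFactPair b (q - 1)
    rw [sub_add_cancel] at h1 h2
    simp only [waerdenSum, zero_add, Finset.range_one, Finset.sum_singleton, Nat.cast_zero, sub_zero,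
      add_zero, pow_zero, one_mul]
    push_cast at h1 h2
    linear_combination -(invFactPair 0 0 * invFactPair b q) * h1
      - (invFactPair 0 0 * invFactPair a p) * h2
  -- In its own representation, the tensor square of spin 1/2, the factor x - y is annihilated by
  -- the raising operator. By Leibniz it passes through, and its degree 1 is compensated by the
  -- change of s in p + q - s.
  | succ s ih =>
    have hs : (s + 1 : ℝ) ≠ 0 := by positivity
    apply mul_left_cancel₀ hs
    have e1 := waerdenSum_succ a b s p q
    have e2 := waerdenSum_succ a b s (p - 1) q
    have e3 := waerdenSum_succ a b s p (q - 1)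
    have i1 := ih (p - 1) q
    have i2 := ih p (q - 1)
    push_cast at i1 i2 ⊢
    linear_combination (a + (s + 1) - p + 1) * e2 + (b + (s + 1) - q + 1) * e3
      - (p + q - (s + 1)) * e1 + i1 - i2

theorem waerdenSum_neg_left (a b : ℤ) (s : ℕ) {p : ℤ} (hp : p < 0) (q : ℤ) :
    waerdenSum a b s p q = 0 := by
  refine Finset.sum_eq_zero fun k hk => ?_
  rw [Finset.mem_range] at hk
  rw [invFactPair_of_neg (a := a) (by omega)]
  ring

theorem waerdenSum_neg_right (a b : ℤ) (s : ℕ) (p : ℤ) {q : ℤ} (hq : q < 0) :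
    waerdenSum a b s p q = 0 := by
  refine Finset.sum_eq_zero fun k hk => ?_
  rw [invFactPair_of_neg (a := b) (by omega)]
  ring

theorem waerdenSum_eq_zero (a b : ℤ) (s : ℕ) {p q : ℤ} (h : a + b + s < p + q) :
    waerdenSum a b s p q = 0 := by
  refine Finset.sum_eq_zero fun k hk => ?_
  rcases lt_or_ge a (p - s + k) with h1 | h1
  · rw [invFactPair_of_lt h1]; ring
  · rw [invFactPair_of_lt (a := b) (by omega)]; ring

/-- This is the coefficient with m₁ = j₁ and m = j. Only k = 0 survives, without sign, in accordance
with the Condon-Shortley convention. -/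
theorem waerdenSum_highest_pos (a b s : ℕ) : 0 < waerdenSum a b s (a + s : ℕ) b := by
  rw [waerdenSum, Finset.sum_eq_single 0]
  · simp only [invFactPair]
    rw [show ((a + s : ℕ) : ℤ) - s + (0 : ℕ) = a by push_cast; ring]
    simp only [Nat.cast_zero, sub_zero, pow_zero, one_mul, sub_self, invFact_zero, mul_one]
    exact mul_pos (mul_pos (invFact_natCast_pos s) (invFact_natCast_pos a)) (invFact_natCast_pos b)
  · intro k _ hk
    rw [invFactPair_of_lt (a := a) (by push_cast; omega)]
    ring
  · simp

/-- Together with its variant below, this removes the square roots: with the weights √((d-p)! p!)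
split off, the matrix elements of Z_+ become integers. -/
theorem sqrt_mul_sqrt_factorial {d p : ℕ} (hp : p < d) :
    √(((d : ℝ) - p) * (p + 1)) * √(((d - p)! : ℝ) * (p ! : ℝ))
      = ((d : ℝ) - p) * √(((d - (p + 1))! : ℝ) * ((p + 1)! : ℝ)) := by
  obtain ⟨m, rfl⟩ := Nat.exists_eq_add_of_lt hp
  rw [show p + m + 1 - p = m + 1 by omega, show p + m + 1 - (p + 1) = m by omega,
    show ((p + m + 1 : ℕ) : ℝ) - p = m + 1 by push_cast; ring, ← Real.sqrt_mul (by positivity)]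
  rw [← Real.sqrt_sq (show (0 : ℝ) ≤ (m : ℝ) + 1 by positivity), ← Real.sqrt_mul (by positivity),
    Real.sqrt_sq (by positivity)]
  congr 1
  rw [Nat.factorial_succ, Nat.factorial_succ]
  push_cast
  ring

theorem sqrt_mul_sqrt_factorial' {d p : ℕ} (hp : p < d) :
    √(((d : ℝ) - p) * (p + 1)) * √(((d - (p + 1))! : ℝ) * ((p + 1)! : ℝ))
      = (p + 1) * √(((d - p)! : ℝ) * (p ! : ℝ)) := by
  obtain ⟨m, rfl⟩ := Nat.exists_eq_add_of_lt hp
  rw [show p + m + 1 - p = m + 1 by omega, show p + m + 1 - (p + 1) = m by omega,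
    show ((p + m + 1 : ℕ) : ℝ) - p = m + 1 by push_cast; ring, ← Real.sqrt_mul (by positivity)]
  rw [← Real.sqrt_sq (show (0 : ℝ) ≤ (p : ℝ) + 1 by positivity), ← Real.sqrt_mul (by positivity),
    Real.sqrt_sq (by positivity)]
  congr 1
  rw [Nat.factorial_succ, Nat.factorial_succ]
  push_cast
  ring

/-- The parameters are a = j + j₁ - j₂, b = j + j₂ - j₁ and s = j₁ + j₂ - j. The constant N collects
what depends on the spins only, so it drops out of linear recurrences in the weights. -/
theorem exists_su2CG_eq (a b s : ℕ) : ∃ N : ℝ, 0 < N ∧ ∀ p q r : ℕ,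
    su2CG (a + s) (b + s) (a + b) p q r = if p + q = r + s then
      N * √(((a + b - r)! : ℝ) * (r ! : ℝ)) * √(((a + s - p)! : ℝ) * (p ! : ℝ))
        * √(((b + s - q)! : ℝ) * (q ! : ℝ)) * waerdenSum a b s p q else 0 := by
  have hs : (a + s + (b + s) - (a + b)) / 2 = s := by omega
  refine ⟨√((((a + b : ℕ) : ℝ) + 1) * (((a + b + (a + s) - (b + s)) / 2)! : ℝ)
    * (((a + b + (b + s) - (a + s)) / 2)! : ℝ) * (s ! : ℝ)
        / (((a + s + (b + s) + (a + b)) / 2 + 1)! : ℝ)), by positivity, fun p q r => ?_⟩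
  have hw : WeightSum (a + s) (b + s) (a + b) p q r ↔ p + q = r + s := by
    rw [WeightSum]; push_cast; omega
  simp only [su2CG, hs, hw]
  split_ifs with h
  · have e1 : √((r ! : ℝ) * ((a + b - r)! : ℝ) * ((a + s - p)! : ℝ) * (p ! : ℝ) * ((b + s - q)! : ℝ)
        * (q ! : ℝ)) = √(((a + b - r)! : ℝ) * (r ! : ℝ)) * √(((a + s - p)! : ℝ) * (p ! : ℝ))
        * √(((b + s - q)! : ℝ) * (q ! : ℝ)) := by
      rw [← Real.sqrt_mul (by positivity), ← Real.sqrt_mul (by positivity)]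
      congr 1; ring
    have e2 : ∑ k ∈ Finset.range (s + 1), (-1 : ℝ) ^ k * invFact k * invFact ((s : ℤ) - k)
          * invFact (((a + s : ℕ) : ℤ) - p - k) * invFact ((q : ℤ) - k)
          * invFact ((p : ℤ) - s + k) * invFact (((b + s : ℕ) : ℤ) - s - q + k)
        = waerdenSum a b s p q := by
      refine Finset.sum_congr rfl fun k _ => ?_
      simp only [invFactPair]
      rw [show ((a + s : ℕ) : ℤ) - p - k = a - (p - s + k) by push_cast; ring,
        show ((b + s : ℕ) : ℤ) - s - q + k = b - (q - k) by push_cast; ring]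
      ring
    rw [e1, e2]
    ring
  · rfl

/-- The raising recurrence `waerdenSum_raise` with the normalization restored. The natural
subtractions p - 1 and q - 1 do no harm at 0, because the square roots in front of them vanish. -/
theorem su2CG_raise {a b s p q r : ℕ} (hp : p ≤ a + s) (hq : q ≤ b + s) (hr : r ≤ a + b) :
    √((((a + s : ℕ) : ℝ) - p + 1) * p) * su2CG (a + s) (b + s) (a + b) (p - 1) q r
      + √((((b + s : ℕ) : ℝ) - q + 1) * q) * su2CG (a + s) (b + s) (a + b) p (q - 1) r
      = √((((a + b : ℕ) : ℝ) - r) * (r + 1)) * su2CG (a + s) (b + s) (a + b) p q (r + 1) := by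
  obtain ⟨N, -, hN⟩ := exists_su2CG_eq a b s
  rw [hN, hN, hN]
  set Wr := √(((a + b - r)! : ℝ) * (r ! : ℝ)) with hWr
  set Wp := √(((a + s - p)! : ℝ) * (p ! : ℝ)) with hWp
  set Wq := √(((b + s - q)! : ℝ) * (q ! : ℝ)) with hWq
  have e1 : √((((a + s : ℕ) : ℝ) - p + 1) * p) * (if p - 1 + q = r + s then
      N * Wr * √(((a + s - (p - 1))! : ℝ) * ((p - 1)! : ℝ)) * Wq * waerdenSum a b s (p - 1 : ℕ) q
      else 0) = if p + q = r + 1 + s then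
        N * Wr * Wp * Wq * ((a + s - p + 1) * waerdenSum a b s (p - 1) q) else 0 := by
    cases p with
    | zero => rw [waerdenSum_neg_left (p := ((0 : ℕ) : ℤ) - 1) _ _ _ (by simp)]; simp
    | succ p =>
      have := sqrt_mul_sqrt_factorial (show p < a + s by omega)
      rw [show (((a + s : ℕ) : ℝ) - (p + 1 : ℕ) + 1) * (p + 1 : ℕ) = (((a + s : ℕ) : ℝ) - p) * (p + 1) by
        push_cast; ring, Nat.add_sub_cancel, mul_ite, mul_zero]
      refine if_congr (by omega) ?_ rfl
      rw [show ((p + 1 : ℕ) : ℤ) - 1 = p by push_cast; ring]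
      push_cast at this hWp ⊢
      rw [hWp]
      linear_combination (N * Wr * Wq * waerdenSum a b s p q) * this
  have e2 : √((((b + s : ℕ) : ℝ) - q + 1) * q) * (if p + (q - 1) = r + s then
      N * Wr * Wp * √(((b + s - (q - 1))! : ℝ) * ((q - 1)! : ℝ)) * waerdenSum a b s p (q - 1 : ℕ)
      else 0) = if p + q = r + 1 + s then
        N * Wr * Wp * Wq * ((b + s - q + 1) * waerdenSum a b s p (q - 1)) else 0 := by
    cases q with
    | zero => rw [waerdenSum_neg_right (q := ((0 : ℕ) : ℤ) - 1) _ _ _ _ (by simp)]; simp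
    | succ q =>
      have := sqrt_mul_sqrt_factorial (show q < b + s by omega)
      rw [show (((b + s : ℕ) : ℝ) - (q + 1 : ℕ) + 1) * (q + 1 : ℕ) = (((b + s : ℕ) : ℝ) - q) * (q + 1) by
        push_cast; ring, Nat.add_sub_cancel, mul_ite, mul_zero]
      refine if_congr (by omega) ?_ rfl
      rw [show ((q + 1 : ℕ) : ℤ) - 1 = q by push_cast; ring]
      push_cast at this hWq ⊢
      rw [hWq]
      linear_combination (N * Wr * Wp * waerdenSum a b s p q) * this
  rw [e1, e2]
  split_ifs with h
  · have h3 := waerdenSum_raise a b s p q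
    push_cast at h3
    have h' : (p : ℝ) + q - s = r + 1 := by
      have : ((p + q : ℕ) : ℝ) = ((r + 1 + s : ℕ) : ℝ) := by rw [h]
      push_cast at this
      linarith
    rw [h'] at h3
    rw [← mul_add, h3]
    -- At the top r = a + b the right side vanishes through its square root and the left side
    -- because p + q exceeds the degree a + b + s of the generating polynomial.
    rcases hr.lt_or_eq with hr | rfl
    · have := sqrt_mul_sqrt_factorial' hr
      push_cast at this ⊢
      linear_combination (-N * Wp * Wq * waerdenSum a b s p q) * this
    · rw [waerdenSum_eq_zero _ _ _ (by omega)]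
      simp
  · simp

variable {K : Type*} [Field K] [Algebra ℝ K]

theorem sum_smul_e_succ {d : ℕ} {W : Type*} [AddCommGroup W] [Module K W] (f : V K d →ₗ[K] W)
    (c : ℕ → ℝ) :
    ∑ p ∈ Finset.range (d + 1), algebraMap ℝ K (c p) • f (opZp K d (e K d p)) =
      ∑ p ∈ Finset.range (d + 1), algebraMap ℝ K (√(((d : ℝ) - p + 1) * p) * c (p - 1)) •
        f (e K d p) := by
  rw [Finset.sum_range_succ, Finset.sum_range_succ' _ d]
  simp only [opZp_e, e_eq_zero K (Nat.lt_succ_self d), smul_zero, map_zero, add_zero,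
    Nat.cast_zero, mul_zero, Real.sqrt_zero, zero_mul, zero_smul]
  refine Finset.sum_congr rfl fun p _ => ?_
  rw [map_smul, smul_smul, ← map_mul, Nat.add_sub_cancel, mul_comm,
    show ((d : ℝ) - (p + 1 : ℕ) + 1) * (p + 1 : ℕ) = ((d : ℝ) - p) * (p + 1) by push_cast; ring]

/-- The `su(2)`-coupling of two spins. -/
theorem exists_coupling (K : Type*) [Field K] [Algebra ℝ K] (a b s : ℕ) :
    ∃ f : V K (a + b) →ₗ[K] V K (a + s) ⊗[K] V K (b + s),
      (∀ r ≤ a + b, f (e K (a + b) r) = ∑ p ∈ Finset.range (a + s + 1), ∑ q ∈ Finset.range (b + s + 1),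
        algebraMap ℝ K (su2CG (a + s) (b + s) (a + b) p q r) •
          (e K (a + s) p ⊗ₜ[K] e K (b + s) q)) ∧
      (leftAct (opZp K (a + s)) + rightAct (opZp K (b + s))) ∘ₗ f = f ∘ₗ opZp K (a + b) ∧
      (leftAct (opH K (a + s)) + rightAct (opH K (b + s))) ∘ₗ f = f ∘ₗ opH K (a + b) := by
  set w : ℕ → V K (a + s) ⊗[K] V K (b + s) := fun r =>
    ∑ p ∈ Finset.range (a + s + 1), ∑ q ∈ Finset.range (b + s + 1),
        algebraMap ℝ K (su2CG (a + s) (b + s) (a + b) p q r) •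
          (e K (a + s) p ⊗ₜ[K] e K (b + s) q) with hw
  set f := (Pi.basisFun K (Fin (a + b + 1))).constr K fun r => w r with hf
  have hfe : ∀ r ≤ a + b, f (e K (a + b) r) = w r := by
    intro r hr
    have := (Pi.basisFun K (Fin (a + b + 1))).constr_basis K (fun r => w r) ⟨r, by omega⟩
    rwa [e_eq_basis] at this
  refine ⟨f, hfe, V_hom_ext fun r hr => ?_, V_hom_ext fun r hr => ?_⟩
  · have e1 : f (opZp K (a + b) (e K (a + b) r)) =
        algebraMap ℝ K (√((((a + b : ℕ) : ℝ) - r) * (r + 1))) • w (r + 1) := by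
      rw [opZp_e, map_smul]
      rcases hr.lt_or_eq with hr | rfl
      · rw [hfe _ hr]
      · simp
    rw [LinearMap.comp_apply, LinearMap.comp_apply, e1, hfe r hr]
    simp only [hw, LinearMap.add_apply, map_sum, map_smul, leftAct_tmul, rightAct_tmul, smul_add,
      Finset.sum_add_distrib]
    have e2 : ∀ q, ∑ p ∈ Finset.range (a + s + 1), algebraMap ℝ K
        (su2CG (a + s) (b + s) (a + b) p q r) • (opZp K (a + s) (e K (a + s) p) ⊗ₜ[K] e K (b + s) q)
        = ∑ p ∈ Finset.range (a + s + 1), algebraMap ℝ K (√((((a + s : ℕ) : ℝ) - p + 1) * p)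
          * su2CG (a + s) (b + s) (a + b) (p - 1) q r) • (e K (a + s) p ⊗ₜ[K] e K (b + s) q) :=
      fun q => sum_smul_e_succ ((TensorProduct.mk K _ _).flip (e K (b + s) q))
        (fun p => su2CG (a + s) (b + s) (a + b) p q r)
    have e3 : ∀ p, ∑ q ∈ Finset.range (b + s + 1), algebraMap ℝ K
        (su2CG (a + s) (b + s) (a + b) p q r) • (e K (a + s) p ⊗ₜ[K] opZp K (b + s) (e K (b + s) q))
        = ∑ q ∈ Finset.range (b + s + 1), algebraMap ℝ K (√((((b + s : ℕ) : ℝ) - q + 1) * q)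
          * su2CG (a + s) (b + s) (a + b) p (q - 1) r) • (e K (a + s) p ⊗ₜ[K] e K (b + s) q) :=
      fun p => sum_smul_e_succ (TensorProduct.mk K _ _ (e K (a + s) p))
        (fun q => su2CG (a + s) (b + s) (a + b) p q r)
    rw [Finset.sum_comm]
    simp only [e2, e3]
    rw [Finset.sum_comm, ← Finset.sum_add_distrib, Finset.smul_sum]
    refine Finset.sum_congr rfl fun p hp => ?_
    rw [← Finset.sum_add_distrib, Finset.smul_sum]
    refine Finset.sum_congr rfl fun q hq => ?_
    rw [Finset.mem_range] at hp hq
    rw [← add_smul, ← map_add, su2CG_raise (by omega) (by omega) hr, map_mul, smul_smul]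
  · rw [LinearMap.comp_apply, LinearMap.comp_apply, opH_e, map_smul, hfe r hr]
    simp only [hw, LinearMap.add_apply, map_sum, map_smul, leftAct_tmul, rightAct_tmul, opH_e,
      TensorProduct.tmul_smul, ← TensorProduct.smul_tmul', Finset.smul_sum]
    refine Finset.sum_congr rfl fun p _ => Finset.sum_congr rfl fun q _ => ?_
    obtain ⟨N, -, hN⟩ := exists_su2CG_eq a b s
    rw [hN]
    split_ifs with h
    · rw [← add_smul, smul_comm]
      congr 2
      have : ((p + q : ℕ) : K) = ((r + s : ℕ) : K) := by rw [h]
      push_cast at this ⊢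
      linear_combination 2 * this
    · simp

end Classical

/-! ### Homomorphisms detected by H and z -/

section Representations

variable {K : Type*} [Field K]

theorem adjoin_range_gen (h : K) : Algebra.adjoin K (Set.range (gen h)) = ⊤ := by
  have h1 : Set.range (gen h) = RingQuot.mkAlgHom K (Rel h) '' Set.range (FreeAlgebra.ι K) := by
    rw [← Set.range_comp]; rfl
  rw [h1, ← AlgHom.map_adjoin, FreeAlgebra.adjoin_range_ι, Algebra.map_top]
  exact (AlgHom.range_eq_top _).2 (RingQuot.mkAlgHom_surjective K (Rel h))

theorem endTensorEnd_eq {V W : Type*} [AddCommGroup V] [Module K V] [AddCommGroup W] [Module K W]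
    (f : Module.End K V) (g : Module.End K W) :
    Module.endTensorEndAlgHom (R := K) (S := K) (A := K) (f ⊗ₜ[K] g) = leftAct f * rightAct g := by
  refine TensorProduct.ext' fun v w => ?_
  rw [Module.End.mul_apply, rightAct_tmul, leftAct_tmul]
  rfl

variable [Algebra ℝ K]

theorem rep_H (h : K) (d : ℕ) : rep h d (gen h .H) = opH K d := by
  simp [rep, liftUh, gen, fg]

theorem rep_Y (h : K) (d : ℕ) : rep h d (gen h .Y) = opY h d := by
  simp [rep, liftUh, gen, fg]

theorem rep_T (h : K) (d : ℕ) : rep h d (gen h .T) = opT h d := by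
  simp [rep, liftUh, gen, fg]

theorem rep_Tinv (h : K) (d : ℕ) : rep h d (gen h .Tinv) = opTinv h d := by
  simp [rep, liftUh, gen, fg]

theorem tensorRep_H (h : K) (d₁ d₂ : ℕ) :
    tensorRep h (rep h d₁) (rep h d₂) (gen h .H) = tensorH h d₁ d₂ := by
  have : comul h (gen h .H) = gen h .H ⊗ₜ[K] gen h .T + gen h .Tinv ⊗ₜ[K] gen h .H := by
    simp [comul, liftUh, gen, fg]
  rw [tensorRep, AlgHom.comp_apply, AlgHom.comp_apply, this, map_add, map_add,
    Algebra.TensorProduct.map_tmul, Algebra.TensorProduct.map_tmul, endTensorEnd_eq,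
    endTensorEnd_eq, rep_H, rep_H, rep_T, rep_Tinv, tensorH]

theorem tensorRep_T (h : K) (d₁ d₂ : ℕ) :
    tensorRep h (rep h d₁) (rep h d₂) (gen h .T) = leftAct (opT h d₁) * rightAct (opT h d₂) := by
  have : comul h (gen h .T) = gen h .T ⊗ₜ[K] gen h .T := by
    simp [comul, liftUh, gen, fg]
  rw [tensorRep, AlgHom.comp_apply, AlgHom.comp_apply, this, Algebra.TensorProduct.map_tmul,
    endTensorEnd_eq, rep_T, rep_T]

/-- Since 1 - z is invertible, T is a function of z; T⁻¹ follows, Y is `commute_Y`, and the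
generators exhaust the algebra. -/
theorem commute_of_commute_H_z {M : Type*} [AddCommGroup M] [Module K M] [FiniteDimensional K M]
    {h : K} (hh : h ≠ 0) (ρ : Uh h →ₐ[K] Module.End K M) {z N : Module.End K M}
    (hz : IsNilpotent z) (hT : ρ (gen h .T) * (1 - z) = 1 + z)
    (hT' : (1 - z) * ρ (gen h .T) = 1 + z) (hNH : N * ρ (gen h .H) = ρ (gen h .H) * N)
    (hNz : N * z = z * N) (u : Uh h) : N * ρ u = ρ u * N := by
  have r1 : ρ (gen h .T) * ρ (gen h .Tinv) = 1 := by rw [← map_mul, gen_T_Tinv, map_one]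
  have r2 : ρ (gen h .Tinv) * ρ (gen h .T) = 1 := by rw [← map_mul, gen_Tinv_T, map_one]
  have r3 := congrArg ρ (gen_H_T h)
  have r4 := congrArg ρ (gen_T_Y h)
  have r5 := congrArg ρ (gen_H_Y h)
  simp only [map_sub, map_mul, map_one, map_smul, map_add, map_neg] at r3 r4 r5
  have cY := commute_Y h hh _ _ _ _ z N r2 r3 r4 r5 hT hT' hz hNH hNz
  have cT : N * ρ (gen h .T) = ρ (gen h .T) * N := by
    apply hz.isUnit_one_sub.mul_right_cancel
    calc N * ρ (gen h .T) * (1 - z) = N * (1 + z) := by rw [mul_assoc, hT]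
      _ = (1 + z) * N := by rw [mul_add, add_mul, hNz]; simp
      _ = ρ (gen h .T) * (N - z * N) := by rw [← hT]; noncomm_ring
      _ = _ := by rw [← hNz]; noncomm_ring
  have cT' : N * ρ (gen h .Tinv) = ρ (gen h .Tinv) * N := by
    calc N * ρ (gen h .Tinv) = ρ (gen h .Tinv) * (ρ (gen h .T) * N) * ρ (gen h .Tinv) := by
          rw [← mul_assoc, r2, one_mul]
      _ = ρ (gen h .Tinv) * N * (ρ (gen h .T) * ρ (gen h .Tinv)) := by rw [← cT]; noncomm_ring
      _ = _ := by rw [r1, mul_one]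
  have hu : u ∈ Algebra.adjoin K (Set.range (gen h)) := by rw [adjoin_range_gen]; trivial
  induction hu using Algebra.adjoin_induction with
  | mem x hx =>
    obtain ⟨g, rfl⟩ := hx
    cases g
    exacts [hNH, cY, cT, cT']
  | algebraMap r => rw [AlgHom.commutes]; exact (Algebra.commutes r N).symm
  | add x y _ _ hx hy => rw [map_add, mul_add, add_mul, hx, hy]
  | mul x y _ _ hx hy => rw [map_mul, ← mul_assoc, hx, mul_assoc, hy, mul_assoc]

/-- A linear map between finite-dimensional representations is a homomorphism if it is compatible
with `H` and with `z = tanh (h X / 2)`. -/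
theorem intertwines_of_H_z {M M' : Type*} [AddCommGroup M] [Module K M] [FiniteDimensional K M]
    [AddCommGroup M'] [Module K M'] [FiniteDimensional K M'] {h : K} (hh : h ≠ 0)
    (ρ : Uh h →ₐ[K] Module.End K M) (σ : Uh h →ₐ[K] Module.End K M') {z : Module.End K M}
    {z' : Module.End K M'} (hz : IsNilpotent z) (hz' : IsNilpotent z')
    (hT : ρ (gen h .T) * (1 - z) = 1 + z) (hT' : (1 - z) * ρ (gen h .T) = 1 + z)
    (hS : σ (gen h .T) * (1 - z') = 1 + z') (hS' : (1 - z') * σ (gen h .T) = 1 + z')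
    (f : M →ₗ[K] M') (hH : f ∘ₗ ρ (gen h .H) = σ (gen h .H) ∘ₗ f) (hf : f ∘ₗ z = z' ∘ₗ f)
    (u : Uh h) : f ∘ₗ ρ u = σ u ∘ₗ f := by
  set τ : Uh h →ₐ[K] Module.End K (M × M') :=
    (LinearMap.prodMapAlgHom K M M').comp (ρ.prod σ) with hτ
  set Z : Module.End K (M × M') := LinearMap.prodMapAlgHom K M M' (z, z') with hZ
  -- The block operator (v, v') ↦ (0, f v) commutes with ρ ⊕ σ exactly when f intertwines ρ and σ,
  -- which reduces homomorphisms to commutants.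
  set N : Module.End K (M × M') := LinearMap.inr K M M' ∘ₗ f ∘ₗ LinearMap.fst K M M' with hN
  have hτ' : ∀ x, τ x = LinearMap.prodMapAlgHom K M M' (ρ x, σ x) := fun x => rfl
  have hcomm : ∀ (a : Module.End K M) (b : Module.End K M'), f ∘ₗ a = b ∘ₗ f →
      N * LinearMap.prodMapAlgHom K M M' (a, b) = LinearMap.prodMapAlgHom K M M' (a, b) * N := by
    intro a b hab
    refine LinearMap.ext fun x => ?_
    have := LinearMap.congr_fun hab x.1
    simpa [hN, Prod.ext_iff] using this
  have key := commute_of_commute_H_z hh τ (z := Z) (N := N) ?_ ?_ ?_ (hcomm _ _ hH) (hcomm _ _ hf) u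
  · refine LinearMap.ext fun x => ?_
    have := congrArg Prod.snd (LinearMap.congr_fun key (x, 0))
    simpa [hN, hτ] using this
  · refine IsNilpotent.map ?_ _
    obtain ⟨n, hn⟩ := hz
    obtain ⟨m, hm⟩ := hz'
    exact ⟨n + m, Prod.ext (by simp [pow_add, hn]) (by simp [pow_add, hm])⟩
  · rw [hτ', hZ, ← map_one (LinearMap.prodMapAlgHom K M M'), ← map_sub, ← map_add, ← map_mul]
    congr 1
    exact Prod.ext hT hS
  · rw [hτ', hZ, ← map_one (LinearMap.prodMapAlgHom K M M'), ← map_sub, ← map_add, ← map_mul]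
    congr 1
    exact Prod.ext hT' hS'

end Representations

/-! ### Irreducibility of V^(j) -/

section Irreducible

variable {K : Type*} [Field K]

theorem opH_apply (d : ℕ) (y : V K d) (i : Fin (d + 1)) :
    opH K d y i = (2 * ((i : ℕ) : K) - d) * y i := by
  have : LinearMap.proj i ∘ₗ opH K d = (2 * ((i : ℕ) : K) - d) • LinearMap.proj i := by
    refine V_hom_ext fun r _ => ?_
    rw [LinearMap.comp_apply, opH_e]
    simp only [map_smul, LinearMap.proj_apply, LinearMap.smul_apply, e, smul_eq_mul]
    split_ifs with hi
    · rw [hi]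
    · simp
  exact LinearMap.congr_fun this y

theorem exists_pow_ne_zero_of_pow_eq_zero {M : Type*} [AddCommGroup M] [Module K M]
    (f : Module.End K M) {x : M} (hx : x ≠ 0) {n : ℕ} (hn : (f ^ n) x = 0) :
    ∃ m, (f ^ m) x ≠ 0 ∧ f ((f ^ m) x) = 0 := by
  obtain ⟨m, h1, h2⟩ := Nat.exists_not_and_succ_of_not_zero_of_exists
    (p := fun n => (f ^ n) x = 0) (by simpa using hx) ⟨n, hn⟩
  exact ⟨m, h1, by rwa [← Module.End.mul_apply, ← pow_succ']⟩

/-- An injective endomorphism of the finite-dimensional W is onto, so its inverse also preserves W.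
This is what makes subrepresentations stable under z and cosh(hX/2), which are not given as elements
of the algebra. -/
theorem mem_of_leftInverse {M : Type*} [AddCommGroup M] [Module K M] [FiniteDimensional K M]
    {W : Submodule K M} {f g : Module.End K M} (hf : ∀ w ∈ W, f w ∈ W) (hg : g * f = 1) :
    ∀ w ∈ W, g w ∈ W := by
  have hgf : ∀ x, g (f x) = x := fun x => by rw [← Module.End.mul_apply, hg, Module.End.one_apply]
  have hinj : Function.Injective (f.restrict hf) := fun x y hxy => by
    have := congrArg (fun w : W => g w) hxy
    simp only [LinearMap.coe_restrict_apply, hgf] at this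
    exact Subtype.ext this
  intro w hw
  obtain ⟨x, hx⟩ := (LinearMap.injective_iff_surjective.1 hinj) ⟨w, hw⟩
  have : f x = w := congrArg Subtype.val hx
  rw [← this, hgf]
  exact x.2

theorem pow_mem_of_mem {M : Type*} [AddCommGroup M] [Module K M] {W : Submodule K M}
    {f : Module.End K M} (hf : ∀ w ∈ W, f w ∈ W) (n : ℕ) : ∀ w ∈ W, (f ^ n) w ∈ W := by
  induction n with
  | zero => simp
  | succ n ih =>
    intro w hw
    rw [pow_succ', Module.End.mul_apply]
    exact hf _ (ih w hw)

theorem e_ne_zero {d r : ℕ} (hr : r ≤ d) : e K d r ≠ 0 := fun h0 => by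
  have := congrFun h0 ⟨r, by omega⟩
  simp [e] at this

theorem eq_top_of_e_mem {d : ℕ} {W : Submodule K (V K d)} (hW : ∀ r ≤ d, e K d r ∈ W) : W = ⊤ := by
  rw [← top_le_iff, ← (Pi.basisFun K (Fin (d + 1))).span_eq, Submodule.span_le]
  rintro _ ⟨i, rfl⟩
  rw [e_eq_basis]
  exact hW i (by have := i.isLt; omega)

variable [Algebra ℝ K]

theorem opZp_apply_succ (d : ℕ) (y : V K d) (r : ℕ) (hr : r < d) :
    opZp K d y ⟨r + 1, by omega⟩ =
      algebraMap ℝ K (√(((d : ℝ) - r) * (r + 1))) * y ⟨r, by omega⟩ := by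
  have : (LinearMap.proj (⟨r + 1, by omega⟩ : Fin (d + 1)) : V K d →ₗ[K] K) ∘ₗ opZp K d
      = algebraMap ℝ K (√(((d : ℝ) - r) * (r + 1))) •
        (LinearMap.proj (⟨r, by omega⟩ : Fin (d + 1)) : V K d →ₗ[K] K) := by
    refine V_hom_ext fun k _ => ?_
    rw [LinearMap.comp_apply, opZp_e]
    simp only [map_smul, LinearMap.proj_apply, LinearMap.smul_apply, e, smul_eq_mul,
      add_left_inj]
    split_ifs with hi
    · rw [hi]
    · simp
  exact LinearMap.congr_fun this y

theorem algebraMap_sqrt_ne_zero {x : ℝ} (hx : 0 < x) : algebraMap ℝ K (√x) ≠ 0 := by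
  rw [map_ne_zero]
  exact (Real.sqrt_pos.2 hx).ne'

/-- The matrix elements of Z_+ below the top are nonzero, so its kernel is the line of the highest
weight vector. -/
theorem eq_smul_of_opz_eq_zero {h : K} (hh : h ≠ 0) {d : ℕ} {y : V K d} (hy : opz h d y = 0) :
    y = y (Fin.last d) • e K d d := by
  have hy' : opZp K d y = 0 := by
    rw [opz, LinearMap.smul_apply, smul_eq_zero] at hy
    exact hy.resolve_left (div_ne_zero hh (two_ne_zero' K))
  ext i
  rw [Pi.smul_apply, smul_eq_mul, e]
  split_ifs with hi
  · rw [mul_one]; congr 1; exact Fin.ext hi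
  · rw [mul_zero]
    have hid : (i : ℕ) < d := by have := i.isLt; omega
    have h1 := opZp_apply_succ d y i hid
    rw [hy', Pi.zero_apply, eq_comm, mul_eq_zero] at h1
    refine h1.resolve_left (algebraMap_sqrt_ne_zero ?_)
    have : ((i : ℕ) : ℝ) < d := by exact_mod_cast hid
    exact mul_pos (by linarith) (by positivity)

/-- The representations `V^(j)` are irreducible. -/
theorem rep_irreducible {h : K} (hh : h ≠ 0) (d : ℕ) (W : Submodule K (V K d))
    (hW : ∀ u : Uh h, ∀ w ∈ W, rep h d u w ∈ W) : W = ⊥ ∨ W = ⊤ := by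
  refine or_iff_not_imp_left.2 fun hbot => ?_
  have two := two_ne_zero' K
  have wT : ∀ w ∈ W, (1 + opT h d) w ∈ W := fun w hw => by
    rw [LinearMap.add_apply, ← rep_T]
    exact W.add_mem hw (hW _ w hw)
  -- Here 1 + T = 2(1-z)⁻¹, so W is stable under (1-z)/2 and hence under z.
  have wz : ∀ w ∈ W, opz h d w ∈ W := by
    have e1 : ((2 : K)⁻¹ • (1 - opz h d)) * (1 + opT h d) = 1 := by
      rw [smul_mul_assoc, mul_add, mul_opT, mul_one, sub_add_add_cancel, ← two_smul K, smul_smul,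
        inv_mul_cancel₀ two, one_smul]
    have e2 := mem_of_leftInverse wT e1
    intro w hw
    have e3 := W.sub_mem hw (W.smul_mem 2 (e2 w hw))
    rw [LinearMap.smul_apply, smul_smul, mul_inv_cancel₀ two, one_smul, LinearMap.sub_apply,
      Module.End.one_apply, sub_sub_cancel] at e3
    exact e3
  have wS : ∀ w ∈ W, opSech h d w ∈ W := by
    intro w hw
    rw [opSech, LinearMap.sum_apply]
    refine W.sum_mem fun k _ => W.smul_mem _ (pow_mem_of_mem (fun v hv => ?_) k w hw)
    rw [LinearMap.neg_apply]
    exact W.neg_mem (pow_mem_of_mem wz 2 v hv)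
  obtain ⟨C, hC⟩ : IsUnit (opSech h d) := by
    have h1 : IsUnit (opSech h d * opSech h d) := by
      rw [opSech_sq]
      exact ((Commute.refl _).isNilpotent_mul_right (isNilpotent_opz h d)).isUnit_one_sub
    exact ((Commute.refl (opSech h d)).isUnit_mul_iff.1 h1).1
  have hC1 : (↑C⁻¹ : Module.End K (V K d)) * opSech h d = 1 := by rw [← hC, C.inv_mul]
  have hC2 : opSech h d * (↑C⁻¹ : Module.End K (V K d)) = 1 := by rw [← hC, C.mul_inv]
  have wC := mem_of_leftInverse wS hC1
  have wZm : ∀ w ∈ W, opZm K d w ∈ W := by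
    intro w hw
    have e1 : opZm K d = ↑C⁻¹ * opY h d * ↑C⁻¹ := by
      rw [opY]
      calc opZm K d = (↑C⁻¹ * opSech h d) * opZm K d * (opSech h d * ↑C⁻¹) := by
            rw [hC1, hC2, one_mul, mul_one]
        _ = _ := by noncomm_ring
    rw [e1, Module.End.mul_apply, Module.End.mul_apply, ← rep_Y]
    exact wC _ (hW _ _ (wC _ hw))
  obtain ⟨w, hw, hw0⟩ := W.exists_mem_ne_zero_of_ne_bot hbot
  obtain ⟨m, hm, hm'⟩ := exists_pow_ne_zero_of_pow_eq_zero (opz h d) hw0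
    (n := d + 1) (by rw [opz_nilp]; rfl)
  have htop : e K d d ∈ W := by
    have h1 := eq_smul_of_opz_eq_zero hh hm'
    have h2 := pow_mem_of_mem wz m w hw
    rw [h1] at h2 hm
    exact (W.smul_mem_iff (left_ne_zero_of_smul hm)).1 h2
  refine eq_top_of_e_mem fun r hr => ?_
  -- Descent from the highest weight vector by Z_-, whose matrix elements are nonzero above the
  -- bottom.
  induction hk : d - r generalizing r with
  | zero => rwa [show r = d by omega]
  | succ k ih =>
    have h1 := wZm _ (ih (r + 1) (by omega) (by omega))
    rw [opZm_e, Nat.add_sub_cancel] at h1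
    refine (W.smul_mem_iff (algebraMap_sqrt_ne_zero ?_)).1 h1
    have : ((r + 1 : ℕ) : ℝ) ≤ d := by exact_mod_cast (show r + 1 ≤ d by omega)
    exact mul_pos (by positivity) (by linarith)

end Irreducible

/-! ### The coefficients of the coupled vectors -/

section Coefficients

variable {K : Type*} [Field K]

theorem sum_tmul_injective {d₁ d₂ : ℕ} {c c' : Fin (d₁ + 1) → Fin (d₂ + 1) → K}
    (hcc : ∑ p : Fin (d₁ + 1), ∑ q : Fin (d₂ + 1), c p q • (e K d₁ p ⊗ₜ[K] e K d₂ q)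
      = ∑ p : Fin (d₁ + 1), ∑ q : Fin (d₂ + 1), c' p q • (e K d₁ p ⊗ₜ[K] e K d₂ q)) (p q) :
    c p q = c' p q := by
  have key : ∀ c : Fin (d₁ + 1) → Fin (d₂ + 1) → K,
      ∑ p : Fin (d₁ + 1), ∑ q : Fin (d₂ + 1), c p q • (e K d₁ p ⊗ₜ[K] e K d₂ q)
        = ∑ i, c i.1 i.2 • tensorBasis K d₁ d₂ i := fun c => by
    rw [Fintype.sum_prod_type]
    simp only [tensorBasis_apply]
  rw [key, key] at hcc
  have := congrArg (fun x => (tensorBasis K d₁ d₂).repr x (p, q)) hcc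
  simpa only [Module.Basis.repr_sum_self] using this

variable [Algebra ℝ K]

theorem cgSum_eq_sum (h : K) (d₁ d₂ d p q r : ℕ) : cgSum h d₁ d₂ d p q r =
    ∑ x ∈ Finset.range (d₁ + 1) ×ˢ Finset.range (d₂ + 1),
      algebraMap ℝ K (su2CG d₁ d₂ d x.1 x.2 r)
        * ACoeff h d₁ d₂ x.1 x.2 ((p : ℤ) - x.1) ((q : ℤ) - x.2) := by
  rw [cgSum]
  refine Finset.sum_filter_of_ne fun x _ hx => ?_
  by_contra hw
  exact hx (by simp [su2CG, hw])

theorem ACoeff_zero_zero (h : K) (d₁ d₂ p q : ℕ) :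
    ACoeff h d₁ d₂ p q 0 0 = 1 := by
  have h1 := (alpha_pos d₁ p).ne'
  have h2 := (alpha_pos d₂ q).ne'
  simp only [ACoeff, aCoeff, bCoeff, add_zero, div_self (mul_ne_zero h1 h2)]
  simp

/-- The twist does not change the coefficients of the vectors whose weight is the sum of the
weights of the factors. -/
theorem cgSum_eq_su2CG (h : K) {d₁ d₂ d p q r : ℕ} (hp : p ≤ d₁) (hq : q ≤ d₂)
    (hw : WeightSum d₁ d₂ d p q r) :
    cgSum h d₁ d₂ d p q r = algebraMap ℝ K (su2CG d₁ d₂ d p q r) := by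
  rw [cgSum, Finset.sum_eq_single (p, q)]
  · simp only [sub_self, ACoeff_zero_zero, mul_one]
  · rintro ⟨p', q'⟩ hx hne
    rw [Finset.mem_filter] at hx
    have hw' := hx.2
    simp only [WeightSum] at hw hw'
    -- Both index pairs have the same sum, so if they differ, one of the two increments is negative,
    -- where A vanishes.
    rw [ACoeff_eq_zero, mul_zero]
    simp only [ne_eq, Prod.mk.injEq] at hne
    dsimp only at hw' ⊢
    omega
  · intro hx
    exact absurd (Finset.mem_filter.2 ⟨Finset.mem_product.2
      ⟨Finset.mem_range.2 (by dsimp only; omega), Finset.mem_range.2 (by dsimp only; omega)⟩, hw⟩) hx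

/-- The twist only adds vectors of higher total weight, so the classical coefficient with m₁ = j₁, m
= j, which is positive, survives in the highest weight vector. -/
theorem cgSum_highest_ne_zero (h : K) (a b s : ℕ) :
    cgSum h (a + s) (b + s) (a + b) (a + s) b (a + b) ≠ 0 := by
  rw [cgSum_eq_su2CG h le_rfl (by omega) (by rw [WeightSum]; push_cast; ring), map_ne_zero]
  obtain ⟨N, hN, hN'⟩ := exists_su2CG_eq a b s
  rw [hN', if_pos (by omega)]
  have := waerdenSum_highest_pos a b s
  positivity

end Coefficients

/-! ### Embeddings of the summands and the dimension count -/

section Decomposition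

variable {K : Type*} [Field K] [Algebra ℝ K]

/-- The triangle and parity conditions are equivalent to j + j₁ - j₂, j + j₂ - j₁ and j₁ + j₂ - j
being natural numbers; these are a, b and s. -/
theorem exists_eq_of_coupledSpin {d₁ d₂ : ℕ} (d : CoupledSpin d₁ d₂) :
    ∃ a b s : ℕ, d₁ = a + s ∧ d₂ = b + s ∧ d.1 = a + b := by
  obtain ⟨d, h1, h2, k, h3⟩ := d
  rw [abs_le] at h1
  exact ⟨(d + d₁ - d₂) / 2, (d + d₂ - d₁) / 2, (d₁ + d₂ - d) / 2, by omega, by omega, by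
    dsimp only; omega⟩

/-- The embeddings of the representations `V^(j)` in a tensor product. They are the embeddings for
`sl(2)`, followed by the twist. -/
theorem exists_embedding {h : K} (hh : h ≠ 0) (d₁ d₂ : ℕ) :
    ∃ zt : Module.End K (V K d₁ ⊗[K] V K d₂), ∀ d : CoupledSpin d₁ d₂,
      ∃ f : V K d.1 →ₗ[K] V K d₁ ⊗[K] V K d₂,
        (∀ u : Uh h, f ∘ₗ rep h d.1 u = tensorRep h (rep h d₁) (rep h d₂) u ∘ₗ f) ∧
        f ∘ₗ opz h d.1 = zt ∘ₗ f ∧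
        ∀ r ≤ d.1, f (e K d.1 r) = ∑ p : Fin (d₁ + 1), ∑ q : Fin (d₂ + 1),
          cgSum h d₁ d₂ d.1 p q r • (e K d₁ p ⊗ₜ[K] e K d₂ q) := by
  obtain ⟨F, zt, hzt, hT, hT', hz, hH, hF⟩ := exists_twist h d₁ d₂
  -- One operator serves all spins at once: it is the coproduct of z, and `toModule_injective` needs
  -- it to be common to the summands.
  refine ⟨zt, fun d => ?_⟩
  obtain ⟨f, hf, hfz, hfH⟩ : ∃ f : V K d.1 →ₗ[K] V K d₁ ⊗[K] V K d₂,
      (∀ r ≤ d.1, f (e K d.1 r) = ∑ p ∈ Finset.range (d₁ + 1), ∑ q ∈ Finset.range (d₂ + 1),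
        algebraMap ℝ K (su2CG d₁ d₂ d.1 p q r) • (e K d₁ p ⊗ₜ e K d₂ q)) ∧
      (leftAct (opZp K d₁) + rightAct (opZp K d₂)) ∘ₗ f = f ∘ₗ opZp K d.1 ∧
      (leftAct (opH K d₁) + rightAct (opH K d₂)) ∘ₗ f = f ∘ₗ opH K d.1 := by
    obtain ⟨a, b, s, rfl, rfl, hd⟩ := exists_eq_of_coupledSpin d
    rw [hd]
    exact exists_coupling K a b s
  have hfz' : (leftAct (opz h d₁) + rightAct (opz h d₂)) ∘ₗ f = f ∘ₗ opz h d.1 := by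
    simp only [opz, map_smul]
    rw [← smul_add, LinearMap.smul_comp, hfz, LinearMap.comp_smul]
  have hFfz : (F ∘ₗ f) ∘ₗ opz h d.1 = zt ∘ₗ (F ∘ₗ f) := by
    rw [LinearMap.comp_assoc, ← hfz', ← LinearMap.comp_assoc, ← LinearMap.comp_assoc,
      ← Module.End.mul_eq_comp, ← Module.End.mul_eq_comp, hz]
  refine ⟨F ∘ₗ f, ?_, hFfz, fun r hr => ?_⟩
  · refine intertwines_of_H_z hh _ _ (isNilpotent_opz h d.1) hzt ?_ ?_ ?_ ?_ _ ?_ hFfz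
    · rw [rep_T, opT_mul]
    · rw [rep_T, mul_opT]
    · rw [tensorRep_T, hT]
    · rw [tensorRep_T, hT']
    · rw [rep_H, tensorRep_H, LinearMap.comp_assoc, ← hfH, ← LinearMap.comp_assoc,
        ← LinearMap.comp_assoc, ← Module.End.mul_eq_comp, ← Module.End.mul_eq_comp, hH]
  · have e1 : ∀ x ∈ Finset.range (d₁ + 1) ×ˢ Finset.range (d₂ + 1),
        F (algebraMap ℝ K (su2CG d₁ d₂ d.1 x.1 x.2 r) • (e K d₁ x.1 ⊗ₜ e K d₂ x.2))
          = ∑ y ∈ Finset.range (d₁ + 1) ×ˢ Finset.range (d₂ + 1),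
            (algebraMap ℝ K (su2CG d₁ d₂ d.1 x.1 x.2 r)
              * ACoeff h d₁ d₂ x.1 x.2 ((y.1 : ℤ) - x.1) ((y.2 : ℤ) - x.2))
              • (e K d₁ y.1 ⊗ₜ e K d₂ y.2) := by
      intro x hx
      rw [Finset.mem_product, Finset.mem_range, Finset.mem_range] at hx
      rw [map_smul, hF _ (by omega) _ (by omega), ← Finset.sum_product', Finset.smul_sum]
      simp only [smul_smul]
    rw [LinearMap.comp_apply, hf r hr, ← Finset.sum_product', map_sum, Finset.sum_congr rfl e1,
      Finset.sum_comm]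
    simp only [← Finset.sum_smul, ← cgSum_eq_sum]
    rw [Finset.sum_product, Finset.sum_range]
    refine Finset.sum_congr rfl fun p _ => ?_
    rw [Finset.sum_range]

theorem sum_tmul_ne_zero (h : K) {d₁ d₂ : ℕ} (d : CoupledSpin d₁ d₂) :
    ∑ p : Fin (d₁ + 1), ∑ q : Fin (d₂ + 1),
      cgSum h d₁ d₂ d.1 p q d.1 • (e K d₁ p ⊗ₜ[K] e K d₂ q) ≠ 0 := by
  intro h0
  have := sum_tmul_injective (K := K) (c' := fun _ _ => 0) (h0.trans (by simp))
  obtain ⟨a, b, s, rfl, rfl, hd⟩ := exists_eq_of_coupledSpin d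
  rw [hd] at this
  exact cgSum_highest_ne_zero h a b s
    (this ⟨a + s, by omega⟩ ⟨b, by omega⟩)

/-- The admissible spins, numbered downwards from `j₁ + j₂`. -/
def coupledSpinEquiv (d₁ d₂ : ℕ) : Fin (min d₁ d₂ + 1) ≃ CoupledSpin d₁ d₂ where
  toFun s := ⟨d₁ + d₂ - 2 * s, by
    have := s.isLt
    refine ⟨by rw [abs_le]; omega, by omega, ⟨d₁ + d₂ - s, by omega⟩⟩⟩
  invFun d := ⟨(d₁ + d₂ - d.1) / 2, by
    have h1 := abs_le.1 d.2.1
    omega⟩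
  left_inv s := by
    have := s.isLt
    ext
    dsimp only
    omega
  right_inv d := by
    obtain ⟨d, h1, h2, k, h3⟩ := d
    ext
    dsimp only
    omega

instance (d₁ d₂ : ℕ) : Fintype (CoupledSpin d₁ d₂) := Fintype.ofEquiv _ (coupledSpinEquiv d₁ d₂)

theorem sum_coupledSpin (d₁ d₂ : ℕ) :
    ∑ d : CoupledSpin d₁ d₂, (d.1 + 1) = (d₁ + 1) * (d₂ + 1) := by
  rw [← (coupledSpinEquiv d₁ d₂).sum_comp (fun d => d.1 + 1)]
  -- The partial sums have a closed form over ℤ; the bound on n keeps the natural subtraction from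
  -- truncating.
  have key : ∀ n : ℕ, n ≤ min d₁ d₂ + 1 →
      ((∑ s ∈ Finset.range n, (d₁ + d₂ - 2 * s + 1) : ℕ) : ℤ) = n * (d₁ + d₂ + 2 - n) := by
    intro n hn
    induction n with
    | zero => simp
    | succ n ih =>
      rw [Finset.sum_range_succ, Nat.cast_add, ih (by omega),
        show ((d₁ + d₂ - 2 * n + 1 : ℕ) : ℤ) = d₁ + d₂ - 2 * n + 1 by omega]
      push_cast
      ring
  have h1 := key _ le_rfl
  rw [Finset.sum_range] at h1
  have h2 : ∑ s : Fin (min d₁ d₂ + 1), ((coupledSpinEquiv d₁ d₂ s).1 + 1)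
      = ∑ s : Fin (min d₁ d₂ + 1), (d₁ + d₂ - 2 * (s : ℕ) + 1) := rfl
  apply Nat.cast_injective (R := ℤ)
  rw [h2, h1]
  rcases le_total d₁ d₂ with hd | hd
  · rw [min_eq_left hd]
    push_cast
    ring
  · rw [min_eq_right hd]
    push_cast
    ring

end Decomposition

/-! ### Existence and uniqueness of the decomposition -/

section Uniqueness

variable {K : Type*} [Field K] [Algebra ℝ K]

theorem opz_e_last (h : K) (d : ℕ) : opz h d (e K d d) = 0 := by
  rw [opz, LinearMap.smul_apply, opZp_e]
  simp

theorem opT_e_last (h : K) (d : ℕ) : opT h d (e K d d) = e K d d := by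
  have := LinearMap.congr_fun (opT_mul h d) (e K d d)
  simpa [opz_e_last] using this

/-- If Ty = y, then (1-z)y = (1+z)y. Highest weight vectors are thereby characterized by the
generator T, which every isomorphism of representations respects. -/
theorem opz_eq_zero_of_opT_eq {h : K} {d : ℕ} {y : V K d} (hy : opT h d y = y) :
    opz h d y = 0 := by
  have h1 := LinearMap.congr_fun (mul_opT h d) y
  simp only [Module.End.mul_apply, hy, LinearMap.sub_apply, LinearMap.add_apply,
    Module.End.one_apply] at h1
  have h2 : (2 : K) • opz h d y = 0 := by
    rw [two_smul, ← sub_eq_zero.2 h1.symm]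
    abel
  exact (smul_eq_zero.1 h2).resolve_left (two_ne_zero' K)

theorem natCast_injective (K : Type*) [Field K] [Algebra ℝ K] :
    Function.Injective (fun n : ℕ => (n : K)) := fun m n hmn => by
  have : algebraMap ℝ K m = algebraMap ℝ K n := by simpa using hmn
  exact_mod_cast (algebraMap ℝ K).injective this

theorem opH_e_last (K : Type*) [Field K] (d : ℕ) : opH K d (e K d d) = (d : K) • e K d d := by
  rw [opH_e]
  congr 1
  ring

theorem eq_sum_lof {ι : Type*} [Fintype ι] [DecidableEq ι] {h : K} (hh : h ≠ 0) {n : ι → ℕ}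
    {x : ⨁ i, V K (n i)} (hx : ∀ i, opz h (n i) (x i) = 0) :
    x = ∑ i, x i (Fin.last (n i)) • DirectSum.lof K ι (fun i => V K (n i)) i (e K (n i) (n i)) := by
  conv_lhs => rw [← DirectSum.sum_univ_of x]
  refine Finset.sum_congr rfl fun i _ => ?_
  rw [← map_smul, ← eq_smul_of_opz_eq_zero hh (hx i)]
  rfl

/-- A homomorphism from the direct sum of the `V^(j)` which is compatible with the operator `zt`
is injective if it does not annihilate the highest weight vectors. -/
theorem toModule_injective {h : K} (hh : h ≠ 0) {ι M : Type*} [Fintype ι] [DecidableEq ι]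
    [AddCommGroup M] [Module K M] {n : ι → ℕ} (hn : Function.Injective n)
    (ρ : Uh h →ₐ[K] Module.End K M) (zt : Module.End K M) (f : ∀ i, V K (n i) →ₗ[K] M)
    (hf : ∀ i u, f i ∘ₗ rep h (n i) u = ρ u ∘ₗ f i) (hfz : ∀ i, f i ∘ₗ opz h (n i) = zt ∘ₗ f i)
    (hf0 : ∀ i, f i (e K (n i) (n i)) ≠ 0) :
    Function.Injective (DirectSum.toModule K ι M f) := by
  set g := DirectSum.toModule K ι M f with hg
  set E := DirectSum.lmap (fun i => opz h (n i)) with hE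
  have hgE : ∀ x, g (E x) = zt (g x) := by
    have : g ∘ₗ E = zt ∘ₗ g := by
      refine DirectSum.linearMap_ext K fun i => LinearMap.ext fun x => ?_
      simp only [LinearMap.comp_apply, hE, hg, DirectSum.lmap_lof, DirectSum.toModule_lof]
      exact LinearMap.congr_fun (hfz i) x
    exact LinearMap.congr_fun this
  have hEpow : ∀ (m : ℕ) x i, (E ^ m) x i = (opz h (n i) ^ m) (x i) := by
    intro m
    induction m with
    | zero => simp
    | succ m ih =>
      intro x i
      rw [pow_succ', Module.End.mul_apply, pow_succ', Module.End.mul_apply, ← ih]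
      rfl
  -- The images of the highest weight vectors are eigenvectors of H with the distinct eigenvalues n
  -- i.
  have hlin : LinearIndependent K fun i => f i (e K (n i) (n i)) := by
    refine Module.End.eigenvectors_linearIndependent' (ρ (gen h .H)) (fun i => (n i : K))
      ((natCast_injective K).comp hn) _ fun i => ⟨?_, hf0 i⟩
    rw [Module.End.mem_eigenspace_iff]
    have := LinearMap.congr_fun (hf i (gen h .H)) (e K (n i) (n i))
    rw [LinearMap.comp_apply, LinearMap.comp_apply, rep_H, opH_e_last, map_smul] at this
    exact this.symm
  refine (injective_iff_map_eq_zero g).2 fun x hx => ?_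
  by_contra hx0
  -- The kernel of `g` is stable under `E`. The last nonzero E^m x in it is a combination of highest
  -- weight vectors, whose images are independent. The exponent 1 + ∑ n i annihilates every summand.
  obtain ⟨m, hm, hm'⟩ := exists_pow_ne_zero_of_pow_eq_zero E hx0
    (n := (∑ i, n i) + 1) (by
      refine DFinsupp.ext fun i => ?_
      rw [hEpow]
      have : n i + 1 ≤ (∑ i, n i) + 1 := by
        have := Finset.single_le_sum (f := n) (fun _ _ => Nat.zero_le _) (Finset.mem_univ i)
        omega
      rw [pow_eq_zero_of_le this (opz_nilp h (n i))]
      rfl)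
  have hgm : ∀ m, g ((E ^ m) x) = 0 := by
    intro m
    induction m with
    | zero => simpa using hx
    | succ m ih => rw [pow_succ', Module.End.mul_apply, hgE, ih, map_zero]
  set y := (E ^ m) x with hy
  have hyz : ∀ i, opz h (n i) (y i) = 0 := fun i => by
    have := congrArg (fun w => w i) hm'
    exact this
  have hys := eq_sum_lof hh hyz
  have hgy := hgm m
  rw [← hy, hys, map_sum] at hgy
  simp only [map_smul, hg, DirectSum.toModule_lof] at hgy
  have hc := Fintype.linearIndependent_iff.1 hlin _ hgy
  apply hm
  rw [hys]
  exact Finset.sum_eq_zero fun i _ => by rw [hc i, zero_smul]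

theorem isClebschGordan_cgSum {h : K} (hh : h ≠ 0) (d₁ d₂ : ℕ) :
    IsClebschGordan h d₁ d₂ (fun d p q r => cgSum h d₁ d₂ d.1 p q r) := by
  obtain ⟨zt, H⟩ := exists_embedding hh d₁ d₂
  choose f hf hfz hfe using H
  have hinj : Function.Injective (DirectSum.toModule K (CoupledSpin d₁ d₂) _ f) :=
    toModule_injective hh Subtype.val_injective (tensorRep h (rep h d₁) (rep h d₂)) zt f hf hfz
      fun d => by rw [hfe d _ le_rfl]; exact sum_tmul_ne_zero h d
  have hdim : Module.finrank K (⨁ d : CoupledSpin d₁ d₂, V K d.1)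
      = Module.finrank K (V K d₁ ⊗[K] V K d₂) := by
    rw [Module.finrank_directSum, Module.finrank_tensorProduct]
    simp only [Module.finrank_fin_fun]
    exact sum_coupledSpin d₁ d₂
  have hbij : Function.Bijective (DirectSum.toModule K (CoupledSpin d₁ d₂) _ f) :=
    ⟨hinj, (LinearMap.injective_iff_surjective_of_finrank_eq_finrank hdim).1 hinj⟩
  obtain ⟨Φ, hΦ⟩ : ∃ Φ : (⨁ d : CoupledSpin d₁ d₂, V K d.1) ≃ₗ[K] V K d₁ ⊗[K] V K d₂,
      ∀ x, Φ x = DirectSum.toModule K (CoupledSpin d₁ d₂) _ f x :=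
    ⟨LinearEquiv.ofBijective _ hbij, fun x => rfl⟩
  refine ⟨Φ, fun u => ?_, fun d r => ?_⟩
  · refine DirectSum.linearMap_ext K fun d => LinearMap.ext fun x => ?_
    simp only [LinearMap.comp_apply, LinearEquiv.coe_coe, hΦ,
      DirectSum.lmap_lof, DirectSum.toModule_lof]
    exact LinearMap.congr_fun (hf d u) x
  · rw [hΦ, DirectSum.toModule_lof]
    exact hfe d r (by have := r.isLt; omega)

/-- Clebsch-Gordan coefficients are determined up to a factor for each spin. -/
theorem IsClebschGordan.exists_eq_mul {h : K} (hh : h ≠ 0) {d₁ d₂ : ℕ}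
    {𝒞 𝒟 : (d : CoupledSpin d₁ d₂) → Fin (d₁ + 1) → Fin (d₂ + 1) → Fin (d.1 + 1) → K}
    (h𝒞 : IsClebschGordan h d₁ d₂ 𝒞) (h𝒟 : IsClebschGordan h d₁ d₂ 𝒟) :
    ∃ c : CoupledSpin d₁ d₂ → K, (∀ d, c d ≠ 0) ∧ ∀ d p q r, 𝒟 d p q r = c d * 𝒞 d p q r := by
  obtain ⟨f, hf, hfe⟩ := h𝒞
  obtain ⟨g, hg, hge⟩ := h𝒟
  have hf' : ∀ u x, f (DirectSum.lmap (fun d : CoupledSpin d₁ d₂ => rep h d.1 u) x)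
      = tensorRep h (rep h d₁) (rep h d₂) u (f x) := fun u => LinearMap.congr_fun (hf u)
  have hg' : ∀ u x, g (DirectSum.lmap (fun d : CoupledSpin d₁ d₂ => rep h d.1 u) x)
      = tensorRep h (rep h d₁) (rep h d₂) u (g x) := fun u => LinearMap.congr_fun (hg u)
  suffices H : ∀ d : CoupledSpin d₁ d₂, ∃ c : K, c ≠ 0 ∧
      ∀ p q r, 𝒟 d p q r = c * 𝒞 d p q r from ⟨fun d => (H d).choose,
        fun d => (H d).choose_spec.1, fun d => (H d).choose_spec.2⟩
  intro d
  set ι := DirectSum.lof K (CoupledSpin d₁ d₂) (fun d => V K d.1) with hι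
  have hιinj : Function.Injective (ι d) := DirectSum.of_injective d
  -- The highest weight vector of the second decomposition, seen in the first: fixed by T and of
  -- H-weight d. As each spin occurs once, it is a multiple of the vector of the same spin.
  set x := f.symm (g (ι d (e K d.1 d.1))) with hx
  have hιu : ∀ u w, ι d (rep h d.1 u w)
      = DirectSum.lmap (fun d : CoupledSpin d₁ d₂ => rep h d.1 u) (ι d w) :=
    fun u w => (DirectSum.lmap_lof (fun d : CoupledSpin d₁ d₂ => rep h d.1 u) d w).symm
  have hxu : ∀ u, DirectSum.lmap (fun d : CoupledSpin d₁ d₂ => rep h d.1 u) x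
      = f.symm (g (ι d (rep h d.1 u (e K d.1 d.1)))) := fun u => by
    rw [LinearEquiv.eq_symm_apply, hf', hx, LinearEquiv.apply_symm_apply, ← hg', hιu]
  have hxz : ∀ i, opz h i.1 (x i) = 0 := fun i => by
    apply opz_eq_zero_of_opT_eq
    have := congrArg (fun w => w i) (hxu (gen h .T))
    rwa [rep_T, opT_e_last, DirectSum.lmap_apply, rep_T] at this
  obtain ⟨c, hc⟩ : ∃ c : K, x = c • ι d (e K d.1 d.1) := by
    refine ⟨x d (Fin.last d.1), ?_⟩
    conv_lhs => rw [eq_sum_lof hh hxz]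
    refine Finset.sum_eq_single d (fun i _ hid => ?_) (fun hd => absurd (Finset.mem_univ d) hd)
    have h1 := congrArg (fun w => w i (Fin.last i.1)) (hxu (gen h .H))
    dsimp only at h1
    rw [rep_H, opH_e_last, DirectSum.lmap_apply, rep_H, opH_apply, map_smul, map_smul, map_smul,
      ← hx, DirectSum.smul_apply, Pi.smul_apply, smul_eq_mul, Fin.val_last, two_mul,
      add_sub_cancel_right, mul_eq_mul_right_iff] at h1
    rw [h1.resolve_left fun h2 => hid (Subtype.ext (natCast_injective K h2)), zero_smul]
  have hgc : g (ι d (e K d.1 d.1)) = c • f (ι d (e K d.1 d.1)) := by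
    rw [← map_smul, ← hc, hx, LinearEquiv.apply_symm_apply]
  -- Schur's argument without eigenvalues: the scalar c is already known on the highest weight
  -- vector, so the kernel of the difference is a nonzero subrepresentation.
  have hker := rep_irreducible hh d.1
    (LinearMap.ker (g.toLinearMap ∘ₗ ι d - c • (f.toLinearMap ∘ₗ ι d))) fun u w hw => by
      rw [LinearMap.mem_ker] at hw ⊢
      simp only [LinearMap.sub_apply, LinearMap.smul_apply, LinearMap.comp_apply,
        LinearEquiv.coe_coe] at hw ⊢
      rw [hιu, hf', hg', ← map_smul, ← map_sub, hw, map_zero]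
  have hmem : e K d.1 d.1 ∈ LinearMap.ker (g.toLinearMap ∘ₗ ι d - c • (f.toLinearMap ∘ₗ ι d)) := by
    rw [LinearMap.mem_ker]
    simp only [LinearMap.sub_apply, LinearMap.smul_apply, LinearMap.comp_apply,
        LinearEquiv.coe_coe, hgc, sub_self]
  have htop := hker.resolve_left fun h0 => by
    rw [h0, Submodule.mem_bot] at hmem
    exact e_ne_zero le_rfl hmem
  refine ⟨c, ?_, fun p q r => ?_⟩
  · rintro rfl
    rw [zero_smul, LinearEquiv.map_eq_zero_iff] at hgc
    exact e_ne_zero le_rfl (hιinj (hgc.trans (map_zero _).symm))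
  · have h1 : e K d.1 r ∈ LinearMap.ker (g.toLinearMap ∘ₗ ι d - c • (f.toLinearMap ∘ₗ ι d)) := by
      rw [htop]; trivial
    rw [LinearMap.mem_ker] at h1
    simp only [LinearMap.sub_apply, LinearMap.smul_apply, LinearMap.comp_apply,
        LinearEquiv.coe_coe, sub_eq_zero] at h1
    rw [hge, hfe, Finset.smul_sum] at h1
    simp only [Finset.smul_sum, smul_smul] at h1
    exact sum_tmul_injective (c := fun p q => 𝒟 d p q r) (c' := fun p q => c * 𝒞 d p q r) h1 p q

end Uniqueness

end Jordanian

end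

/-- Here `d₁ = 2 j₁` and `d₂ = 2 j₂`. The representations `V^(j)` are irreducible, the tensor
product of two of them is the direct sum of the `V^(j)`, `j = |j₁ - j₂|, …, j₁ + j₂`, with the
stated Clebsch-Gordan coefficients, and these are the only ones up to a factor for each `j`. -/
theorem proposition5 {K : Type*} [Field K] [Algebra ℝ K] (h : K) (hh : h ≠ 0) (d₁ d₂ : ℕ) :
    (∀ (d : ℕ) (W : Submodule K (Jordanian.V K d)),
      (∀ (u : Jordanian.Uh h), ∀ w ∈ W, Jordanian.rep h d u w ∈ W) → W = ⊥ ∨ W = ⊤) ∧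
    Jordanian.IsClebschGordan h d₁ d₂
      (fun d p q r => Jordanian.cgSum h d₁ d₂ d.1 p q r) ∧
    ∀ 𝒞 : (d : Jordanian.CoupledSpin d₁ d₂) → Fin (d₁ + 1) → Fin (d₂ + 1) → Fin (d.1 + 1) → K,
      Jordanian.IsClebschGordan h d₁ d₂ 𝒞 →
        ∃ c : Jordanian.CoupledSpin d₁ d₂ → K, (∀ d, c d ≠ 0) ∧
          ∀ d p q r, 𝒞 d p q r = c d * Jordanian.cgSum h d₁ d₂ d.1 p q r := by
  have existence := Jordanian.isClebschGordan_cgSum hh d₁ d₂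
  exact ⟨fun d W hW => Jordanian.rep_irreducible hh d W hW, existence,
    fun _ h𝒞 => existence.exists_eq_mul hh h𝒞⟩
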